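/- Let $p\ge 2$ be an integer, $\mathfrak q=e^{i\pi/p}$, $[n]=\frac{\mathfrak q^n-\mathfrak q^{-n}}{\mathfrak q-\mathfrak q^{-1}}$, and let $\overline{\mathscr U}_{\mathfrak q}s\ell(2)$ be the $2p^3$-dimensional algebra generated by $E,F,K^{\pm1}$ with relations $KEK^{-1}=\mathfrak q^2E$, $KFK^{-1}=\mathfrak q^{-2}F$, $[E,F]=\frac{K-K^{-1}}{\mathfrak q-\mathfrak q^{-1}}$, $E^p=F^p=0$, $K^{2p}=1$. Let $\underline{\mathbb C}_{\mathfrak q}$ (the divided-power quantum plane) be the space with basis $x^{(m)}y^{(n)}$, $m,n\ge0$, and $\underline\Omega^1_{\mathfrak q}$ (the $1$-forms) the space with basis $x^{(m)}y^{(n)}\xi$, $x^{(m)}y^{(n)}\eta$, $m,n\ge 0$ (monomials with a negative exponent are zero). The algebra $\overline{\mathscr U}_{\mathfrak q}s\ell(2)$ acts on $\underline{\mathbb C}_{\mathfrak q}$ by $$E(x^{(m)}y^{(n)})=[m+1]x^{(m+1)}y^{(n-1)},\quad K(x^{(m)}y^{(n)})=\mathfrak q^{m-n}x^{(m)}y^{(n)},\quad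 F(x^{(m)}y^{(n)})=[n+1]x^{(m-1)}y^{(n+1)},$$ and on $\underline\Omega^1_{\mathfrak q}$ by $$\begin{aligned} E(x^{(m)}y^{(n)}\xi)&=\mathfrak q[m+1]x^{(m+1)}y^{(n-1)}\xi,& E(x^{(m)}y^{(n)}\eta)&=\mathfrak q^{-1}[m+1]x^{(m+1)}y^{(n-1)}\eta+x^{(m)}y^{(n)}\xi,\\ K(x^{(m)}y^{(n)}\xi)&=\mathfrak q^{m-n+1}x^{(m)}y^{(n)}\xi,& K(x^{(m)}y^{(n)}\eta)&=\mathfrak q^{m-n-1}x^{(m)}y^{(n)}\eta,\\ F(x^{(m)}y^{(n)}\xi)&=[n+1]x^{(m-1)}y^{(n+1)}\xi+\mathfrak q^{n-m}x^{(m)}y^{(n)}\eta,& F(x^{(m)}y^{(n)}\eta)&=[n+1]x^{(m-1)}y^{(n+1)}\eta. \end{aligned}$$ The differential $d:\underline{\mathbb C}_{\mathfrak q}\to\underline\Omega^1_{\mathfrak q}$, $d(x^{(m)}y^{(n)})=\mathfrak q^{m+n-1}x^{(m-1)}y^{(n)}\xi+\mathfrak q^{n-1}x^{(m)}y^{(n-1)}\eta$,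 commutes with these actions. Let $(\underline{\mathbb C}_{\mathfrak q})_i$ and $(\underline\Omega^1_{\mathfrak q})_i$ be the spans of the basis elements with $m+n=i$ (these are submodules), and let $(\underline\Omega^1_{\mathfrak q})_{(i)}=\bigoplus_{j\le i}(\underline\Omega^1_{\mathfrak q})_j$. For $1\le r\le p$, let $X^\pm_r$ be the $r$-dimensional irreducible module with basis $v_0,\dots,v_{r-1}$ and $Kv_s=\pm\mathfrak q^{r-1-2s}v_s$, $Ev_s=\pm[s][r-s]v_{s-1}$, $Fv_s=v_{s+1}$ ($v_{-1}=v_r=0$); let $P^\pm_r$ be the projective cover of $X^\pm_r$. For $1\le r\le p-1$, $n\ge2$, let $W^\pm_r(n)$ be the indecomposable zigzag module $$X^\pm_r\to X^\mp_{p-r}\leftarrow X^\pm_r\to\cdots\leftarrow X^\pm_r$$ with $n$ copies of $X^\pm_r$ on top and $n-1$ copies of $X^\mp_{p-r}$ in the socle, where, in addition to the actions inside the copies, $F$ sends the last basis vector of the $i$th top copy to the first basis vector of the $i$th socle copy, and $E$ sends the first basis vector of the $(i+1)$st top copy to the last basis vector of the $i$th socle copy ($1\le i\le n-1$). If $S\subset\underline{\mathbb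 C}_{\mathfrak q}$ is a submodule isomorphic to $M$ on which $d$ is injective, the isomorphic image $d(S)\subset\underline\Omega^1_{\mathfrak q}$ is denoted $dM$; $kM$ stands for a direct sum of $k$ submodules isomorphic to $M$ (respectively of the form $dM$). Then there are the following direct sum decompositions into $\overline{\mathscr U}_{\mathfrak q}s\ell(2)$-submodules. First, $$(\underline\Omega^1_{\mathfrak q})_{(p-1)}=\bigoplus_{r=2}^{p}dX^+_r\oplus\bigoplus_{r=1}^{p-2}X^+_r\oplus P^+_{p-1}$$ with $dX^+_r\subset(\underline\Omega^1_{\mathfrak q})_{r-2}$, $X^+_r\subset(\underline\Omega^1_{\mathfrak q})_{r}$ and $P^+_{p-1}\subset(\underline\Omega^1_{\mathfrak q})_{p-1}$. Next, for every $n\ge2$, $$(\underline\Omega^1_{\mathfrak q})_{(np-1)}=(\underline\Omega^1_{\mathfrak q})_{((n-1)p-1)}\oplus\bigoplus_{r=2}^{p-1}dW^\pm_r(n)\oplus n\,dX^\pm_p\oplus(n-1)X^\mp_p\oplus\bigoplus_{r=1}^{p-2}W^\pm_r(n)\oplus nP^\pm_{p-1}$$ with the upper signs for odd $n$ and the lower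 signs for even $n$, where $dW^\pm_r(n)\subset(\underline\Omega^1_{\mathfrak q})_{(n-1)p+r-2}$, each $dX^\pm_p\subset(\underline\Omega^1_{\mathfrak q})_{np-2}$, each $X^\mp_p\subset(\underline\Omega^1_{\mathfrak q})_{(n-1)p}$, $W^\pm_r(n)\subset(\underline\Omega^1_{\mathfrak q})_{(n-1)p+r}$, and each $P^\pm_{p-1}\subset(\underline\Omega^1_{\mathfrak q})_{np-1}$. -/

import Mathlib

noncomputable section

namespace QPlane

/-! ### The root of unity and the quantum integers -/

/-- The root of unity `𝔮 = exp(iπ/p)`. -/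
def q (p : ℕ) : ℂ := Complex.exp (Real.pi * Complex.I / p)

/-- The quantum integer `[n] = (𝔮^n - 𝔮^(-n)) / (𝔮 - 𝔮⁻¹)`. -/
def qInt (p : ℕ) (n : ℤ) : ℂ := (q p ^ n - q p ^ (-n)) / (q p - (q p)⁻¹)

/-! ### The restricted quantum group -/

/-- Generators of the quantum group. -/
inductive Gen
  | E | F | K | Kinv

open FreeAlgebra in
/-- Defining relations of the `2p³`-dimensional quantum group. -/
inductive Rel (p : ℕ) : FreeAlgebra ℂ Gen → FreeAlgebra ℂ Gen → Prop
  | K_mul_Kinv : Rel p (ι ℂ Gen.K * ι ℂ Gen.Kinv) 1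
  | Kinv_mul_K : Rel p (ι ℂ Gen.Kinv * ι ℂ Gen.K) 1
  | KE : Rel p (ι ℂ Gen.K * ι ℂ Gen.E * ι ℂ Gen.Kinv) (q p ^ (2 : ℤ) • ι ℂ Gen.E)
  | KF : Rel p (ι ℂ Gen.K * ι ℂ Gen.F * ι ℂ Gen.Kinv) (q p ^ (-2 : ℤ) • ι ℂ Gen.F)
  | EF : Rel p (ι ℂ Gen.E * ι ℂ Gen.F - ι ℂ Gen.F * ι ℂ Gen.E)
      ((q p - (q p)⁻¹)⁻¹ • (ι ℂ Gen.K - ι ℂ Gen.Kinv))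
  | E_pow : Rel p (ι ℂ Gen.E ^ p) 0
  | F_pow : Rel p (ι ℂ Gen.F ^ p) 0
  | K_pow : Rel p (ι ℂ Gen.K ^ (2 * p)) 1

/-- The restricted quantum group `Ū_𝔮 sl(2)` at `𝔮 = exp(iπ/p)`, as an associative algebra. -/
abbrev Uq (p : ℕ) : Type := RingQuot (Rel p)

/-- The image of a generator in `Ū_𝔮 sl(2)`. -/
def Uq.gen (p : ℕ) (g : Gen) : Uq p := RingQuot.mkAlgHom ℂ (Rel p) (FreeAlgebra.ι ℂ g)

/-- The generator `E` of `Ū_𝔮 sl(2)`. -/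
abbrev Uq.E (p : ℕ) : Uq p := Uq.gen p Gen.E
/-- The generator `F` of `Ū_𝔮 sl(2)`. -/
abbrev Uq.F (p : ℕ) : Uq p := Uq.gen p Gen.F
/-- The generator `K` of `Ū_𝔮 sl(2)`. -/
abbrev Uq.K (p : ℕ) : Uq p := Uq.gen p Gen.K

section Representation

variable {p : ℕ} {V : Type*} [AddCommGroup V] [Module ℂ V]

/-- Operators that satisfy the defining relations give an algebra map from `Ū_𝔮 sl(2)`. -/
def Uq.toEnd (g : Gen → Module.End ℂ V)
    (h : ∀ ⦃a b⦄, Rel p a b → FreeAlgebra.lift ℂ g a = FreeAlgebra.lift ℂ g b) :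
    Uq p →ₐ[ℂ] Module.End ℂ V :=
  RingQuot.liftAlgHom ℂ ⟨FreeAlgebra.lift ℂ g, h⟩

theorem Uq.toEnd_gen (g : Gen → Module.End ℂ V)
    (h : ∀ ⦃a b⦄, Rel p a b → FreeAlgebra.lift ℂ g a = FreeAlgebra.lift ℂ g b) (x : Gen) :
    Uq.toEnd g h (Uq.gen p x) = g x := by
  simp [Uq.toEnd, Uq.gen]

/-- Induction principle for `Ū_𝔮 sl(2)`. -/
theorem Uq.induction {C : Uq p → Prop} (hc : ∀ c : ℂ, C (algebraMap ℂ _ c))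
    (hg : ∀ g, C (Uq.gen p g)) (ha : ∀ a b, C a → C b → C (a + b))
    (hm : ∀ a b, C a → C b → C (a * b)) (a : Uq p) : C a := by
  obtain ⟨x, rfl⟩ := RingQuot.mkAlgHom_surjective ℂ (Rel p) a
  induction x using FreeAlgebra.induction with
  | grade0 c => simpa using hc c
  | grade1 g => exact hg g
  | mul a b ha hb => rw [map_mul]; exact hm _ _ ha hb
  | add a b hha hb => rw [map_add]; exact ha _ _ hha hb

theorem rel_of (g : Gen → Module.End ℂ V)
    (h1 : g Gen.K * g Gen.Kinv = 1) (h2 : g Gen.Kinv * g Gen.K = 1)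
    (h3 : g Gen.K * g Gen.E = q p ^ (2 : ℤ) • (g Gen.E * g Gen.K))
    (h4 : g Gen.K * g Gen.F = q p ^ (-2 : ℤ) • (g Gen.F * g Gen.K))
    (h5 : g Gen.E * g Gen.F - g Gen.F * g Gen.E
      = (q p - (q p)⁻¹)⁻¹ • (g Gen.K - g Gen.Kinv))
    (h6 : g Gen.E ^ p = 0) (h7 : g Gen.F ^ p = 0) (h8 : g Gen.K ^ (2 * p) = 1) :
    ∀ ⦃a b⦄, Rel p a b → FreeAlgebra.lift ℂ g a = FreeAlgebra.lift ℂ g b := by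
  intro a b h
  cases h with
  | K_mul_Kinv => simpa using h1
  | Kinv_mul_K => simpa using h2
  | KE => simp only [map_mul, FreeAlgebra.lift_ι_apply, h3, map_smul]; simp [mul_assoc, h1]
  | KF => simp only [map_mul, FreeAlgebra.lift_ι_apply, h4, map_smul]; simp [mul_assoc, h1]
  | EF => simpa using h5
  | E_pow => simpa using h6
  | F_pow => simpa using h7
  | K_pow => simpa using h8

end Representation

theorem qInt_zero (p : ℕ) : qInt p 0 = 0 := by simp [qInt]

/-! ### Elementary facts on the root of unity -/

theorem q_ne_zero (p : ℕ) : q p ≠ 0 := Complex.exp_ne_zero _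

section
variable (p : ℕ) [hp : p.AtLeastTwo]

theorem two_le : 2 ≤ p := hp.prop

theorem q_primitive : IsPrimitiveRoot (q p) (2 * p) := by
  have h := Complex.isPrimitiveRoot_exp (2 * p) (by have := two_le p; omega)
  have e : q p = Complex.exp (2 * Real.pi * Complex.I / ((2 * p : ℕ) : ℂ)) := by
    unfold q; congr 1; push_cast
    rw [mul_assoc (2 : ℂ), mul_div_mul_left _ _ two_ne_zero]
  rw [e]; exact h

theorem q_sub_ne_zero : q p - (q p)⁻¹ ≠ 0 := by
  intro h
  have h0 := q_ne_zero p
  have : q p ^ 2 = 1 := by field_simp at h; linear_combination h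
  have := Nat.le_of_dvd (by norm_num) ((q_primitive p).dvd_of_pow_eq_one _ this)
  have := two_le p
  omega

theorem qInt_of_dvd {n : ℤ} (h : (p : ℤ) ∣ n) : qInt p n = 0 := by
  obtain ⟨k, rfl⟩ := h
  have h1 : q p ^ (2 * p : ℤ) = 1 := by
    exact_mod_cast (q_primitive p).pow_eq_one
  have h2 : q p ^ ((p : ℤ) * k) = q p ^ (-((p : ℤ) * k)) := by
    have : (p : ℤ) * k = 2 * p * k + -(p * k) := by ring
    conv_lhs => rw [this, zpow_add₀ (q_ne_zero p), zpow_mul, h1, one_zpow, one_mul]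
  rw [qInt, ← h2, sub_self, zero_div]

theorem qInt_one : qInt p 1 = 1 := by
  rw [qInt, zpow_neg, zpow_one, div_self (q_sub_ne_zero p)]

theorem qInt_comm (m n : ℤ) :
    qInt p m * qInt p (n + 1) - qInt p (m + 1) * qInt p n
      = (q p - (q p)⁻¹)⁻¹ * (q p ^ (m - n) - q p ^ (n - m)) := by
  have h := q_sub_ne_zero p
  have h0 := q_ne_zero p
  simp only [qInt, neg_add, sub_eq_add_neg m, sub_eq_add_neg n, zpow_add₀ h0, zpow_neg, zpow_one]
  have hm := zpow_ne_zero m h0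
  have hn := zpow_ne_zero n h0
  generalize q p ^ m = a at *
  generalize q p ^ n = b at *
  have key : (a - a⁻¹) * (b * q p - b⁻¹ * (q p)⁻¹) - (a * q p - a⁻¹ * (q p)⁻¹) * (b - b⁻¹)
      = (q p - (q p)⁻¹) * (a * b⁻¹ - b * a⁻¹) := by ring
  rw [div_mul_div_comm, div_mul_div_comm, ← sub_div, key, mul_div_mul_left _ _ h,
    inv_mul_eq_div]

theorem qInt_succ (n : ℤ) : qInt p (n + 1) = q p * qInt p n + q p ^ (-n) := by
  have h := q_sub_ne_zero p
  have h0 := q_ne_zero p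
  simp only [qInt, neg_add, zpow_add₀ h0, zpow_neg, zpow_one]
  have hn := zpow_ne_zero n h0
  generalize q p ^ n = b at *
  rw [div_eq_iff h, add_mul, mul_assoc, div_mul_cancel₀ _ h]
  field_simp
  ring

theorem qInt_succ_inv (n : ℤ) : qInt p (n + 1) = (q p)⁻¹ * qInt p n + q p ^ n := by
  have h := q_sub_ne_zero p
  have h0 := q_ne_zero p
  simp only [qInt, neg_add, zpow_add₀ h0, zpow_neg, zpow_one]
  have hn := zpow_ne_zero n h0
  generalize q p ^ n = b at *
  rw [div_eq_iff h, add_mul, mul_assoc, div_mul_cancel₀ _ h]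
  field_simp
  ring

theorem prod_qInt (m : ℤ) : ∏ i ∈ Finset.range p, qInt p (m + 1 + i) = 0 := by
  have hp := two_le p
  have h0 : (0 : ℤ) < p := by omega
  refine Finset.prod_eq_zero (i := ((-(m + 1)) % p).toNat) ?_ ?_
  · have h1 := Int.emod_nonneg (-(m + 1)) h0.ne'
    have h2 := Int.emod_lt_of_pos (-(m + 1)) h0
    rw [Finset.mem_range]; omega
  · apply qInt_of_dvd
    rw [Int.toNat_of_nonneg (Int.emod_nonneg _ h0.ne')]
    have := Int.emod_add_mul_ediv (-(m + 1)) p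
    exact ⟨-(-(m + 1) / p), by linarith⟩

end

/-! ### The divided-power quantum plane -/

/-- The underlying space of the divided-power quantum plane: the complex vector space with basis
the monomials `x⁽ᵐ⁾y⁽ⁿ⁾`, `m, n ≥ 0`. -/
def Plane (_p : ℕ) : Type := (ℕ × ℕ) →₀ ℂ

instance (p : ℕ) : AddCommGroup (Plane p) := inferInstanceAs (AddCommGroup ((ℕ × ℕ) →₀ ℂ))
instance instModulePlane (p : ℕ) : Module ℂ (Plane p) := inferInstanceAs (Module ℂ ((ℕ × ℕ) →₀ ℂ))

namespace Plane

/-- The basis of monomials: `(m, n)` stands for `x⁽ᵐ⁾y⁽ⁿ⁾`. -/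
def basis (p : ℕ) : Module.Basis (ℕ × ℕ) ℂ (Plane p) := ⟨LinearEquiv.refl ℂ ((ℕ × ℕ) →₀ ℂ)⟩

/-- The monomial `x⁽ᵐ⁾y⁽ⁿ⁾`, with the convention that it vanishes if `m < 0` or `n < 0`. -/
def mon (p : ℕ) (m n : ℤ) : Plane p :=
  if 0 ≤ m ∧ 0 ≤ n then basis p (m.toNat, n.toNat) else 0

theorem mon_neg (p : ℕ) {m n : ℤ} (h : ¬ (0 ≤ m ∧ 0 ≤ n)) : mon p m n = 0 := if_neg h

/-- The linear map on the quantum plane with prescribed values on the monomials. -/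
def lin {p : ℕ} {V : Type*} [AddCommGroup V] [Module ℂ V] (f : ℤ → ℤ → V) : Plane p →ₗ[ℂ] V :=
  (basis p).constr ℂ fun i => f i.1 i.2

theorem lin_mon {p : ℕ} {V : Type*} [AddCommGroup V] [Module ℂ V] (f : ℤ → ℤ → V)
    (hf : ∀ m n : ℤ, ¬ (0 ≤ m ∧ 0 ≤ n) → f m n = 0) (m n : ℤ) :
    lin f (mon p m n) = f m n := by
  by_cases h : 0 ≤ m ∧ 0 ≤ n
  · rw [mon, if_pos h, lin, Module.Basis.constr_basis, Int.toNat_of_nonneg h.1,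
      Int.toNat_of_nonneg h.2]
  · rw [mon_neg p h, map_zero, hf m n h]

theorem hom_ext {p : ℕ} {V : Type*} [AddCommGroup V] [Module ℂ V] {f g : Plane p →ₗ[ℂ] V}
    (h : ∀ m n : ℤ, f (mon p m n) = g (mon p m n)) : f = g := by
  refine (basis p).ext fun i => ?_
  have := h i.1 i.2
  simpa [mon] using this

/-- `E(x⁽ᵐ⁾y⁽ⁿ⁾) = [m+1] x⁽ᵐ⁺¹⁾y⁽ⁿ⁻¹⁾`. -/
def opE (p : ℕ) : Module.End ℂ (Plane p) :=
  lin fun m n => qInt p (m + 1) • mon p (m + 1) (n - 1)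

/-- `F(x⁽ᵐ⁾y⁽ⁿ⁾) = [n+1] x⁽ᵐ⁻¹⁾y⁽ⁿ⁺¹⁾`. -/
def opF (p : ℕ) : Module.End ℂ (Plane p) :=
  lin fun m n => qInt p (n + 1) • mon p (m - 1) (n + 1)

/-- `K(x⁽ᵐ⁾y⁽ⁿ⁾) = 𝔮^(m-n) x⁽ᵐ⁾y⁽ⁿ⁾`. -/
def opK (p : ℕ) : Module.End ℂ (Plane p) := lin fun m n => q p ^ (m - n) • mon p m n

/-- The inverse of `K`. -/
def opKinv (p : ℕ) : Module.End ℂ (Plane p) := lin fun m n => q p ^ (n - m) • mon p m n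

/-- The operators by which the generators act on the quantum plane. -/
def op (p : ℕ) : Gen → Module.End ℂ (Plane p)
  | Gen.E => opE p
  | Gen.F => opF p
  | Gen.K => opK p
  | Gen.Kinv => opKinv p

theorem vanish_E (p : ℕ) [p.AtLeastTwo] {V : Type*} [AddCommGroup V] [Module ℂ V]
    (f : ℤ → ℤ → V) (hf : ∀ m n : ℤ, ¬ (0 ≤ m ∧ 0 ≤ n) → f m n = 0) (m n : ℤ)
    (h : ¬ (0 ≤ m ∧ 0 ≤ n)) : qInt p (m + 1) • f (m + 1) (n - 1) = 0 := by
  by_cases hm : m = -1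
  · subst hm; simp [qInt_zero]
  · rw [hf _ _ (by omega), smul_zero]

theorem vanish_F (p : ℕ) [p.AtLeastTwo] {V : Type*} [AddCommGroup V] [Module ℂ V]
    (f : ℤ → ℤ → V) (hf : ∀ m n : ℤ, ¬ (0 ≤ m ∧ 0 ≤ n) → f m n = 0) (m n : ℤ)
    (h : ¬ (0 ≤ m ∧ 0 ≤ n)) : qInt p (n + 1) • f (m - 1) (n + 1) = 0 := by
  by_cases hn : n = -1
  · subst hn; simp [qInt_zero]
  · rw [hf _ _ (by omega), smul_zero]

section
variable (p : ℕ) (m n : ℤ)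

theorem opE_mon [p.AtLeastTwo] : opE p (mon p m n) = qInt p (m + 1) • mon p (m + 1) (n - 1) :=
  lin_mon _ (vanish_E p (mon p) fun _ _ => mon_neg p) m n

theorem opF_mon [p.AtLeastTwo] : opF p (mon p m n) = qInt p (n + 1) • mon p (m - 1) (n + 1) :=
  lin_mon _ (vanish_F p (mon p) fun _ _ => mon_neg p) m n

theorem opK_mon : opK p (mon p m n) = q p ^ (m - n) • mon p m n :=
  lin_mon _ (fun m n h => by rw [mon_neg p h, smul_zero]) m n

theorem opKinv_mon : opKinv p (mon p m n) = q p ^ (n - m) • mon p m n :=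
  lin_mon _ (fun m n h => by rw [mon_neg p h, smul_zero]) m n

end

theorem opE_pow (p : ℕ) [p.AtLeastTwo] (j : ℕ) (m n : ℤ) : (opE p ^ j) (mon p m n)
    = (∏ i ∈ Finset.range j, qInt p (m + 1 + i)) • mon p (m + j) (n - j) := by
  induction j with
  | zero => simp
  | succ j ih =>
    rw [pow_succ', Module.End.mul_apply, ih, map_smul, opE_mon, smul_smul, Finset.prod_range_succ]
    congr 2
    · congr 1; ring
    · push_cast; ring
    · push_cast; ring

theorem opF_pow (p : ℕ) [p.AtLeastTwo] (j : ℕ) (m n : ℤ) : (opF p ^ j) (mon p m n)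
    = (∏ i ∈ Finset.range j, qInt p (n + 1 + i)) • mon p (m - j) (n + j) := by
  induction j with
  | zero => simp
  | succ j ih =>
    rw [pow_succ', Module.End.mul_apply, ih, map_smul, opF_mon, smul_smul, Finset.prod_range_succ]
    congr 2
    · congr 1; ring
    · push_cast; ring
    · push_cast; ring

theorem opK_pow (p : ℕ) (j : ℕ) (m n : ℤ) : (opK p ^ j) (mon p m n)
    = q p ^ ((m - n) * j) • mon p m n := by
  induction j with
  | zero => simp
  | succ j ih =>
    rw [pow_succ', Module.End.mul_apply, ih, map_smul, opK_mon, smul_smul,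
      ← zpow_add₀ (q_ne_zero p)]
    congr 2; push_cast; ring

theorem rel (p : ℕ) [p.AtLeastTwo] :
    ∀ ⦃a b⦄, Rel p a b → FreeAlgebra.lift ℂ (op p) a = FreeAlgebra.lift ℂ (op p) b := by
  have h0 := q_ne_zero p
  refine rel_of _ ?_ ?_ ?_ ?_ ?_ ?_ ?_ ?_ <;> simp only [op] <;>
    refine hom_ext fun m n => ?_
  · simp only [Module.End.mul_apply, opKinv_mon, map_smul, opK_mon, smul_smul,
      Module.End.one_apply, ← zpow_add₀ h0]
    simp
  · simp only [Module.End.mul_apply, opKinv_mon, map_smul, opK_mon, smul_smul,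
      Module.End.one_apply, ← zpow_add₀ h0]
    simp
  · simp only [Module.End.mul_apply, LinearMap.smul_apply, opE_mon, map_smul, opK_mon, smul_smul]
    congr 1
    rw [← mul_assoc, ← zpow_add₀ h0, mul_comm]
    congr 2; ring
  · simp only [Module.End.mul_apply, LinearMap.smul_apply, opF_mon, map_smul, opK_mon, smul_smul]
    congr 1
    rw [← mul_assoc, ← zpow_add₀ h0, mul_comm]
    congr 2; ring
  · simp only [Module.End.mul_apply, LinearMap.smul_apply, LinearMap.sub_apply, opE_mon, opF_mon,
      opK_mon, opKinv_mon, map_smul, smul_smul, sub_add_cancel, add_sub_cancel_right, ← sub_smul]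
    congr 1
    rw [← qInt_comm]; ring
  · rw [opE_pow, prod_qInt, zero_smul, LinearMap.zero_apply]
  · rw [opF_pow, prod_qInt, zero_smul, LinearMap.zero_apply]
  · rw [opK_pow, Module.End.one_apply, mul_comm, zpow_mul, zpow_natCast,
      (q_primitive p).pow_eq_one, one_zpow, one_smul]

/-- The action of `Ū_𝔮 sl(2)` on the quantum plane. -/
instance instModuleUq (p : ℕ) [p.AtLeastTwo] : Module (Uq p) (Plane p) :=
  Module.compHom (Plane p) (Uq.toEnd (op p) (rel p)).toRingHom

theorem gen_smul (p : ℕ) [p.AtLeastTwo] (g : Gen) (f : Plane p) : Uq.gen p g • f = op p g f :=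
  congrArg (fun u : Module.End ℂ (Plane p) => u f) (Uq.toEnd_gen (op p) (rel p) g)

instance instTower (p : ℕ) [p.AtLeastTwo] : IsScalarTower ℂ (Uq p) (Plane p) :=
  ⟨fun c u f => congrArg (fun u : Module.End ℂ (Plane p) => u f)
    (map_smul (Uq.toEnd (op p) (rel p)) c u)⟩

end Plane

/-! ### One-forms -/

/-- The underlying space of the one-forms: the complex vector space with basis
`x⁽ᵐ⁾y⁽ⁿ⁾ξ` (left summand) and `x⁽ᵐ⁾y⁽ⁿ⁾η` (right summand), `m, n ≥ 0`. -/
def OneForm (_p : ℕ) : Type := (ℕ × ℕ) ⊕ (ℕ × ℕ) →₀ ℂ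

instance (p : ℕ) : AddCommGroup (OneForm p) :=
  inferInstanceAs (AddCommGroup ((ℕ × ℕ) ⊕ (ℕ × ℕ) →₀ ℂ))
instance instModuleOneForm (p : ℕ) : Module ℂ (OneForm p) :=
  inferInstanceAs (Module ℂ ((ℕ × ℕ) ⊕ (ℕ × ℕ) →₀ ℂ))

namespace OneForm

/-- The basis of the one-forms: `inl (m, n)` stands for `x⁽ᵐ⁾y⁽ⁿ⁾ξ`, `inr (m, n)` for
`x⁽ᵐ⁾y⁽ⁿ⁾η`. -/
def basis (p : ℕ) : Module.Basis ((ℕ × ℕ) ⊕ (ℕ × ℕ)) ℂ (OneForm p) :=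
  ⟨LinearEquiv.refl ℂ ((ℕ × ℕ) ⊕ (ℕ × ℕ) →₀ ℂ)⟩

/-- The one-form `x⁽ᵐ⁾y⁽ⁿ⁾ξ`, which vanishes if `m < 0` or `n < 0`. -/
def xi (p : ℕ) (m n : ℤ) : OneForm p :=
  if 0 ≤ m ∧ 0 ≤ n then basis p (Sum.inl (m.toNat, n.toNat)) else 0

/-- The one-form `x⁽ᵐ⁾y⁽ⁿ⁾η`, which vanishes if `m < 0` or `n < 0`. -/
def eta (p : ℕ) (m n : ℤ) : OneForm p :=
  if 0 ≤ m ∧ 0 ≤ n then basis p (Sum.inr (m.toNat, n.toNat)) else 0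

theorem xi_neg (p : ℕ) {m n : ℤ} (h : ¬ (0 ≤ m ∧ 0 ≤ n)) : xi p m n = 0 := if_neg h
theorem eta_neg (p : ℕ) {m n : ℤ} (h : ¬ (0 ≤ m ∧ 0 ≤ n)) : eta p m n = 0 := if_neg h

/-- The linear map on one-forms that sends `x⁽ᵐ⁾y⁽ⁿ⁾ξ` to `f m n` and `x⁽ᵐ⁾y⁽ⁿ⁾η` to `g m n`. -/
def lin {p : ℕ} {V : Type*} [AddCommGroup V] [Module ℂ V] (f g : ℤ → ℤ → V) :
    OneForm p →ₗ[ℂ] V :=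
  (basis p).constr ℂ (Sum.elim (fun i => f i.1 i.2) (fun i => g i.1 i.2))

theorem lin_xi {p : ℕ} {V : Type*} [AddCommGroup V] [Module ℂ V] (f g : ℤ → ℤ → V)
    (hf : ∀ m n : ℤ, ¬ (0 ≤ m ∧ 0 ≤ n) → f m n = 0) (m n : ℤ) :
    lin f g (xi p m n) = f m n := by
  by_cases h : 0 ≤ m ∧ 0 ≤ n
  · rw [xi, if_pos h, lin, Module.Basis.constr_basis, Sum.elim_inl, Int.toNat_of_nonneg h.1,
      Int.toNat_of_nonneg h.2]
  · rw [xi_neg p h, map_zero, hf m n h]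

theorem lin_eta {p : ℕ} {V : Type*} [AddCommGroup V] [Module ℂ V] (f g : ℤ → ℤ → V)
    (hg : ∀ m n : ℤ, ¬ (0 ≤ m ∧ 0 ≤ n) → g m n = 0) (m n : ℤ) :
    lin f g (eta p m n) = g m n := by
  by_cases h : 0 ≤ m ∧ 0 ≤ n
  · rw [eta, if_pos h, lin, Module.Basis.constr_basis, Sum.elim_inr, Int.toNat_of_nonneg h.1,
      Int.toNat_of_nonneg h.2]
  · rw [eta_neg p h, map_zero, hg m n h]

theorem hom_ext {p : ℕ} {V : Type*} [AddCommGroup V] [Module ℂ V] {f g : OneForm p →ₗ[ℂ] V}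
    (h : ∀ m n : ℤ, f (xi p m n) = g (xi p m n) ∧ f (eta p m n) = g (eta p m n)) : f = g := by
  refine (basis p).ext fun i => ?_
  rcases i with i | i
  · simpa [xi] using (h i.1 i.2).1
  · simpa [eta] using (h i.1 i.2).2

/-- `E(x⁽ᵐ⁾y⁽ⁿ⁾ξ) = 𝔮 [m+1] x⁽ᵐ⁺¹⁾y⁽ⁿ⁻¹⁾ξ` and
`E(x⁽ᵐ⁾y⁽ⁿ⁾η) = 𝔮⁻¹ [m+1] x⁽ᵐ⁺¹⁾y⁽ⁿ⁻¹⁾η + x⁽ᵐ⁾y⁽ⁿ⁾ξ`. -/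
def opE (p : ℕ) : Module.End ℂ (OneForm p) :=
  lin (fun m n => (q p * qInt p (m + 1)) • xi p (m + 1) (n - 1))
    (fun m n => ((q p)⁻¹ * qInt p (m + 1)) • eta p (m + 1) (n - 1) + xi p m n)

/-- `F(x⁽ᵐ⁾y⁽ⁿ⁾ξ) = [n+1] x⁽ᵐ⁻¹⁾y⁽ⁿ⁺¹⁾ξ + 𝔮^(n-m) x⁽ᵐ⁾y⁽ⁿ⁾η` and
`F(x⁽ᵐ⁾y⁽ⁿ⁾η) = [n+1] x⁽ᵐ⁻¹⁾y⁽ⁿ⁺¹⁾η`. -/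
def opF (p : ℕ) : Module.End ℂ (OneForm p) :=
  lin (fun m n => qInt p (n + 1) • xi p (m - 1) (n + 1) + q p ^ (n - m) • eta p m n)
    (fun m n => qInt p (n + 1) • eta p (m - 1) (n + 1))

/-- `K(x⁽ᵐ⁾y⁽ⁿ⁾ξ) = 𝔮^(m-n+1) x⁽ᵐ⁾y⁽ⁿ⁾ξ` and `K(x⁽ᵐ⁾y⁽ⁿ⁾η) = 𝔮^(m-n-1) x⁽ᵐ⁾y⁽ⁿ⁾η`. -/
def opK (p : ℕ) : Module.End ℂ (OneForm p) :=
  lin (fun m n => q p ^ (m - n + 1) • xi p m n) (fun m n => q p ^ (m - n - 1) • eta p m n)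

/-- The inverse of `K`. -/
def opKinv (p : ℕ) : Module.End ℂ (OneForm p) :=
  lin (fun m n => q p ^ (n - m - 1) • xi p m n) (fun m n => q p ^ (n - m + 1) • eta p m n)

/-- The operators by which the generators act on the one-forms. -/
def op (p : ℕ) : Gen → Module.End ℂ (OneForm p)
  | Gen.E => opE p
  | Gen.F => opF p
  | Gen.K => opK p
  | Gen.Kinv => opKinv p

section
variable (p : ℕ) (m n : ℤ)

theorem opE_xi [p.AtLeastTwo] :
    opE p (xi p m n) = (q p * qInt p (m + 1)) • xi p (m + 1) (n - 1) := by
  refine lin_xi _ _ (fun m n h => ?_) m n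
  rw [mul_smul, Plane.vanish_E p (xi p) (fun _ _ => xi_neg p) _ _ h, smul_zero]

theorem opE_eta [p.AtLeastTwo] : opE p (eta p m n)
    = ((q p)⁻¹ * qInt p (m + 1)) • eta p (m + 1) (n - 1) + xi p m n := by
  refine lin_eta _ _ (fun m n h => ?_) m n
  rw [mul_smul, Plane.vanish_E p (eta p) (fun _ _ => eta_neg p) _ _ h, smul_zero, xi_neg p h,
    add_zero]

theorem opF_xi [p.AtLeastTwo] : opF p (xi p m n)
    = qInt p (n + 1) • xi p (m - 1) (n + 1) + q p ^ (n - m) • eta p m n := by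
  refine lin_xi _ _ (fun m n h => ?_) m n
  rw [Plane.vanish_F p (xi p) (fun _ _ => xi_neg p) _ _ h, eta_neg p h, smul_zero, add_zero]

theorem opF_eta [p.AtLeastTwo] :
    opF p (eta p m n) = qInt p (n + 1) • eta p (m - 1) (n + 1) :=
  lin_eta _ _ (Plane.vanish_F p (eta p) fun _ _ => eta_neg p) m n

theorem opK_xi : opK p (xi p m n) = q p ^ (m - n + 1) • xi p m n :=
  lin_xi _ _ (fun m n h => by rw [xi_neg p h, smul_zero]) m n

theorem opK_eta : opK p (eta p m n) = q p ^ (m - n - 1) • eta p m n :=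
  lin_eta _ _ (fun m n h => by rw [eta_neg p h, smul_zero]) m n

theorem opKinv_xi : opKinv p (xi p m n) = q p ^ (n - m - 1) • xi p m n :=
  lin_xi _ _ (fun m n h => by rw [xi_neg p h, smul_zero]) m n

theorem opKinv_eta : opKinv p (eta p m n) = q p ^ (n - m + 1) • eta p m n :=
  lin_eta _ _ (fun m n h => by rw [eta_neg p h, smul_zero]) m n

theorem opE_pow_xi [p.AtLeastTwo] (j : ℕ) : (opE p ^ j) (xi p m n)
    = (q p ^ j * ∏ i ∈ Finset.range j, qInt p (m + 1 + i)) • xi p (m + j) (n - j) := by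
  induction j with
  | zero => simp
  | succ j ih =>
    rw [pow_succ', Module.End.mul_apply, ih, map_smul, opE_xi, smul_smul, Finset.prod_range_succ,
      show m + 1 + (j : ℤ) = m + j + 1 by ring]
    push_cast
    rw [show m + (j : ℤ) + 1 = m + (j + 1) by ring, show n - (j : ℤ) - 1 = n - (j + 1) by ring]
    congr 1; ring

theorem opE_pow_eta [p.AtLeastTwo] (j : ℕ) : (opE p ^ (j + 1)) (eta p m n)
    = ((q p)⁻¹ ^ (j + 1) * ∏ i ∈ Finset.range (j + 1), qInt p (m + 1 + i)) •
        eta p (m + (j + 1)) (n - (j + 1))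
      + (qInt p (j + 1) * ∏ i ∈ Finset.range j, qInt p (m + 1 + i)) • xi p (m + j) (n - j) := by
  induction j with
  | zero => simp [opE_eta, qInt_one]
  | succ j ih =>
    rw [pow_succ', Module.End.mul_apply, ih, map_add, map_smul, map_smul, opE_eta, opE_xi]
    push_cast
    rw [qInt_succ p ((j : ℤ) + 1), Finset.prod_range_succ _ (j + 1)]
    push_cast
    rw [show m + 1 + ((j : ℤ) + 1) = m + (j + 1) + 1 by ring,
      show m + ((j : ℤ) + 1) + 1 = m + (j + 1 + 1) by ring,
      show n - ((j : ℤ) + 1) - 1 = n - (j + 1 + 1) by ring,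
      show m + (j : ℤ) + 1 = m + (j + 1) by ring, show n - (j : ℤ) - 1 = n - (j + 1) by ring,
      Finset.prod_range_succ _ j, show m + 1 + (j : ℤ) = m + (j + 1) by ring]
    rw [show q p ^ (-((j : ℤ) + 1)) = (q p)⁻¹ ^ (j + 1) by
      rw [zpow_neg, inv_pow]; norm_cast]
    module

theorem opF_pow_eta [p.AtLeastTwo] (j : ℕ) : (opF p ^ j) (eta p m n)
    = (∏ i ∈ Finset.range j, qInt p (n + 1 + i)) • eta p (m - j) (n + j) := by
  induction j with
  | zero => simp
  | succ j ih =>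
    rw [pow_succ', Module.End.mul_apply, ih, map_smul, opF_eta, smul_smul, Finset.prod_range_succ,
      show n + 1 + (j : ℤ) = n + j + 1 by ring]
    push_cast
    rw [show n + (j : ℤ) + 1 = n + (j + 1) by ring, show m - (j : ℤ) - 1 = m - (j + 1) by ring]

theorem opF_pow_xi [p.AtLeastTwo] (j : ℕ) : (opF p ^ (j + 1)) (xi p m n)
    = (∏ i ∈ Finset.range (j + 1), qInt p (n + 1 + i)) • xi p (m - (j + 1)) (n + (j + 1))
      + (q p ^ (n - m + j) * qInt p (j + 1) * ∏ i ∈ Finset.range j, qInt p (n + 1 + i)) •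
        eta p (m - j) (n + j) := by
  have h0 := q_ne_zero p
  induction j with
  | zero => simp [opF_xi, qInt_one]
  | succ j ih =>
    rw [pow_succ', Module.End.mul_apply, ih, map_add, map_smul, map_smul, opF_eta, opF_xi]
    push_cast
    rw [qInt_succ_inv p ((j : ℤ) + 1), Finset.prod_range_succ _ (j + 1)]
    push_cast
    rw [show n + 1 + ((j : ℤ) + 1) = n + (j + 1) + 1 by ring,
      show n + ((j : ℤ) + 1) + 1 = n + (j + 1 + 1) by ring,
      show m - ((j : ℤ) + 1) - 1 = m - (j + 1 + 1) by ring,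
      show n + (j : ℤ) + 1 = n + (j + 1) by ring, show m - (j : ℤ) - 1 = m - (j + 1) by ring,
      Finset.prod_range_succ _ j, show n + 1 + (j : ℤ) = n + (j + 1) by ring,
      show n + ((j : ℤ) + 1) - (m - (j + 1)) = (n - m + (j + 1)) + (j + 1) by ring,
      zpow_add₀ h0 (n - m + (j + 1)), ← add_assoc (n - m), zpow_add₀ h0 (n - m + j) 1, zpow_one]
    generalize q p ^ (n - m + (j : ℤ)) = a
    generalize q p ^ ((j : ℤ) + 1) = b
    match_scalars
    · ring
    · field_simp; ring

theorem opK_pow_xi (j : ℕ) : (opK p ^ j) (xi p m n) = q p ^ ((m - n + 1) * j) • xi p m n := by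
  induction j with
  | zero => simp
  | succ j ih =>
    rw [pow_succ', Module.End.mul_apply, ih, map_smul, opK_xi, smul_smul,
      ← zpow_add₀ (q_ne_zero p)]
    congr 2; push_cast; ring

theorem opK_pow_eta (j : ℕ) : (opK p ^ j) (eta p m n) = q p ^ ((m - n - 1) * j) • eta p m n := by
  induction j with
  | zero => simp
  | succ j ih =>
    rw [pow_succ', Module.End.mul_apply, ih, map_smul, opK_eta, smul_smul,
      ← zpow_add₀ (q_ne_zero p)]
    congr 2; push_cast; ring

end

theorem rel (p : ℕ) [p.AtLeastTwo] :
    ∀ ⦃a b⦄, Rel p a b → FreeAlgebra.lift ℂ (op p) a = FreeAlgebra.lift ℂ (op p) b := by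
  have h0 := q_ne_zero p
  have hK : q p ^ (2 * p : ℤ) = 1 := by exact_mod_cast (q_primitive p).pow_eq_one
  obtain ⟨j, hj⟩ : ∃ j, p = j + 1 := ⟨p - 1, by have := two_le p; omega⟩
  have hpj : qInt p (j + 1) = 0 := qInt_of_dvd p (by rw [hj]; push_cast; exact dvd_rfl)
  refine rel_of _ ?_ ?_ ?_ ?_ ?_ ?_ ?_ ?_ <;> simp only [op] <;>
    refine hom_ext fun m n => ⟨?_, ?_⟩
  · simp only [Module.End.mul_apply, opKinv_xi, map_smul, opK_xi, smul_smul,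
      Module.End.one_apply, ← zpow_add₀ h0]
    rw [show n - m - 1 + (m - n + 1) = 0 by ring, zpow_zero, one_smul]
  · simp only [Module.End.mul_apply, opKinv_eta, map_smul, opK_eta, smul_smul,
      Module.End.one_apply, ← zpow_add₀ h0]
    rw [show n - m + 1 + (m - n - 1) = 0 by ring, zpow_zero, one_smul]
  · simp only [Module.End.mul_apply, opKinv_xi, map_smul, opK_xi, smul_smul,
      Module.End.one_apply, ← zpow_add₀ h0]
    rw [show m - n + 1 + (n - m - 1) = 0 by ring, zpow_zero, one_smul]
  · simp only [Module.End.mul_apply, opKinv_eta, map_smul, opK_eta, smul_smul,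
      Module.End.one_apply, ← zpow_add₀ h0]
    rw [show m - n - 1 + (n - m + 1) = 0 by ring, zpow_zero, one_smul]
  · simp only [Module.End.mul_apply, LinearMap.smul_apply, opE_xi, map_smul, opK_xi, smul_smul]
    rw [show m + 1 - (n - 1) + 1 = 2 + (m - n + 1) by ring, zpow_add₀ h0 2]
    congr 1; ring
  · simp only [Module.End.mul_apply, LinearMap.smul_apply, opE_eta, map_smul, opK_eta, map_add,
      opK_xi]
    rw [show m + 1 - (n - 1) - 1 = 2 + (m - n - 1) by ring,
      show m - n + 1 = 2 + (m - n - 1) by ring, zpow_add₀ h0 2]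
    module
  · simp only [Module.End.mul_apply, LinearMap.smul_apply, opF_xi, map_smul, opK_eta, map_add,
      opK_xi]
    rw [show m - 1 - (n + 1) + 1 = -2 + (m - n + 1) by ring,
      show m - n - 1 = -2 + (m - n + 1) by ring, zpow_add₀ h0 (-2)]
    module
  · simp only [Module.End.mul_apply, LinearMap.smul_apply, opF_eta, map_smul, opK_eta, smul_smul]
    rw [show m - 1 - (n + 1) - 1 = -2 + (m - n - 1) by ring, zpow_add₀ h0 (-2)]
    congr 1; ring
  · simp only [Module.End.mul_apply, LinearMap.smul_apply, LinearMap.sub_apply, opE_xi, opE_eta,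
      opF_xi, opK_xi, opKinv_xi, map_smul, map_add, sub_add_cancel, add_sub_cancel_right]
    have key := qInt_comm p m n
    rw [show n - 1 - (m + 1) = n - m - 2 by ring]
    have e1 : q p ^ (m - n + 1) = q p ^ (m - n) * q p := by rw [zpow_add₀ h0, zpow_one]
    have e2 : q p ^ (n - m - 1) = q p ^ (n - m) * (q p)⁻¹ := by
      rw [sub_eq_add_neg (n - m), zpow_add₀ h0, zpow_neg, zpow_one]
    have e3 : q p ^ (n - m - 2) = q p ^ (n - m) * (q p)⁻¹ * (q p)⁻¹ := by
      rw [sub_eq_add_neg (n - m), zpow_add₀ h0, zpow_neg, mul_assoc]; norm_cast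
      rw [pow_two, mul_inv]
    rw [e1, e2, e3]
    have h := q_sub_ne_zero p
    match_scalars
    · have : q p ^ (n - m) = (q p - (q p)⁻¹)⁻¹ * (q p ^ (n - m) * (q p - (q p)⁻¹)) := by
        rw [mul_comm, mul_assoc, mul_inv_cancel₀ h, mul_one]
      linear_combination q p * key + this
    · field_simp
      try ring
  · simp only [Module.End.mul_apply, LinearMap.smul_apply, LinearMap.sub_apply, opE_eta,
      opF_xi, opF_eta, opK_eta, opKinv_eta, map_smul, map_add, sub_add_cancel,
      add_sub_cancel_right]
    have key := qInt_comm p m n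
    have e1 : q p ^ (n - m + 1) = q p ^ (n - m) * q p := by rw [zpow_add₀ h0, zpow_one]
    have e2 : q p ^ (m - n - 1) = q p ^ (m - n) * (q p)⁻¹ := by
      rw [sub_eq_add_neg (m - n), zpow_add₀ h0, zpow_neg, zpow_one]
    rw [e1, e2]
    have h := q_sub_ne_zero p
    match_scalars
    · have : q p ^ (n - m) = (q p - (q p)⁻¹)⁻¹ * (q p ^ (n - m) * (q p - (q p)⁻¹)) := by
        rw [mul_comm, mul_assoc, mul_inv_cancel₀ h, mul_one]
      linear_combination (q p)⁻¹ * key - this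
    · ring
  · rw [opE_pow_xi, prod_qInt, mul_zero, zero_smul, LinearMap.zero_apply]
  · have h1 := opE_pow_eta p m n j
    rw [hpj, ← hj, prod_qInt] at h1
    simpa using h1
  · have h1 := opF_pow_xi p m n j
    rw [hpj, ← hj, prod_qInt] at h1
    simpa using h1
  · rw [opF_pow_eta, prod_qInt, zero_smul, LinearMap.zero_apply]
  · rw [opK_pow_xi, Module.End.one_apply, mul_comm]; push_cast
    rw [zpow_mul, hK, one_zpow, one_smul]
  · rw [opK_pow_eta, Module.End.one_apply, mul_comm]; push_cast
    rw [zpow_mul, hK, one_zpow, one_smul]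

/-- The action of `Ū_𝔮 sl(2)` on the one-forms. -/
instance instModuleUq (p : ℕ) [p.AtLeastTwo] : Module (Uq p) (OneForm p) :=
  Module.compHom (OneForm p) (Uq.toEnd (op p) (rel p)).toRingHom

theorem gen_smul (p : ℕ) [p.AtLeastTwo] (g : Gen) (f : OneForm p) : Uq.gen p g • f = op p g f :=
  congrArg (fun u : Module.End ℂ (OneForm p) => u f) (Uq.toEnd_gen (op p) (rel p) g)

instance instTower (p : ℕ) [p.AtLeastTwo] : IsScalarTower ℂ (Uq p) (OneForm p) :=
  ⟨fun c u f => congrArg (fun u : Module.End ℂ (OneForm p) => u f)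
    (map_smul (Uq.toEnd (op p) (rel p)) c u)⟩

end OneForm

section Stable

variable {p : ℕ} {V W : Type*} [AddCommGroup V] [Module ℂ V] [Module (Uq p) V]
  [IsScalarTower ℂ (Uq p) V] [AddCommGroup W] [Module ℂ W] [Module (Uq p) W]
  [IsScalarTower ℂ (Uq p) W]

/-- A subspace stable under the generators, as a submodule over `Ū_𝔮 sl(2)`. -/
def subOfGen (S : Submodule ℂ V) (h : ∀ g, ∀ v ∈ S, Uq.gen p g • v ∈ S) :
    Submodule (Uq p) V where
  toAddSubmonoid := S.toAddSubmonoid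
  smul_mem' u v hv := by
    have key : ∀ w ∈ S, u • w ∈ S := by
      induction u using Uq.induction with
      | hc c => intro w hw; rw [algebraMap_smul]; exact S.smul_mem c hw
      | hg g => exact h g
      | ha a b ha hb => intro w hw; rw [add_smul]; exact S.add_mem (ha w hw) (hb w hw)
      | hm a b ha hb => intro w hw; rw [mul_smul]; exact ha _ (hb w hw)
    exact key v hv

/-- A `ℂ`-linear map that commutes with the generators, as a map of `Ū_𝔮 sl(2)`-modules. -/
def linOfGen (f : V →ₗ[ℂ] W) (h : ∀ g v, f (Uq.gen p g • v) = Uq.gen p g • f v) :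
    V →ₗ[Uq p] W where
  toFun := f
  map_add' := f.map_add
  map_smul' u := by
    induction u using Uq.induction with
    | hc c => intro v; simp only [RingHom.id_apply, algebraMap_smul, map_smul]
    | hg g => exact h g
    | ha a b ha hb => intro v; simp only [RingHom.id_apply] at *; rw [add_smul, map_add, ha, hb,
        add_smul]
    | hm a b ha hb => intro v; simp only [RingHom.id_apply] at *; rw [mul_smul, ha, hb, mul_smul]

end Stable

/-! ### Gradings -/

namespace Plane

variable (p : ℕ)

/-- The graded component of the quantum plane, as a complex subspace: the span of the
monomials `x⁽ᵐ⁾y⁽ⁿ⁾` with `m + n = i`. -/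
def gradeSpan (i : ℕ) : Submodule ℂ (Plane p) :=
  Submodule.span ℂ {f | ∃ m n : ℕ, m + n = i ∧ f = mon p m n}

theorem mon_mem {i : ℕ} {m n : ℤ} (h : m + n = i) : mon p m n ∈ gradeSpan p i := by
  by_cases hmn : 0 ≤ m ∧ 0 ≤ n
  · lift m to ℕ using hmn.1
    lift n to ℕ using hmn.2
    exact Submodule.subset_span ⟨m, n, by exact_mod_cast h, rfl⟩
  · rw [mon_neg p hmn]; exact Submodule.zero_mem _

theorem gradeSpan_stable [p.AtLeastTwo] (i : ℕ) (g : Gen) :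
    ∀ f ∈ gradeSpan p i, Uq.gen p g • f ∈ gradeSpan p i := by
  intro f hf
  rw [gen_smul]
  refine (Submodule.span_le (p := (gradeSpan p i).comap (op p g))).2 ?_ hf
  rintro _ ⟨m, n, h, rfl⟩
  have h' : (m : ℤ) + n = i := by exact_mod_cast h
  cases g <;> simp only [SetLike.mem_coe, Submodule.mem_comap, op, opE_mon, opF_mon, opK_mon,
    opKinv_mon] <;> exact Submodule.smul_mem _ _ (mon_mem p (by omega))

/-- The graded component of the quantum plane spanned by `x⁽ᵐ⁾y⁽ⁿ⁾` with `m + n = i`, as a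
submodule over `Ū_𝔮 sl(2)`. -/
def grade [p.AtLeastTwo] (i : ℕ) : Submodule (Uq p) (Plane p) :=
  subOfGen (gradeSpan p i) (gradeSpan_stable p i)

end Plane

namespace OneForm

variable (p : ℕ)

/-- The graded component of the one-forms, as a complex subspace: the span of the one-forms
`x⁽ᵐ⁾y⁽ⁿ⁾ξ` and `x⁽ᵐ⁾y⁽ⁿ⁾η` with `m + n = i`. -/
def gradeSpan (i : ℕ) : Submodule ℂ (OneForm p) :=
  Submodule.span ℂ {f | ∃ m n : ℕ, m + n = i ∧ (f = xi p m n ∨ f = eta p m n)}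

theorem xi_mem {i : ℕ} {m n : ℤ} (h : m + n = i) : xi p m n ∈ gradeSpan p i := by
  by_cases hmn : 0 ≤ m ∧ 0 ≤ n
  · lift m to ℕ using hmn.1
    lift n to ℕ using hmn.2
    exact Submodule.subset_span ⟨m, n, by exact_mod_cast h, Or.inl rfl⟩
  · rw [xi_neg p hmn]; exact Submodule.zero_mem _

theorem eta_mem {i : ℕ} {m n : ℤ} (h : m + n = i) : eta p m n ∈ gradeSpan p i := by
  by_cases hmn : 0 ≤ m ∧ 0 ≤ n
  · lift m to ℕ using hmn.1
    lift n to ℕ using hmn.2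
    exact Submodule.subset_span ⟨m, n, by exact_mod_cast h, Or.inr rfl⟩
  · rw [eta_neg p hmn]; exact Submodule.zero_mem _

theorem gradeSpan_stable [p.AtLeastTwo] (i : ℕ) (g : Gen) :
    ∀ f ∈ gradeSpan p i, Uq.gen p g • f ∈ gradeSpan p i := by
  intro f hf
  rw [gen_smul]
  refine (Submodule.span_le (p := (gradeSpan p i).comap (op p g))).2 ?_ hf
  rintro _ ⟨m, n, h, hf⟩
  have h' : (m : ℤ) + n = i := by exact_mod_cast h
  have hx : ∀ (c : ℂ) (k l : ℤ), k + l = i → c • xi p k l ∈ gradeSpan p i :=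
    fun c k l e => Submodule.smul_mem _ _ (xi_mem p e)
  have he : ∀ (c : ℂ) (k l : ℤ), k + l = i → c • eta p k l ∈ gradeSpan p i :=
    fun c k l e => Submodule.smul_mem _ _ (eta_mem p e)
  rw [SetLike.mem_coe, Submodule.mem_comap]
  rcases hf with rfl | rfl
  · cases g <;> simp only [op, opE_xi, opF_xi, opK_xi, opKinv_xi]
    · exact hx _ _ _ (by omega)
    · exact Submodule.add_mem _ (hx _ _ _ (by omega)) (he _ _ _ (by omega))
    · exact hx _ _ _ (by omega)
    · exact hx _ _ _ (by omega)
  · cases g <;> simp only [op, opE_eta, opF_eta, opK_eta, opKinv_eta]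
    · exact Submodule.add_mem _ (he _ _ _ (by omega)) (xi_mem p (by omega))
    · exact he _ _ _ (by omega)
    · exact he _ _ _ (by omega)
    · exact he _ _ _ (by omega)

/-- The graded component of the one-forms spanned by `x⁽ᵐ⁾y⁽ⁿ⁾ξ` and `x⁽ᵐ⁾y⁽ⁿ⁾η` with
`m + n = i`, as a submodule over `Ū_𝔮 sl(2)`. -/
def grade [p.AtLeastTwo] (i : ℕ) : Submodule (Uq p) (OneForm p) :=
  subOfGen (gradeSpan p i) (gradeSpan_stable p i)

/-- The submodule of the one-forms spanned by all graded components of grade at most `i`. -/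
def upTo [p.AtLeastTwo] (i : ℕ) : Submodule (Uq p) (OneForm p) :=
  ⨆ (j : ℕ) (_ : j ≤ i), grade p j

end OneForm

/-! ### The differential -/

section
open Plane OneForm
variable (p : ℕ)

/-- The differential
`d(x⁽ᵐ⁾y⁽ⁿ⁾) = 𝔮^(m+n-1) x⁽ᵐ⁻¹⁾y⁽ⁿ⁾ξ + 𝔮^(n-1) x⁽ᵐ⁾y⁽ⁿ⁻¹⁾η` as a `ℂ`-linear map. -/
def dLin : Plane p →ₗ[ℂ] OneForm p :=
  Plane.lin fun m n => q p ^ (m + n - 1) • xi p (m - 1) n + q p ^ (n - 1) • eta p m (n - 1)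

theorem dLin_mon (m n : ℤ) : dLin p (mon p m n)
    = q p ^ (m + n - 1) • xi p (m - 1) n + q p ^ (n - 1) • eta p m (n - 1) := by
  refine Plane.lin_mon _ (fun m n h => ?_) m n
  rw [xi_neg p (by omega), eta_neg p (by omega), smul_zero, smul_zero, add_zero]

theorem dLin_comm [p.AtLeastTwo] (g : Gen) (f : Plane p) :
    dLin p (Uq.gen p g • f) = Uq.gen p g • dLin p f := by
  rw [Plane.gen_smul, OneForm.gen_smul]
  suffices h : dLin p ∘ₗ Plane.op p g = OneForm.op p g ∘ₗ dLin p from LinearMap.congr_fun h f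
  refine Plane.hom_ext fun m n => ?_
  have h0 := q_ne_zero p
  cases g <;> simp only [LinearMap.comp_apply, Plane.op, OneForm.op, Plane.opE_mon, Plane.opF_mon,
    Plane.opK_mon, Plane.opKinv_mon, map_smul, dLin_mon, map_add, OneForm.opE_xi,
    OneForm.opE_eta, OneForm.opF_xi, OneForm.opF_eta, OneForm.opK_xi, OneForm.opK_eta,
    OneForm.opKinv_xi, OneForm.opKinv_eta, sub_add_cancel, add_sub_cancel_right]
  · rw [qInt_succ p m, show m + 1 + (n - 1) - 1 = n - 1 + m by ring,
      show m + n - 1 = n - 1 + m by ring, show n - 1 - 1 = n - 1 + -1 by ring]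
    simp only [zpow_add₀ h0 (n - 1), zpow_neg, zpow_one]
    match_scalars <;> field_simp
  · rw [qInt_succ_inv p n, show n - (m - 1) = n - m + 1 by ring,
      show m - 1 + (n + 1) - 1 = m + n - 1 by ring]
    have e1 : q p ^ (m + n - 1) * q p ^ (n - m + 1) = q p ^ n * q p ^ n := by
      rw [← zpow_add₀ h0, ← zpow_add₀ h0]; congr 1; ring
    have e2 : q p ^ (n - 1) = q p ^ n * (q p)⁻¹ := by
      rw [sub_eq_add_neg, zpow_add₀ h0, zpow_neg, zpow_one]
    rw [e2]
    match_scalars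
    · ring
    · linear_combination -e1
  · rw [show m - 1 - n + 1 = m - n by ring, show m - (n - 1) - 1 = m - n by ring]
    module
  · rw [show n - (m - 1) - 1 = n - m by ring, show n - 1 - m + 1 = n - m by ring]
    module

/-- The differential from the quantum plane to the one-forms, which commutes with the action of
`Ū_𝔮 sl(2)`. -/
def d [p.AtLeastTwo] : Plane p →ₗ[Uq p] OneForm p := linOfGen (dLin p) (dLin_comm p)

end

/-! ### The modules that occur in the decomposition

In each of the following, `ε = 1` gives the representation with upper sign `+` and `ε = -1` the one
with upper sign `-`. -/

section
variable (p : ℕ) (ε : ℤˣ)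

/-- `M` is isomorphic to the irreducible module `X^ε_r` (`1 ≤ r ≤ p`): it has a basis
`v 0, …, v (r-1)` with `K v_s = ε 𝔮^(r-1-2s) v_s`, `E v_s = ε [s] [r-s] v_(s-1)` (zero for `s = 0`),
`F v_s = v_(s+1)` (zero for `s = r - 1`). -/
def IsX (r : ℕ) (M : Type*) [AddCommGroup M] [Module ℂ M] [Module (Uq p) M] : Prop :=
  ∃ (b : Module.Basis (Fin r) ℂ M) (v : ℕ → M), (∀ s : Fin r, b s = v s) ∧
    ∀ s < r,
      Uq.K p • v s = (((ε : ℤ) : ℂ) * q p ^ ((r : ℤ) - 1 - 2 * s)) • v s ∧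
      Uq.E p • v s = (if s = 0 then 0 else
        (((ε : ℤ) : ℂ) * qInt p s * qInt p ((r : ℤ) - s)) • v (s - 1)) ∧
      Uq.F p • v s = (if s + 1 < r then v (s + 1) else 0)

/-- `M` is isomorphic to the indecomposable module `W^ε_r(n)` (`1 ≤ r ≤ p - 1`, `n ≥ 2`), the zigzag
`X^ε_r → X^(-ε)_(p-r) ← X^ε_r → ⋯ ← X^ε_r` with `n` copies of `X^ε_r` on top, with bases
`t i 0, …, t i (r-1)`, and `n - 1` copies of `X^(-ε)_(p-r)` in the socle, with bases
`u j 0, …, u j (p-r-1)`. On top of the internal actions, `F` sends the last vector of the `i`th top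
copy to the first vector of the `i`th socle copy, and `E` sends the first vector of the `(i+1)`st
top copy to the last vector of the `i`th socle copy. -/
def IsW (r n : ℕ) (M : Type*) [AddCommGroup M] [Module ℂ M] [Module (Uq p) M] : Prop :=
  ∃ (b : Module.Basis ((Fin n × Fin r) ⊕ (Fin (n - 1) × Fin (p - r))) ℂ M) (t u : ℕ → ℕ → M),
    (∀ (i : Fin n) (s : Fin r), b (Sum.inl (i, s)) = t i s) ∧
    (∀ (j : Fin (n - 1)) (s : Fin (p - r)), b (Sum.inr (j, s)) = u j s) ∧
    (∀ i < n, ∀ s < r,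
      Uq.K p • t i s = (((ε : ℤ) : ℂ) * q p ^ ((r : ℤ) - 1 - 2 * s)) • t i s ∧
      Uq.E p • t i s = (if s = 0 then (if i = 0 then 0 else u (i - 1) (p - r - 1)) else
        (((ε : ℤ) : ℂ) * qInt p s * qInt p ((r : ℤ) - s)) • t i (s - 1)) ∧
      Uq.F p • t i s = (if s + 1 < r then t i (s + 1) else
        if i + 1 < n then u i 0 else 0)) ∧
    (∀ j < n - 1, ∀ s < p - r,
      Uq.K p • u j s = (-((ε : ℤ) : ℂ) * q p ^ ((p : ℤ) - r - 1 - 2 * s)) • u j s ∧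
      Uq.E p • u j s = (if s = 0 then 0 else
        (-((ε : ℤ) : ℂ) * qInt p s * qInt p ((p : ℤ) - r - s)) • u j (s - 1)) ∧
      Uq.F p • u j s = (if s + 1 < p - r then u j (s + 1) else 0))

/-- `M` is isomorphic to `P^ε_r`, the projective cover of `X^ε_r`: `M` is a projective module and
has a superfluous submodule `L` such that `M ⧸ L` is isomorphic to `X^ε_r`. -/
def IsP (r : ℕ) (M : Type*) [AddCommGroup M] [Module ℂ M] [Module (Uq p) M]
    [IsScalarTower ℂ (Uq p) M] : Prop :=
  Module.Projective (Uq p) M ∧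
    ∃ L : Submodule (Uq p) M, (∀ N : Submodule (Uq p) M, L ⊔ N = ⊤ → N = ⊤) ∧ IsX p ε r (M ⧸ L)

end

section
variable {p : ℕ} [p.AtLeastTwo]

/-- The family `N` of submodules is a decomposition of the submodule `T` into an (internal) direct
sum. -/
def IsDirectSum {ι : Type} (N : ι → Submodule (Uq p) (OneForm p))
    (T : Submodule (Uq p) (OneForm p)) : Prop :=
  iSupIndep N ∧ ⨆ i, N i = T

/-- `N` is a `d`-exact copy of `S`: the differential is injective on `S` and maps it onto `N`. -/
def IsExactCopy (S : Submodule (Uq p) (Plane p)) (N : Submodule (Uq p) (OneForm p)) : Prop :=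
  Set.InjOn (d p) S ∧ S.map (d p) = N

end

/-- Labels of the summands in the lowest range of grades: `dX_r` for `2 ≤ r ≤ p`, `X_r` for
`1 ≤ r ≤ p - 2`, and one projective module. -/
inductive LowSummand (p : ℕ) : Type
  | dX (r : ℕ) (h₁ : 2 ≤ r) (h₂ : r ≤ p)
  | X (r : ℕ) (h₁ : 1 ≤ r) (h₂ : r ≤ p - 2)
  | P

/-- Labels of the summands in the `n`th range of grades: the one-forms of all lower ranges, `dW_r`
for `2 ≤ r ≤ p - 1`, `n` copies of `dX_p`, `n - 1` copies of `X_p`, `W_r` for `1 ≤ r ≤ p - 2`, and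
`n` projective modules. -/
inductive Summand (p n : ℕ) : Type
  | lower
  | dW (r : ℕ) (h₁ : 2 ≤ r) (h₂ : r ≤ p - 1)
  | dX (j : Fin n)
  | X (j : Fin (n - 1))
  | W (r : ℕ) (h₁ : 1 ≤ r) (h₂ : r ≤ p - 2)
  | P (j : Fin n)

end QPlane

end

/-! Besides $d$ there is a second equivariant map from the plane to the one-forms: `theta`,
multiplication by the invariant form $x\eta-\mathfrak q^{-1}y\xi$. In grade $i$ the forms have
dimension $2(i+1)$, and receive $d$ from degree $i+1$ (dimension $i+2$) and `theta` from degree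
$i-1$ (dimension $i$). As in the Clebsch–Gordan rule, the two images are complementary as long as
$[i+1]\ne 0$, that is $p\nmid i+1$. This is the only denominator needed: `smul_xi_eq` and
`smul_eta_eq` express monomial forms through the two images, and `primitive` and `coprimitive`
invert the two maps. Outside the resonant grades $np-1$ everything thus reduces to the plane.

In degree $N$ of the plane, $E$ and $F$ move along the diagonal $a+b=N$, and an arrow vanishes
exactly when the exponent it raises reaches a multiple of $p$. If $p\mid N+1$, the $E$- and
$F$-arrows vanish at the same places and the diagonal falls into blocks of length $p$, each an $X_p$
(`Plane.isX_block`). If $N+1=(n-1)p+r$ with $0<r<p$, the two kinds of breaks interleave: for $n\ge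
2$ they give the zigzag $W_r(n)$ (`Plane.isW_diag`), and for $n=1$ there is no break and the degree
is $X_r$ (`Plane.isX_diag`).

In a resonant grade the monomial forms split into blocks of dimension $2p$, each generated by a form
$e$ of weight $\pm\mathfrak q^{p-2}$ with $E^2e=0$. Such a vector is $E^{p-2}w$ for a weight vector
$w$. Weight vectors lift through surjections because $K$ has finite order, and $E^2$ kills $E^{p-2}$
of the lift because $E^p=0$. In dimension $2p$ the vectors $F^ae$, $F^aEe$ form a basis, so $e$ may
be sent to any vector of the same kind, and projectivity follows (`IsDominant.projective`). The
cover property is `IsDominant.radical_superfluous` together with `IsDominant.isX_quotient_radical`.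

Directness of all sums comes from one basis of the one-forms (`Cell.linearIndependent_form`): exact
and coexact forms off resonance, monomial forms on resonance. Every summand is the span of a set of
basis elements, so the decompositions are partitions of labels (`Cell.isDirectSum`). -/

noncomputable section

namespace QPlane

/-! ### Quantum integers -/

section
variable (p : ℕ)

theorem qInt_neg (n : ℤ) : qInt p (-n) = -qInt p n := by
  rw [qInt, qInt, neg_neg, ← neg_div, neg_sub]

theorem qInt_add (a b : ℤ) : qInt p (a + b) = q p ^ b * qInt p a + q p ^ (-a) * qInt p b := by
  have h0 := q_ne_zero p
  simp only [qInt, neg_add, zpow_add₀ h0]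
  ring

variable [p.AtLeastTwo]

theorem q_pow_p : q p ^ p = -1 := by
  have h0 : (p : ℂ) ≠ 0 := by have := two_le p; exact_mod_cast (by omega : p ≠ 0)
  rw [q, ← Complex.exp_nat_mul, mul_div_cancel₀ _ h0, Complex.exp_pi_mul_I]

/-- The source of the alternating signs: shifting a weight exponent by $p$ exchanges the types $X^+$
and $X^-$. -/
theorem q_zpow_mul_p (a : ℤ) : q p ^ (a * p) = (-1) ^ a := by
  rw [mul_comm, zpow_mul, zpow_natCast, q_pow_p]

/-- $[n]=0$ means $\mathfrak q^{2n}=1$, and $\mathfrak q$ has order exactly $2p$. -/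
theorem qInt_eq_zero_iff (n : ℤ) : qInt p n = 0 ↔ (p : ℤ) ∣ n := by
  refine ⟨fun h => ?_, qInt_of_dvd p⟩
  rw [qInt, div_eq_zero_iff, or_iff_left (q_sub_ne_zero p), sub_eq_zero] at h
  have h1 : q p ^ (2 * n) = 1 := by
    rw [two_mul, zpow_add₀ (q_ne_zero p)]
    nth_rw 2 [h]
    rw [← zpow_add₀ (q_ne_zero p), add_neg_cancel, zpow_zero]
  have h2 := ((q_primitive p).zpow_eq_one_iff_dvd _).1 h1
  push_cast at h2
  exact (mul_dvd_mul_iff_left two_ne_zero).1 h2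

theorem qInt_add_mul_p (a n : ℤ) : qInt p (a * p + n) = (-1) ^ a * qInt p n := by
  rw [qInt_add, qInt_of_dvd p (dvd_mul_left (p : ℤ) a), mul_zero, zero_add, ← neg_mul,
    q_zpow_mul_p, zpow_neg, ← inv_zpow, inv_neg_one]

/-- One sign comes from $\mathfrak q^p=-1$ and one from oddness of $[\,\cdot\,]$. This matches the
$E$-coefficients in the socle of a zigzag. -/
theorem qInt_p_sub (n : ℤ) : qInt p (p - n) = qInt p n := by
  have := qInt_add_mul_p p 1 (-n)
  rw [one_mul, zpow_one, qInt_neg] at this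
  rw [sub_eq_add_neg, this]; ring

theorem qInt_ne_zero_of_lt {n : ℤ} (h1 : 0 < n) (h2 : n < p) : qInt p n ≠ 0 := by
  rw [Ne, qInt_eq_zero_iff]
  intro h
  have := Int.le_of_dvd h1 h
  omega

end

/-! ### Relations in the quantum group -/

namespace Uq
variable (p : ℕ)

/-- The inverse of the generator `K`. -/
abbrev Kinv : Uq p := Uq.gen p Gen.Kinv

theorem mk_eq {a b : FreeAlgebra ℂ Gen} (h : Rel p a b) :
    RingQuot.mkAlgHom ℂ (Rel p) a = RingQuot.mkAlgHom ℂ (Rel p) b :=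
  RingQuot.mkAlgHom_rel ℂ h

theorem K_mul_Kinv : K p * Kinv p = 1 := by simpa [gen] using mk_eq p Rel.K_mul_Kinv
theorem Kinv_mul_K : Kinv p * K p = 1 := by simpa [gen] using mk_eq p Rel.Kinv_mul_K
theorem E_pow : E p ^ p = 0 := by simpa [gen] using mk_eq p Rel.E_pow
theorem F_pow : F p ^ p = 0 := by simpa [gen] using mk_eq p Rel.F_pow
theorem K_pow : K p ^ (2 * p) = 1 := by simpa [gen] using mk_eq p Rel.K_pow

theorem K_mul_E : K p * E p = q p ^ (2 : ℤ) • (E p * K p) := by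
  have h : K p * E p * Kinv p = q p ^ (2 : ℤ) • E p := by simpa [gen] using mk_eq p Rel.KE
  rw [← smul_mul_assoc, ← h, mul_assoc _ (Kinv p), Kinv_mul_K, mul_one]

theorem K_mul_F : K p * F p = q p ^ (-2 : ℤ) • (F p * K p) := by
  have h : K p * F p * Kinv p = q p ^ (-2 : ℤ) • F p := by simpa [gen] using mk_eq p Rel.KF
  rw [← smul_mul_assoc, ← h, mul_assoc _ (Kinv p), Kinv_mul_K, mul_one]

theorem E_mul_F : E p * F p = F p * E p + (q p - (q p)⁻¹)⁻¹ • (K p - Kinv p) := by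
  have h : E p * F p - F p * E p = (q p - (q p)⁻¹)⁻¹ • (K p - Kinv p) := by
    simpa [gen] using mk_eq p Rel.EF
  rw [← h]; abel

end Uq

/-! ### Weight vectors -/

section Weight
open Uq

variable {p : ℕ} {V : Type*} [AddCommGroup V] [Module ℂ V] [Module (Uq p) V]
  [IsScalarTower ℂ (Uq p) V]

theorem smul_smul_comm' (u : Uq p) (c : ℂ) (v : V) : u • c • v = c • u • v := by
  rw [← algebraMap_smul (Uq p) c v, ← mul_smul, ← Algebra.commutes, mul_smul, algebraMap_smul]

theorem Kinv_smul {μ : ℂ} {v : V} (hμ : μ ≠ 0) (h : K p • v = μ • v) :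
    Kinv p • v = μ⁻¹ • v := by
  have h1 : Kinv p • K p • v = v := by rw [← mul_smul, Kinv_mul_K, one_smul]
  rw [h, smul_smul_comm'] at h1
  rw [eq_inv_smul_iff₀ hμ, h1]

theorem K_smul_E {μ : ℂ} {v : V} (h : K p • v = μ • v) :
    K p • E p • v = (μ * q p ^ (2 : ℤ)) • E p • v := by
  rw [← mul_smul, K_mul_E, smul_assoc, mul_smul, h, smul_smul_comm', smul_smul, mul_comm]

theorem K_smul_F_pow {μ : ℂ} {v : V} (h : K p • v = μ • v) (s : ℕ) :
    K p • F p ^ s • v = (μ * q p ^ (-2 * (s : ℤ))) • F p ^ s • v := by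
  induction s with
  | zero => simpa using h
  | succ s ih =>
    rw [pow_succ', mul_smul, ← mul_smul (K p), K_mul_F, smul_assoc, mul_smul, ih,
      smul_smul_comm', smul_smul]
    congr 1
    push_cast
    rw [mul_add (-2 : ℤ), mul_one, zpow_add₀ (q_ne_zero p)]
    ring

variable [p.AtLeastTwo]

/-- Move $E$ past one $F$ at a time; the scalars $\varepsilon[r-1-2s]$ produced by $[E,F]$
telescope. The vector need not be singular: the term $F^sEv$ is kept for zigzag and projective
modules. -/
theorem E_smul_F_pow {ε : ℤˣ} {r : ℤ} {v : V}
    (h : K p • v = (((ε : ℤ) : ℂ) * q p ^ (r - 1)) • v) (s : ℕ) :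
    E p • F p ^ s • v = F p ^ s • E p • v
      + (((ε : ℤ) : ℂ) * qInt p s * qInt p (r - s)) • F p ^ (s - 1) • v := by
  have h0 := q_ne_zero p
  have hε : (((ε : ℤ) : ℂ)) ≠ 0 := by exact_mod_cast ε.ne_zero
  have hε' : (((ε : ℤ) : ℂ))⁻¹ = ((ε : ℤ) : ℂ) := by
    rcases Int.units_eq_one_or ε with rfl | rfl <;> simp
  induction s with
  | zero => simp [qInt_zero]
  | succ s ih =>
    have hK := K_smul_F_pow h s
    have hKi := Kinv_smul (mul_ne_zero (mul_ne_zero hε (zpow_ne_zero _ h0)) (zpow_ne_zero _ h0)) hK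
    -- At $s=0$ the truncated exponent $s-1$ is wrong, but the coefficient contains $[0]=0$.
    have hF : (((ε : ℤ) : ℂ) * qInt p s * qInt p (r - s)) • F p • F p ^ (s - 1) • v
        = (((ε : ℤ) : ℂ) * qInt p s * qInt p (r - s)) • F p ^ s • v := by
      rcases s with _ | s
      · simp [qInt_zero]
      · rw [← mul_smul (F p), ← pow_succ', Nat.add_sub_cancel]
    rw [pow_succ', mul_smul (F p) _ v, ← mul_smul (E p), E_mul_F, add_smul, mul_smul (F p), ih, smul_add,
      smul_smul_comm', hF, smul_assoc, sub_smul, hK, hKi, ← mul_smul (F p) (F p ^ s), add_assoc, ← sub_smul,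
      smul_smul ((q p - (q p)⁻¹)⁻¹), ← add_smul, Nat.add_sub_cancel]
    congr 2
    -- The increment $[s+1][r-s-1]-[s][r-s]$ equals $[r-1-2s]$.
    have key := qInt_comm p (s : ℤ) (r - (s + 1))
    rw [show r - ((s : ℤ) + 1) + 1 = r - s by ring] at key
    rw [mul_inv, mul_inv, hε', mul_assoc _ (q p ^ (r - 1)), ← zpow_add₀ h0, ← zpow_neg, ← zpow_neg,
      mul_assoc _ (q p ^ (-(r - 1))), ← zpow_add₀ h0,
      show r - 1 + -2 * (s : ℤ) = r - (s + 1) - s by ring,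
      show -(r - 1) + -(-2 * (s : ℤ)) = s - (r - (s + 1)) by ring]
    push_cast
    linear_combination ((ε : ℤ) : ℂ) * key

end Weight

/-! ### Recognizing irreducible and zigzag modules -/

section Recognition
open Uq

theorem F_pow_smul_of_le {p : ℕ} {V : Type*} [AddCommGroup V] [Module (Uq p) V] {s : ℕ}
    (h : p ≤ s) (v : V) : F p ^ s • v = 0 := by
  rw [pow_eq_zero_of_le h (F_pow p), zero_smul]

variable {p : ℕ} {V W : Type*} [AddCommGroup V] [Module ℂ V] [Module (Uq p) V]
  [IsScalarTower ℂ (Uq p) V] [AddCommGroup W] [Module ℂ W] [Module (Uq p) W]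
  [IsScalarTower ℂ (Uq p) W]

theorem IsX.of_equiv {ε : ℤˣ} {r : ℕ} (h : IsX p ε r V) (f : V ≃ₗ[Uq p] W) : IsX p ε r W := by
  obtain ⟨b, v, hb, h⟩ := h
  refine ⟨b.map (f.restrictScalars ℂ), fun s => f (v s), fun s => by simp [hb], fun s hs => ?_⟩
  obtain ⟨h1, h2, h3⟩ := h s hs
  have hc : ∀ (c : ℂ) (w : V), f (c • w) = c • f w := (f.restrictScalars ℂ).map_smul
  refine ⟨?_, ?_, ?_⟩
  · rw [← map_smul, h1, hc]
  · rw [← map_smul, h2]; split_ifs <;> simp [hc]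
  · rw [← map_smul, h3]; split_ifs <;> simp

theorem IsW.of_equiv {ε : ℤˣ} {r n : ℕ} (h : IsW p ε r n V) (f : V ≃ₗ[Uq p] W) :
    IsW p ε r n W := by
  obtain ⟨b, t, u, hb₁, hb₂, ht, hu⟩ := h
  have hc : ∀ (c : ℂ) (w : V), f (c • w) = c • f w := (f.restrictScalars ℂ).map_smul
  refine ⟨b.map (f.restrictScalars ℂ), fun i s => f (t i s), fun j s => f (u j s),
    fun i s => by simp [hb₁], fun j s => by simp [hb₂], fun i hi s hs => ?_, fun j hj s hs => ?_⟩
  · obtain ⟨h1, h2, h3⟩ := ht i hi s hs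
    refine ⟨?_, ?_, ?_⟩
    · rw [← map_smul, h1, hc]
    · rw [← map_smul, h2]; split_ifs <;> simp [hc]
    · rw [← map_smul, h3]; split_ifs <;> simp
  · obtain ⟨h1, h2, h3⟩ := hu j hj s hs
    refine ⟨?_, ?_, ?_⟩
    · rw [← map_smul, h1, hc]
    · rw [← map_smul, h2]; split_ifs <;> simp [hc]
    · rw [← map_smul, h3]; split_ifs <;> simp

variable [p.AtLeastTwo]

/-- With $Ev=0$ the commutation formula for $EF^sv$ is exactly the defining action of $X_r$. -/
theorem isX_of_primitive {ε : ℤˣ} {r : ℕ} {v : V}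
    (hK : K p • v = (((ε : ℤ) : ℂ) * q p ^ ((r : ℤ) - 1)) • v) (hE : E p • v = 0)
    (hF : F p ^ r • v = 0) (b : Module.Basis (Fin r) ℂ V) (hb : ∀ s, b s = F p ^ (s : ℕ) • v) :
    IsX p ε r V := by
  refine ⟨b, fun s => F p ^ s • v, hb, fun s hs => ⟨?_, ?_, ?_⟩⟩
  · rw [K_smul_F_pow hK, mul_assoc, ← zpow_add₀ (q_ne_zero p)]
    congr 3
  · rw [E_smul_F_pow hK, hE, smul_zero, zero_add]
    split_ifs with h
    · subst h; simp [qInt_zero]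
    · rfl
  · rw [← mul_smul, ← pow_succ']
    split_ifs with h
    · rfl
    · rw [show s + 1 = r by omega, hF]

/-- Each $x_i$ generates a string $F^sx_i$ with $s<p$: its first $r$ vectors form a top copy, the
other $p-r$ a socle copy. The string crosses from top to socle by $F$ alone, since $[r-r]=0$ blocks
the return by $E$. The relation $Ex_{i+1}=F^{p-1}x_i$ glues the next top copy to the end of this
socle copy. -/
theorem isW_of_chain {ε : ℤˣ} {r n : ℕ} (hr : 1 ≤ r) (hrp : r < p) {x : ℕ → V}
    (hK : ∀ i < n, K p • x i = (((ε : ℤ) : ℂ) * q p ^ ((r : ℤ) - 1)) • x i)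
    (hE₀ : E p • x 0 = 0) (hE : ∀ i, i + 1 < n → E p • x (i + 1) = F p ^ (p - 1) • x i)
    (hF : F p ^ r • x (n - 1) = 0)
    (b : Module.Basis ((Fin n × Fin r) ⊕ (Fin (n - 1) × Fin (p - r))) ℂ V)
    (hb₁ : ∀ i s, b (Sum.inl (i, s)) = F p ^ (s : ℕ) • x i)
    (hb₂ : ∀ j s, b (Sum.inr (j, s)) = F p ^ (r + s : ℕ) • x j) : IsW p ε r n V := by
  -- $Ex_i$ is zero or the end of the preceding string, so the extra term $F^sEx_i$ of the
  -- commutation formula survives only at $s=0$.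
  have hFE : ∀ i < n, ∀ s, 1 ≤ s → F p ^ s • E p • x i = 0 := by
    intro i hi s hs
    rcases i with _ | i
    · rw [hE₀, smul_zero]
    · rw [hE i hi, ← mul_smul, ← pow_add, F_pow_smul_of_le (by omega)]
  refine ⟨b, fun i s => F p ^ s • x i, fun j s => F p ^ (r + s) • x j, hb₁, hb₂, ?_, ?_⟩
  · refine fun i hi s hs => ⟨?_, ?_, ?_⟩
    · rw [K_smul_F_pow (hK i hi), mul_assoc, ← zpow_add₀ (q_ne_zero p)]
      congr 3
    · split_ifs with h h'
      · subst h h'; simpa using hE₀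
      · subst h
        beta_reduce
        obtain ⟨i, rfl⟩ := Nat.exists_eq_succ_of_ne_zero h'
        rw [pow_zero, one_smul, hE i hi, show r + (p - r - 1) = p - 1 by omega]
        rfl
      · rw [E_smul_F_pow (hK i hi), hFE i hi s (by omega), zero_add]
    · rw [← mul_smul, ← pow_succ']
      split_ifs with h h'
      · rfl
      · rw [show s + 1 = r + 0 by omega]
      · rw [show s + 1 = r by omega, show i = n - 1 by omega, hF]
  · refine fun j hj s hs => ⟨?_, ?_, ?_⟩
    · rw [K_smul_F_pow (hK j (by omega)), mul_assoc, ← zpow_add₀ (q_ne_zero p)]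
      congr 1
      have e1 : q p ^ ((p : ℤ) - r - 1 - 2 * s)
          = q p ^ ((1 : ℤ) * p) * q p ^ (-(r : ℤ) - 1 - 2 * s) := by
        rw [← zpow_add₀ (q_ne_zero p)]; congr 1; ring
      rw [e1, q_zpow_mul_p,
        show (r : ℤ) - 1 + -2 * ((r + s : ℕ) : ℤ) = -(r : ℤ) - 1 - 2 * s by push_cast; ring]
      simp
    · rw [E_smul_F_pow (hK j (by omega)), hFE j (by omega) _ (by omega), zero_add]
      split_ifs with h
      · subst h; simp [qInt_zero]
      · rw [show r + s - 1 = r + (s - 1) by omega]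
        congr 1
        -- The coefficient $\varepsilon[r+s][-s]$ becomes $-\varepsilon[s][p-r-s]$, which is the
        -- action in $X^{-\varepsilon}_{p-r}$.
        rw [show (r : ℤ) - ((r + s : ℕ) : ℤ) = -s by push_cast; ring, qInt_neg,
          show (p : ℤ) - r - s = p - ((r + s : ℕ) : ℤ) by push_cast; ring, qInt_p_sub]
        ring
    · rw [← mul_smul, ← pow_succ']
      split_ifs with h
      · rfl
      · rw [F_pow_smul_of_le (by omega)]

end Recognition

/-! ### Projective covers -/

section Projective
open Uq

/-- The average of $\mu^{-j}K^j$ over the cyclic group of order $2p$. It is an element of the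
algebra, so it commutes with all module maps and can correct an arbitrary preimage of a weight
vector. -/
theorem exists_weight_projection {p : ℕ} (hp : 0 < p) {μ : ℂ} (hμ : μ ^ (2 * p) = 1) :
    ∃ π : Uq p, K p * π = μ • π ∧ π * K p = μ • π ∧
      ∀ {V : Type*} [AddCommGroup V] [Module ℂ V] [Module (Uq p) V] [IsScalarTower ℂ (Uq p) V]
        (v : V), K p • v = μ • v → π • v = v := by
  have hp' : 0 < 2 * p := by omega
  have hμ0 : μ ≠ 0 := by rintro rfl; rw [zero_pow hp'.ne'] at hμ; exact zero_ne_one hμ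
  set S : Uq p := ∑ j ∈ Finset.range (2 * p), (μ⁻¹ ^ j) • K p ^ j with hS
  -- The sum is cyclic: its terms for $j=0$ and $j=2p$ agree because $\mu^{2p}=1$ and $K^{2p}=1$.
  have hshift : ∑ j ∈ Finset.range (2 * p), (μ⁻¹ ^ (j + 1)) • K p ^ (j + 1) = S := by
    have h1 := Finset.sum_range_succ (fun j => (μ⁻¹ ^ j) • K p ^ j) (2 * p)
    have h2 := Finset.sum_range_succ' (fun j => (μ⁻¹ ^ j) • K p ^ j) (2 * p)
    rw [h1, inv_pow μ (2 * p), hμ, K_pow] at h2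
    simpa [hS] using h2.symm
  have hKS : K p * S = μ • S := by
    conv_rhs => rw [← hshift]
    rw [hS, Finset.mul_sum, Finset.smul_sum]
    refine Finset.sum_congr rfl fun j _ => ?_
    rw [smul_smul, pow_succ', ← mul_assoc, mul_inv_cancel₀ hμ0, one_mul, pow_succ' (K p),
      mul_smul_comm]
  have hcomm : S * K p = K p * S := by
    rw [hS, Finset.mul_sum, Finset.sum_mul]
    refine Finset.sum_congr rfl fun j _ => ?_
    rw [smul_mul_assoc, mul_smul_comm, ← pow_succ, ← pow_succ']
  refine ⟨((2 * p : ℕ) : ℂ)⁻¹ • S, ?_, ?_, ?_⟩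
  · rw [mul_smul_comm, hKS, smul_comm]
  · rw [smul_mul_assoc, hcomm, hKS, smul_comm]
  · intro V _ _ _ _ v hv
    have hpow : ∀ j : ℕ, K p ^ j • v = μ ^ j • v := by
      intro j
      induction j with
      | zero => simp
      | succ j ih => rw [pow_succ', mul_smul, ih, smul_smul_comm', hv, smul_smul, pow_succ]
    rw [smul_assoc, hS, Finset.sum_smul]
    have : ∀ j ∈ Finset.range (2 * p), ((μ⁻¹ ^ j) • K p ^ j) • v = v := by
      intro j _
      rw [smul_assoc, hpow, smul_smul, inv_pow, inv_mul_cancel₀ (pow_ne_zero _ hμ0), one_smul]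
    rw [Finset.sum_congr rfl this, Finset.sum_const, Finset.card_range, ← Nat.cast_smul_eq_nsmul ℂ,
      inv_smul_smul₀ (by exact_mod_cast hp'.ne')]

variable {p : ℕ} {V W : Type*} [AddCommGroup V] [Module ℂ V] [Module (Uq p) V]
  [IsScalarTower ℂ (Uq p) V] [AddCommGroup W] [Module ℂ W] [Module (Uq p) W]
  [IsScalarTower ℂ (Uq p) W]

theorem weight_projection_smul_eq_zero {μ ν : ℂ} {π : Uq p}
    (h' : π * K p = μ • π) {v : V} (hv : K p • v = ν • v) (hμν : ν ≠ μ) : π • v = 0 := by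
  have h1 : (π * K p) • v = ν • π • v := by rw [mul_smul, hv, smul_smul_comm']
  rw [h', smul_assoc] at h1
  have h2 : (μ - ν) • π • v = 0 := by rw [sub_smul, h1, sub_self]
  exact (smul_eq_zero.1 h2).resolve_left (sub_ne_zero.2 hμν.symm)

theorem K_smul_E_pow {μ : ℂ} {v : V} (h : K p • v = μ • v) (s : ℕ) :
    K p • E p ^ s • v = (μ * q p ^ (2 * (s : ℤ))) • E p ^ s • v := by
  induction s with
  | zero => simpa using h
  | succ s ih =>
    rw [pow_succ', mul_smul, K_smul_E ih, mul_assoc, ← zpow_add₀ (q_ne_zero p)]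
    congr 3

/-- A complex span of weight vectors that is stable under `E` and `F`. -/
def subOfWeightVectors (S : Set V) (hK : ∀ v ∈ S, ∃ μ : ℂ, μ ≠ 0 ∧ K p • v = μ • v)
    (hE : ∀ v ∈ S, E p • v ∈ Submodule.span ℂ S) (hF : ∀ v ∈ S, F p • v ∈ Submodule.span ℂ S) :
    Submodule (Uq p) V :=
  subOfGen (Submodule.span ℂ S) (by
    intro g v hv
    induction hv using Submodule.span_induction with
    | zero => rw [smul_zero]; exact Submodule.zero_mem _
    | add x y _ _ hx hy => rw [smul_add]; exact Submodule.add_mem _ hx hy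
    | smul c x _ hx => rw [smul_smul_comm']; exact Submodule.smul_mem _ _ hx
    | mem x hx =>
      obtain ⟨μ, h0, h⟩ := hK x hx
      cases g
      · exact hE x hx
      · exact hF x hx
      · rw [h]; exact Submodule.smul_mem _ _ (Submodule.subset_span hx)
      · rw [Kinv_smul h0 h]; exact Submodule.smul_mem _ _ (Submodule.subset_span hx))

theorem mem_subOfWeightVectors {S : Set V} {hK hE hF} {v : V} :
    v ∈ subOfWeightVectors (p := p) S hK hE hF ↔ v ∈ Submodule.span ℂ S := Iff.rfl

/-- A vector of weight `ε 𝔮^(p-2)` killed by `E²`. -/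
structure IsDominant (ε : ℤˣ) (e : V) : Prop where
  K_smul : K p • e = (((ε : ℤ) : ℂ) * q p ^ ((p : ℤ) - 2)) • e
  E_smul_E_smul : E p • E p • e = 0

namespace IsDominant

variable {ε : ℤˣ} {e : V}

theorem weight_ne_zero (ε : ℤˣ) (n : ℤ) : (((ε : ℤ) : ℂ) * q p ^ n) ≠ 0 :=
  mul_ne_zero (by exact_mod_cast ε.ne_zero) (zpow_ne_zero _ (q_ne_zero p))

theorem K_smul_E_smul (h : IsDominant (p := p) ε e) :
    K p • E p • e = (((ε : ℤ) : ℂ) * q p ^ (p : ℤ)) • E p • e := by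
  rw [K_smul_E h.K_smul, mul_assoc, ← zpow_add₀ (q_ne_zero p), sub_add_cancel]

theorem K_smul_F_pow (h : IsDominant (p := p) ε e) (s : ℕ) :
    K p • F p ^ s • e = (((ε : ℤ) : ℂ) * q p ^ ((p : ℤ) - 2 - 2 * s)) • F p ^ s • e := by
  rw [QPlane.K_smul_F_pow h.K_smul, mul_assoc, ← zpow_add₀ (q_ne_zero p)]
  congr 3

theorem K_smul_F_pow_E (h : IsDominant (p := p) ε e) (s : ℕ) :
    K p • F p ^ s • E p • e
      = (((ε : ℤ) : ℂ) * q p ^ ((p : ℤ) - 2 * s)) • F p ^ s • E p • e := by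
  rw [QPlane.K_smul_F_pow h.K_smul_E_smul, mul_assoc, ← zpow_add₀ (q_ne_zero p)]
  congr 3

variable [p.AtLeastTwo]

theorem E_smul_F_pow (h : IsDominant (p := p) ε e) (s : ℕ) :
    E p • F p ^ s • e = F p ^ s • E p • e
      + (((ε : ℤ) : ℂ) * qInt p s * qInt p ((p : ℤ) - 1 - s)) • F p ^ (s - 1) • e := by
  refine QPlane.E_smul_F_pow ?_ s
  rw [h.K_smul]; congr 3; ring

theorem E_smul_F_pow_E (h : IsDominant (p := p) ε e) (s : ℕ) :
    E p • F p ^ s • E p • e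
      = (((ε : ℤ) : ℂ) * qInt p s * qInt p ((p : ℤ) + 1 - s)) • F p ^ (s - 1) • E p • e := by
  rw [QPlane.E_smul_F_pow (ε := ε) (r := p + 1), h.E_smul_E_smul, smul_zero, zero_add]
  rw [h.K_smul_E_smul]; congr 3; ring

/-- The coefficient of $E\cdot F\cdot Ee$ contains $[p]=0$. -/
theorem E_smul_F_E (h : IsDominant (p := p) ε e) : E p • F p • E p • e = 0 := by
  have := h.E_smul_F_pow_E 1
  rw [pow_one] at this
  rw [this, show (p : ℤ) + 1 - ((1 : ℕ) : ℤ) = p by push_cast; ring, qInt_of_dvd p dvd_rfl]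
  simp

theorem coeff_ne_zero (ε : ℤˣ) {a b : ℤ} (ha : 0 < a) (ha' : a < p) (hb : 0 < b) (hb' : b < p) :
    ((ε : ℤ) : ℂ) * qInt p a * qInt p b ≠ 0 :=
  mul_ne_zero (mul_ne_zero (by exact_mod_cast ε.ne_zero) (qInt_ne_zero_of_lt p ha ha'))
    (qInt_ne_zero_of_lt p hb hb')

/-- Climbing back from $F^{p-2}e$ meets only the factors $[s][p-1-s]$ with $1\le s\le p-2$, all
nonzero. The price is a component along the $Ee$-string. -/
theorem E_pow_smul_F_pow (h : IsDominant (p := p) ε e) {j : ℕ} (hj : j ≤ p - 2) :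
    ∃ a b : ℂ, a ≠ 0 ∧
      E p ^ j • F p ^ (p - 2) • e = a • F p ^ (p - 2 - j) • e + b • F p ^ (p - 1 - j) • E p • e := by
  have hp := two_le p
  induction j with
  | zero => exact ⟨1, 0, one_ne_zero, by simp⟩
  | succ j ih =>
    obtain ⟨a, b, ha, hab⟩ := ih (by omega)
    rw [pow_succ', mul_smul, hab, smul_add, smul_smul_comm', smul_smul_comm', h.E_smul_F_pow,
      h.E_smul_F_pow_E, smul_add, smul_smul a, smul_smul b, show p - 2 - j - 1 = p - 2 - (j + 1) by omega,
      show p - 1 - j - 1 = p - 1 - (j + 1) by omega,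
      show p - 2 - j = p - 1 - (j + 1) by omega]
    -- The $Ee$-component receives $a$ from the term $F^sEe$ of the commutation formula, and $b$
    -- times the factor of the climb along the $Ee$-string.
    refine ⟨_, a + b * (((ε : ℤ) : ℂ) * qInt p ((p - 1 - j : ℕ) : ℤ)
        * qInt p ((p : ℤ) + 1 - ((p - 1 - j : ℕ) : ℤ))),
      mul_ne_zero ha (coeff_ne_zero (p := p) ε (a := ((p - 1 - (j + 1) : ℕ) : ℤ))
        (b := (p : ℤ) - 1 - ((p - 1 - (j + 1) : ℕ) : ℤ)) ?_ ?_ ?_ ?_), ?_⟩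
    iterate 4 omega
    generalize F p ^ (p - 1 - (j + 1)) • E p • e = x
    generalize F p ^ (p - 2 - (j + 1)) • e = y
    module

/-- Here the factors are $[s][p+1-s]$ with $2\le s\le p-1$, again nonzero. -/
theorem E_pow_smul_F_pow_E (h : IsDominant (p := p) ε e) {j : ℕ} (hj : j ≤ p - 2) :
    ∃ c : ℂ, c ≠ 0 ∧ E p ^ j • F p ^ (p - 1) • E p • e = c • F p ^ (p - 1 - j) • E p • e := by
  have hp := two_le p
  induction j with
  | zero => exact ⟨1, one_ne_zero, by simp⟩
  | succ j ih =>
    obtain ⟨a, ha, hab⟩ := ih (by omega)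
    rw [pow_succ', mul_smul, hab, smul_smul_comm', h.E_smul_F_pow_E, smul_smul]
    refine ⟨_, mul_ne_zero ha (coeff_ne_zero (p := p) ε (a := ((p - 1 - j : ℕ) : ℤ))
      (b := (p : ℤ) + 1 - ((p - 1 - j : ℕ) : ℤ)) ?_ ?_ ?_ ?_), rfl⟩
    iterate 4 omega

/-- $E^{p-2}F^{p-2}e=ae+bFEe$ with $a\ne0$, and $E^{p-2}F^{p-1}Ee=cFEe$ with $c\ne0$. The sources
$F^{p-2}e$ and $F^{p-1}Ee$ have the same weight, so a combination of them removes the unwanted term.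
-/
theorem exists_E_pow_smul_eq (h : IsDominant (p := p) ε e) :
    ∃ w : V, K p • w = (((ε : ℤ) : ℂ) * q p ^ (2 - (p : ℤ))) • w ∧ E p ^ (p - 2) • w = e := by
  have hp := two_le p
  obtain ⟨a, b, ha, hab⟩ := h.E_pow_smul_F_pow le_rfl
  obtain ⟨c, hc, hcc⟩ := h.E_pow_smul_F_pow_E le_rfl
  refine ⟨a⁻¹ • F p ^ (p - 2) • e - (a⁻¹ * b * c⁻¹) • F p ^ (p - 1) • E p • e, ?_, ?_⟩
  · rw [smul_sub, smul_smul_comm', smul_smul_comm', h.K_smul_F_pow, h.K_smul_F_pow_E,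
      show (p : ℤ) - 2 - 2 * ((p - 2 : ℕ) : ℤ) = 2 - p by omega,
      show (p : ℤ) - 2 * ((p - 1 : ℕ) : ℤ) = 2 - p by omega]
    generalize F p ^ (p - 2) • e = x
    generalize F p ^ (p - 1) • E p • e = y
    module
  · rw [smul_sub, smul_smul_comm', smul_smul_comm', hab, hcc, Nat.sub_self, pow_zero, one_smul]
    generalize F p ^ (p - 1 - (p - 2)) • E p • e = y
    match_scalars <;> field_simp
    ring

/-- The condition $E^2e=0$ does not pass to an arbitrary preimage. Writing $e=E^{p-2}w$ leaves only
a weight condition to lift, which the weight projection takes care of. -/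
theorem exists_lift (h : IsDominant (p := p) ε e) (f : W →ₗ[Uq p] V)
    (hf : Function.Surjective f) : ∃ v : W, IsDominant (p := p) ε v ∧ f v = e := by
  have hp := two_le p
  obtain ⟨w, hw, rfl⟩ := h.exists_E_pow_smul_eq
  obtain ⟨w, rfl⟩ := hf w
  have hμ : (((ε : ℤ) : ℂ) * q p ^ (2 - (p : ℤ))) ^ (2 * p) = 1 := by
    have h1 : (((ε : ℤ) : ℂ)) ^ 2 = 1 := by
      rcases Int.units_eq_one_or ε with rfl | rfl <;> simp
    rw [mul_pow, pow_mul, h1, one_pow, one_mul, ← zpow_natCast, ← zpow_mul, mul_comm, zpow_mul,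
      zpow_natCast, (q_primitive p).pow_eq_one, one_zpow]
  obtain ⟨π, h1, -, h3⟩ := exists_weight_projection (by omega) hμ
  refine ⟨E p ^ (p - 2) • π • w, ⟨?_, ?_⟩, ?_⟩
  · have : K p • π • w = (((ε : ℤ) : ℂ) * q p ^ (2 - (p : ℤ))) • π • w := by
      rw [← mul_smul, h1, smul_assoc]
    rw [K_smul_E_pow this, mul_assoc, ← zpow_add₀ (q_ne_zero p)]
    congr 3; omega
  -- $E^2E^{p-2}=E^p=0$ in the algebra itself.
  · rw [← mul_smul (E p) (E p ^ _), ← pow_succ', ← mul_smul (E p) (E p ^ _), ← pow_succ',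
      show p - 2 + 1 + 1 = p by omega, E_pow, zero_smul]
  · rw [map_smul, map_smul, h3 _ hw]

end IsDominant

end Projective

/-! ### Modules of dimension $2p$ generated by a dominant vector -/

section Cover
open Uq

namespace IsDominant

/-- The vectors `Fᵃe` and `FᵃEe`, `0 ≤ a < p`. -/
def family (p : ℕ) {V : Type*} [AddCommGroup V] [Module (Uq p) V] (e : V) : Fin p ⊕ Fin p → V :=
  Sum.elim (fun a => F p ^ (a : ℕ) • e) fun a => F p ^ (a : ℕ) • E p • e

theorem F_pow_mem_span_family {p : ℕ} {V : Type*} [AddCommGroup V] [Module ℂ V] [Module (Uq p) V]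
    (e : V) (a : ℕ) :
    F p ^ a • e ∈ Submodule.span ℂ (Set.range (family p e)) := by
  by_cases h : a < p
  · exact Submodule.subset_span ⟨Sum.inl ⟨a, h⟩, rfl⟩
  · rw [F_pow_smul_of_le (by omega)]; exact Submodule.zero_mem _

theorem F_pow_E_mem_span_family {p : ℕ} {V : Type*} [AddCommGroup V] [Module ℂ V]
    [Module (Uq p) V] (e : V) (a : ℕ) :
    F p ^ a • E p • e ∈ Submodule.span ℂ (Set.range (family p e)) := by
  by_cases h : a < p
  · exact Submodule.subset_span ⟨Sum.inr ⟨a, h⟩, rfl⟩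
  · rw [F_pow_smul_of_le (by omega)]; exact Submodule.zero_mem _

variable {p : ℕ} [p.AtLeastTwo] {V W : Type*} [AddCommGroup V] [Module ℂ V] [Module (Uq p) V]
  [IsScalarTower ℂ (Uq p) V] [AddCommGroup W] [Module ℂ W] [Module (Uq p) W]
  [IsScalarTower ℂ (Uq p) W] {ε : ℤˣ} {e : V}

/-- The span of `Fᵃe` and `FᵃEe` as a submodule. -/
def generated (h : IsDominant (p := p) ε e) : Submodule (Uq p) V :=
  subOfWeightVectors (Set.range (family p e))
    (by
      rintro _ ⟨a | a, rfl⟩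
      · exact ⟨_, weight_ne_zero ε _, h.K_smul_F_pow a⟩
      · exact ⟨_, weight_ne_zero ε _, h.K_smul_F_pow_E a⟩)
    (by
      rintro _ ⟨a | a, rfl⟩
      · rw [family, Sum.elim_inl, h.E_smul_F_pow]
        exact Submodule.add_mem _ (F_pow_E_mem_span_family e _)
          (Submodule.smul_mem _ _ (F_pow_mem_span_family e _))
      · rw [family, Sum.elim_inr, h.E_smul_F_pow_E]
        exact Submodule.smul_mem _ _ (F_pow_E_mem_span_family e _))
    (by
      rintro _ ⟨a | a, rfl⟩
      · rw [family, Sum.elim_inl, ← mul_smul, ← pow_succ']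
        exact F_pow_mem_span_family e _
      · rw [family, Sum.elim_inr, ← mul_smul, ← pow_succ']
        exact F_pow_E_mem_span_family e _)

theorem span_family (h : IsDominant (p := p) ε e)
    (hgen : ∀ N : Submodule (Uq p) V, e ∈ N → N = ⊤) :
    ⊤ ≤ Submodule.span ℂ (Set.range (family p e)) := by
  intro v _
  have h1 := hgen h.generated (mem_subOfWeightVectors.2 (by simpa using F_pow_mem_span_family e 0))
  exact mem_subOfWeightVectors.1 (show v ∈ h.generated by rw [h1]; trivial)

/-- The basis of vectors `Fᵃe`, `FᵃEe` of a `2p`-dimensional module generated by `e`. -/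
def basis (h : IsDominant (p := p) ε e) (hgen : ∀ N : Submodule (Uq p) V, e ∈ N → N = ⊤)
    (hdim : Module.finrank ℂ V = 2 * p) : Module.Basis (Fin p ⊕ Fin p) ℂ V :=
  basisOfTopLeSpanOfCardEqFinrank (family p e) (h.span_family hgen) (by simp [hdim, two_mul])

theorem basis_apply (h : IsDominant (p := p) ε e)
    (hgen : ∀ N : Submodule (Uq p) V, e ∈ N → N = ⊤) (hdim : Module.finrank ℂ V = 2 * p)
    (i : Fin p ⊕ Fin p) : h.basis hgen hdim i = family p e i := by
  rw [basis, coe_basisOfTopLeSpanOfCardEqFinrank]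

/-- Dominance alone determines how the generators act on $F^ae$ and $F^aEe$. In dimension $2p$ these
vectors are independent, so the linear map carrying them to the corresponding vectors of $v$ is well
defined, and it is equivariant. -/
theorem exists_hom (h : IsDominant (p := p) ε e)
    (hgen : ∀ N : Submodule (Uq p) V, e ∈ N → N = ⊤) (hdim : Module.finrank ℂ V = 2 * p)
    {v : W} (hv : IsDominant (p := p) ε v) : ∃ φ : V →ₗ[Uq p] W, φ e = v := by
  have hp := two_le p
  set b := h.basis hgen hdim with hb
  set φ : V →ₗ[ℂ] W := b.constr ℂ (family p v) with hφ
  have h1 : ∀ a : ℕ, φ (F p ^ a • e) = F p ^ a • v := by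
    intro a
    by_cases ha : a < p
    · have : F p ^ a • e = b (Sum.inl ⟨a, ha⟩) := by rw [hb, basis_apply]; rfl
      rw [this, hφ, Module.Basis.constr_basis]; rfl
    · rw [F_pow_smul_of_le (by omega), F_pow_smul_of_le (by omega), map_zero]
  have h2 : ∀ a : ℕ, φ (F p ^ a • E p • e) = F p ^ a • E p • v := by
    intro a
    by_cases ha : a < p
    · have : F p ^ a • E p • e = b (Sum.inr ⟨a, ha⟩) := by rw [hb, basis_apply]; rfl
      rw [this, hφ, Module.Basis.constr_basis]; rfl
    · rw [F_pow_smul_of_le (by omega), F_pow_smul_of_le (by omega), map_zero]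
  have hcomm : ∀ g w, φ (Uq.gen p g • w) = Uq.gen p g • φ w := by
    intro g w
    have hw : w ∈ Submodule.span ℂ (Set.range b) := by rw [b.span_eq]; trivial
    induction hw using Submodule.span_induction with
    | zero => simp
    | add x y _ _ hx hy => rw [smul_add, map_add, hx, hy, map_add, smul_add]
    | smul c x _ hx => rw [smul_smul_comm', map_smul, hx, map_smul, smul_smul_comm']
    | mem x hx =>
      obtain ⟨a | a, rfl⟩ := hx <;> rw [hb, basis_apply]
      · simp only [family, Sum.elim_inl, h1]
        cases g
        · rw [h.E_smul_F_pow, hv.E_smul_F_pow, map_add, φ.map_smul, h1, h2]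
        · rw [← mul_smul, ← pow_succ', h1, ← mul_smul, ← pow_succ']
        · rw [h.K_smul_F_pow, hv.K_smul_F_pow, map_smul, h1]
        · rw [Kinv_smul (weight_ne_zero ε _) (h.K_smul_F_pow a),
            Kinv_smul (weight_ne_zero ε _) (hv.K_smul_F_pow a), map_smul, h1]
      · simp only [family, Sum.elim_inr, h2]
        cases g
        · rw [h.E_smul_F_pow_E, hv.E_smul_F_pow_E, map_smul, h2]
        · rw [← mul_smul (F p) (F p ^ _), ← pow_succ', h2, ← mul_smul (F p) (F p ^ _), ← pow_succ']
        · rw [h.K_smul_F_pow_E, hv.K_smul_F_pow_E, map_smul, h2]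
        · rw [Kinv_smul (weight_ne_zero ε _) (h.K_smul_F_pow_E a),
            Kinv_smul (weight_ne_zero ε _) (hv.K_smul_F_pow_E a), map_smul, h2]
  exact ⟨linOfGen φ hcomm, show φ e = v by simpa using h1 0⟩

/-- A surjection from a free module splits: lift $e$ to a dominant vector $v$ and extend $e\mapsto
v$ to a map. The composite with the surjection fixes the generator $e$, hence is the identity. -/
theorem projective (h : IsDominant (p := p) ε e)
    (hgen : ∀ N : Submodule (Uq p) V, e ∈ N → N = ⊤) (hdim : Module.finrank ℂ V = 2 * p) :
    Module.Projective (Uq p) V := by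
  refine Module.Projective.of_lifting_property'' fun f hf => ?_
  obtain ⟨v, hv, hvf⟩ := h.exists_lift (W := V →₀ Uq p) f hf
  obtain ⟨φ, hφ⟩ := h.exists_hom hgen hdim hv
  refine ⟨φ, ?_⟩
  have h1 := hgen (LinearMap.eqLocus (f ∘ₗ φ) LinearMap.id) (by simp [hφ, hvf])
  exact LinearMap.ext fun x => by
    have : x ∈ LinearMap.eqLocus (f ∘ₗ φ) LinearMap.id := by rw [h1]; trivial
    exact this

/-- Spanning set of the radical of a module generated by a dominant vector. -/
def radicalSet (p : ℕ) {V : Type*} [AddCommGroup V] [Module (Uq p) V] (e : V) : Set V :=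
  {F p ^ (p - 1) • e} ∪ Set.range fun a : ℕ => F p ^ a • E p • e

/-- The submodule spanned by `Fᵖ⁻¹e` and all `FᵃEe`. -/
def radical (h : IsDominant (p := p) ε e) : Submodule (Uq p) V :=
  subOfWeightVectors (radicalSet p e)
    (by
      rintro _ (rfl | ⟨a, rfl⟩)
      · exact ⟨_, weight_ne_zero ε _, h.K_smul_F_pow _⟩
      · exact ⟨_, weight_ne_zero ε _, h.K_smul_F_pow_E a⟩)
    (by
      have hp := two_le p
      rintro _ (rfl | ⟨a, rfl⟩)
      -- $EF^{p-1}e$ has no component along $F^{p-2}e$: its coefficient contains $[0]$.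
      · rw [h.E_smul_F_pow, show (p : ℤ) - 1 - ((p - 1 : ℕ) : ℤ) = 0 by omega, qInt_zero,
          mul_zero, zero_smul, add_zero]
        exact Submodule.subset_span (Or.inr ⟨_, rfl⟩)
      · rw [h.E_smul_F_pow_E]
        exact Submodule.smul_mem _ _ (Submodule.subset_span (Or.inr ⟨_, rfl⟩)))
    (by
      have hp := two_le p
      rintro _ (rfl | ⟨a, rfl⟩)
      · rw [← mul_smul, ← pow_succ', F_pow_smul_of_le (by omega)]
        exact Submodule.zero_mem _
      · simp only
        rw [← mul_smul, ← pow_succ']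
        exact Submodule.subset_span (Or.inr ⟨_, rfl⟩))

theorem F_pow_E_mem_radical (h : IsDominant (p := p) ε e) (a : ℕ) :
    F p ^ a • E p • e ∈ h.radical := Submodule.subset_span (Or.inr ⟨a, rfl⟩)

theorem F_pow_mem_radical (h : IsDominant (p := p) ε e) {a : ℕ} (ha : p - 1 ≤ a) :
    F p ^ a • e ∈ h.radical := by
  obtain rfl | ha := ha.eq_or_lt
  · exact Submodule.subset_span (Or.inl rfl)
  · rw [F_pow_smul_of_le (by omega)]; exact Submodule.zero_mem _

/-- Write $e=l+x$ with $l$ in the radical, $x\in N$, and project to the weight of $e$. Among the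
spanning vectors of the radical only $FEe$ can contribute, so $e-cFEe\in N$. Since $EFEe=0$,
applying $E$ gives $Ee\in N$; then $FEe\in N$ and finally $e\in N$. -/
theorem radical_superfluous (h : IsDominant (p := p) ε e)
    (hgen : ∀ N : Submodule (Uq p) V, e ∈ N → N = ⊤) (N : Submodule (Uq p) V)
    (hN : h.radical ⊔ N = ⊤) : N = ⊤ := by
  have hp := two_le p
  have hμ : (((ε : ℤ) : ℂ) * q p ^ ((p : ℤ) - 2)) ^ (2 * p) = 1 := by
    have h1 : (((ε : ℤ) : ℂ)) ^ 2 = 1 := by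
      rcases Int.units_eq_one_or ε with rfl | rfl <;> simp
    rw [mul_pow, pow_mul, h1, one_pow, one_mul, ← zpow_natCast, ← zpow_mul, mul_comm, zpow_mul,
      zpow_natCast, (q_primitive p).pow_eq_one, one_zpow]
  -- Two weights with the same sign agree only if the exponents agree modulo $2p$.
  have hne : ∀ n : ℤ, ¬ (2 * p : ℤ) ∣ n - (p - 2) →
      ((ε : ℤ) : ℂ) * q p ^ n ≠ ((ε : ℤ) : ℂ) * q p ^ ((p : ℤ) - 2) := by
    intro n hn heq
    have h2 := mul_left_cancel₀ (by exact_mod_cast ε.ne_zero) heq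
    have h3 : q p ^ (n - (p - 2)) = 1 := by
      rw [zpow_sub₀ (q_ne_zero p), h2, div_self (zpow_ne_zero _ (q_ne_zero p))]
    exact hn (by exact_mod_cast ((q_primitive p).zpow_eq_one_iff_dvd _).1 h3)
  obtain ⟨π, -, hπK, hπ⟩ := exists_weight_projection (by omega) hμ
  have hrad : ∀ l ∈ Submodule.span ℂ (radicalSet p e), ∃ c : ℂ, π • l = c • F p • E p • e := by
    intro l hl
    induction hl using Submodule.span_induction with
    | zero => exact ⟨0, by simp⟩
    | add x y _ _ hx hy =>
      obtain ⟨c, hc⟩ := hx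
      obtain ⟨c', hc'⟩ := hy
      exact ⟨c + c', by rw [smul_add, hc, hc', add_smul]⟩
    | smul c x _ hx =>
      obtain ⟨c', hc'⟩ := hx
      exact ⟨c * c', by rw [smul_smul_comm', hc', smul_smul]⟩
    | mem x hx =>
      rcases hx with rfl | ⟨a, rfl⟩
      · refine ⟨0, ?_⟩
        rw [zero_smul]
        refine weight_projection_smul_eq_zero hπK (h.K_smul_F_pow (p - 1)) (hne _ ?_)
        rintro ⟨k, hk⟩
        have : (2 : ℤ) * (p * k + (p - 1)) = 0 := by
          have : ((p - 1 : ℕ) : ℤ) = p - 1 := by omega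
          rw [this] at hk; linarith
        have h5 : (p : ℤ) ∣ 1 := ⟨k + 1, by linarith⟩
        have := Int.le_of_dvd one_pos h5
        omega
      · by_cases ha : a < p
        · by_cases ha' : a = 1
          · subst ha'
            refine ⟨1, ?_⟩
            rw [one_smul]
            simp only [pow_one]
            refine hπ _ ?_
            simpa using h.K_smul_F_pow_E 1
          · refine ⟨0, ?_⟩
            rw [zero_smul]
            refine weight_projection_smul_eq_zero hπK (h.K_smul_F_pow_E a) (hne _ ?_)
            rintro ⟨k, hk⟩
            have h5 : (p : ℤ) ∣ a - 1 := ⟨-k, by linarith⟩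
            rcases Nat.eq_zero_or_pos a with rfl | hpos
            · rw [Nat.cast_zero, zero_sub, dvd_neg] at h5
              have := Int.le_of_dvd one_pos h5
              omega
            · have := Int.le_of_dvd (by omega) h5
              omega
        · exact ⟨0, by simp [F_pow_smul_of_le (not_lt.1 ha)]⟩
  have he : e ∈ h.radical ⊔ N := by rw [hN]; trivial
  obtain ⟨l, hl, x, hx, hlx⟩ := Submodule.mem_sup.1 he
  obtain ⟨c, hc⟩ := hrad l hl
  have h1 : e - c • F p • E p • e ∈ N := by
    have : e - c • F p • E p • e = π • x := by
      rw [← hc]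
      nth_rw 1 [← hπ e h.K_smul, ← hlx]
      rw [smul_add, add_sub_cancel_left]
    rw [this]; exact N.smul_mem _ hx
  have h2 : E p • e ∈ N := by
    have := N.smul_mem (E p) h1
    rwa [smul_sub, smul_smul_comm', h.E_smul_F_E, smul_zero, sub_zero] at this
  refine hgen N ?_
  have h3 : c • F p • E p • e ∈ N := by
    rw [← algebraMap_smul (Uq p) c]
    exact N.smul_mem _ (N.smul_mem _ h2)
  simpa using N.add_mem h1 h3

/-- In the quotient $e$ becomes singular and $F^{p-1}e$ vanishes, so the images of $F^se$ with
$s<p-1$ form the standard basis. -/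
theorem isX_quotient_radical (h : IsDominant (p := p) ε e)
    (hgen : ∀ N : Submodule (Uq p) V, e ∈ N → N = ⊤) (hdim : Module.finrank ℂ V = 2 * p) :
    IsX p ε (p - 1) (V ⧸ h.radical) := by
  have hp := two_le p
  set b := h.basis hgen hdim with hb
  set mk := h.radical.mkQ with hmk
  have hmkc : ∀ (c : ℂ) v, mk (c • v) = c • mk v := fun c v => rfl
  -- The radical has zero coordinates along $F^se$ for $s<p-1$, which gives independence in the
  -- quotient.
  have hcoord : ∀ l ∈ Submodule.span ℂ (radicalSet p e), ∀ i : Fin p, (i : ℕ) < p - 1 →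
      b.repr l (Sum.inl i) = 0 := by
    intro l hl i hi
    induction hl using Submodule.span_induction with
    | zero => simp
    | add x y _ _ hx hy => simp [hx, hy]
    | smul c x _ hx => simp [hx]
    | mem x hx =>
      rcases hx with rfl | ⟨a, rfl⟩
      · have : F p ^ (p - 1) • e = b (Sum.inl ⟨p - 1, by omega⟩) := by rw [hb, basis_apply]; rfl
        rw [this, Module.Basis.repr_self, Finsupp.single_apply, if_neg]
        rw [Sum.inl.injEq, Fin.ext_iff]
        exact hi.ne'
      · by_cases ha : a < p
        · have : F p ^ a • E p • e = b (Sum.inr ⟨a, ha⟩) := by rw [hb, basis_apply]; rfl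
          simp only
          rw [this, Module.Basis.repr_self, Finsupp.single_apply, if_neg (by simp)]
        · simp [F_pow_smul_of_le (not_lt.1 ha)]
  have hli : LinearIndependent ℂ fun s : Fin (p - 1) => F p ^ (s : ℕ) • mk e := by
    rw [Fintype.linearIndependent_iff]
    intro c hc i
    have h1 : mk (∑ s, c s • F p ^ (s : ℕ) • e) = 0 := by
      rw [map_sum, ← hc]
      exact Finset.sum_congr rfl fun s _ => by rw [hmkc, map_smul]
    rw [hmk, Submodule.mkQ_apply, Submodule.Quotient.mk_eq_zero] at h1
    have h2 := hcoord _ h1 ⟨i, by omega⟩ i.2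
    have h3 : ∀ s : Fin (p - 1), F p ^ (s : ℕ) • e = b (Sum.inl ⟨s, by omega⟩) := by
      intro s; rw [hb, basis_apply]; rfl
    simp only [h3, map_sum, map_smul, Module.Basis.repr_self, Finsupp.coe_finsetSum,
      Finset.sum_apply, Finsupp.smul_apply, smul_eq_mul] at h2
    rw [Finset.sum_eq_single i] at h2
    · simpa using h2
    · intro s _ hs
      rw [Finsupp.single_apply, if_neg, mul_zero]
      rw [Sum.inl.injEq, Fin.mk.injEq]
      exact fun h => hs (Fin.ext h)
    · simp
  have hspan : ⊤ ≤ Submodule.span ℂ (Set.range fun s : Fin (p - 1) => F p ^ (s : ℕ) • mk e) := by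
    intro x _
    obtain ⟨v, rfl⟩ := h.radical.mkQ_surjective x
    have hv : v ∈ Submodule.span ℂ (Set.range b) := by rw [b.span_eq]; trivial
    change mk v ∈ _
    induction hv using Submodule.span_induction with
    | zero => rw [map_zero]; exact Submodule.zero_mem _
    | add x y _ _ hx hy => rw [map_add]; exact Submodule.add_mem _ (hx trivial) (hy trivial)
    | smul c x _ hx => rw [hmkc]; exact Submodule.smul_mem _ _ (hx trivial)
    | mem x hx =>
      obtain ⟨a | a, rfl⟩ := hx <;> rw [hb, basis_apply]
      · by_cases ha : (a : ℕ) < p - 1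
        · refine Submodule.subset_span ⟨⟨a, ha⟩, ?_⟩
          simp [family]
        · have : mk (family p e (Sum.inl a)) = 0 :=
            (Submodule.Quotient.mk_eq_zero _).2 (h.F_pow_mem_radical (by omega))
          rw [this]; exact Submodule.zero_mem _
      · have : mk (family p e (Sum.inr a)) = 0 :=
          (Submodule.Quotient.mk_eq_zero _).2 (h.F_pow_E_mem_radical a)
        rw [this]; exact Submodule.zero_mem _
  refine isX_of_primitive (v := mk e) ?_ ?_ ?_ (Module.Basis.mk hli hspan) fun s => by simp
  · rw [← map_smul, h.K_smul, hmkc]; congr 3; omega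
  · rw [← map_smul]
    exact (Submodule.Quotient.mk_eq_zero _).2 (by simpa using h.F_pow_E_mem_radical 0)
  · rw [← map_smul]
    exact (Submodule.Quotient.mk_eq_zero _).2 (h.F_pow_mem_radical le_rfl)

theorem isP (h : IsDominant (p := p) ε e) (hgen : ∀ N : Submodule (Uq p) V, e ∈ N → N = ⊤)
    (hdim : Module.finrank ℂ V = 2 * p) : IsP p ε (p - 1) V :=
  ⟨h.projective hgen hdim, h.radical, h.radical_superfluous hgen,
    h.isX_quotient_radical hgen hdim⟩

end IsDominant

end Cover

/-! ### Submodules spanned by monomials -/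

/-- A set of exponents is stable if the span of the corresponding monomials is stable under the
action of `Ū_𝔮 sl(2)`. -/
def IsStable (p : ℕ) (S : Set (ℕ × ℕ)) : Prop :=
  (∀ a b, (a, b + 1) ∈ S → ¬ p ∣ a + 1 → (a + 1, b) ∈ S) ∧
    ∀ a b, (a + 1, b) ∈ S → ¬ p ∣ b + 1 → (a, b + 1) ∈ S

section Monomials

variable (p : ℕ)

theorem Plane.mon_natCast (a b : ℕ) : Plane.mon p a b = Plane.basis p (a, b) := by
  simp [Plane.mon]

theorem OneForm.xi_natCast (a b : ℕ) : OneForm.xi p a b = OneForm.basis p (Sum.inl (a, b)) := by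
  simp [OneForm.xi]

theorem OneForm.eta_natCast (a b : ℕ) :
    OneForm.eta p a b = OneForm.basis p (Sum.inr (a, b)) := by
  simp [OneForm.eta]

theorem qInt_natCast_eq_zero_iff [p.AtLeastTwo] (a : ℕ) : qInt p ((a : ℤ) + 1) = 0 ↔ p ∣ a + 1 := by
  rw [qInt_eq_zero_iff]; exact_mod_cast Iff.rfl

variable {p} [p.AtLeastTwo]

/-- Stability is needed only where the coefficient $[a+1]$ is nonzero. The family `f` is arbitrary
because the same argument serves monomials of the plane and the forms in $\xi$ and in $\eta$. -/
theorem IsStable.raise_mem {S : Set (ℕ × ℕ)} (hS : IsStable p S) {V : Type*} [AddCommGroup V]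
    [Module ℂ V] (U : Submodule ℂ V) (f : ℤ → ℤ → V) (hf : ∀ a b : ℤ, ¬ (0 ≤ a ∧ 0 ≤ b) → f a b = 0)
    (hU : ∀ a b : ℕ, (a, b) ∈ S → f a b ∈ U) {a b : ℕ} (h : (a, b) ∈ S) :
    qInt p (a + 1) • f (a + 1) (b - 1) ∈ U := by
  by_cases ha : p ∣ a + 1
  · rw [(qInt_natCast_eq_zero_iff p a).2 ha, zero_smul]; exact U.zero_mem
  · rcases b with _ | b
    · rw [hf _ _ (by simp), smul_zero]; exact U.zero_mem
    · have := hU _ _ (hS.1 a b h ha)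
      push_cast at this ⊢
      rw [add_sub_cancel_right]
      exact U.smul_mem _ this

theorem IsStable.lower_mem {S : Set (ℕ × ℕ)} (hS : IsStable p S) {V : Type*} [AddCommGroup V]
    [Module ℂ V] (U : Submodule ℂ V) (f : ℤ → ℤ → V) (hf : ∀ a b : ℤ, ¬ (0 ≤ a ∧ 0 ≤ b) → f a b = 0)
    (hU : ∀ a b : ℕ, (a, b) ∈ S → f a b ∈ U) {a b : ℕ} (h : (a, b) ∈ S) :
    qInt p (b + 1) • f (a - 1) (b + 1) ∈ U := by
  by_cases hb : p ∣ b + 1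
  · rw [(qInt_natCast_eq_zero_iff p b).2 hb, zero_smul]; exact U.zero_mem
  · rcases a with _ | a
    · rw [hf _ _ (by simp), smul_zero]; exact U.zero_mem
    · have := hU _ _ (hS.2 a b h hb)
      push_cast at this ⊢
      rw [add_sub_cancel_right]
      exact U.smul_mem _ this

/-- The submodule of the quantum plane spanned by the monomials with exponents in `S`. -/
def Plane.sub (S : Set (ℕ × ℕ)) (hS : IsStable p S) : Submodule (Uq p) (Plane p) :=
  subOfGen (Submodule.span ℂ (Plane.basis p '' S)) (by
    intro g f hf
    have hU : ∀ a b : ℕ, (a, b) ∈ S →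
        Plane.mon p a b ∈ Submodule.span ℂ (Plane.basis p '' S) :=
      fun a b h => Submodule.subset_span ⟨_, h, (Plane.mon_natCast p a b).symm⟩
    rw [Plane.gen_smul]
    refine (Submodule.span_le (p := (Submodule.span ℂ (Plane.basis p '' S)).comap
      (Plane.op p g))).2 ?_ hf
    rintro _ ⟨⟨a, b⟩, h, rfl⟩
    rw [← Plane.mon_natCast, SetLike.mem_coe, Submodule.mem_comap]
    cases g
    · rw [Plane.op, Plane.opE_mon]
      exact hS.raise_mem _ (Plane.mon p) (fun _ _ => Plane.mon_neg p) hU h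
    · rw [Plane.op, Plane.opF_mon]
      exact hS.lower_mem _ (Plane.mon p) (fun _ _ => Plane.mon_neg p) hU h
    · rw [Plane.op, Plane.opK_mon]; exact Submodule.smul_mem _ _ (hU _ _ h)
    · rw [Plane.op, Plane.opKinv_mon]; exact Submodule.smul_mem _ _ (hU _ _ h))

/-- The submodule of the one-forms spanned by `x⁽ᵃ⁾y⁽ᵇ⁾ξ`, `x⁽ᵃ⁾y⁽ᵇ⁾η` with `(a, b)` in `S`. -/
def OneForm.sub (S : Set (ℕ × ℕ)) (hS : IsStable p S) : Submodule (Uq p) (OneForm p) :=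
  subOfGen (Submodule.span ℂ (OneForm.basis p '' {i | Sum.elim id id i ∈ S})) (by
    intro g f hf
    set U := Submodule.span ℂ (OneForm.basis p '' {i | Sum.elim id id i ∈ S}) with hUdef
    have hU : ∀ a b : ℕ, (a, b) ∈ S → OneForm.xi p a b ∈ U :=
      fun a b h => Submodule.subset_span ⟨Sum.inl (a, b), h, (OneForm.xi_natCast p a b).symm⟩
    have hU' : ∀ a b : ℕ, (a, b) ∈ S → OneForm.eta p a b ∈ U :=
      fun a b h => Submodule.subset_span ⟨Sum.inr (a, b), h, (OneForm.eta_natCast p a b).symm⟩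
    rw [OneForm.gen_smul]
    refine (Submodule.span_le (p := U.comap (OneForm.op p g))).2 ?_ hf
    rintro _ ⟨⟨a, b⟩ | ⟨a, b⟩, h, rfl⟩
    · replace h : (a, b) ∈ S := h
      rw [← OneForm.xi_natCast, SetLike.mem_coe, Submodule.mem_comap]
      cases g
      · rw [OneForm.op, OneForm.opE_xi, mul_smul]
        exact U.smul_mem _
          (hS.raise_mem _ (OneForm.xi p) (fun _ _ => OneForm.xi_neg p) hU h)
      · rw [OneForm.op, OneForm.opF_xi]
        exact U.add_mem (hS.lower_mem _ (OneForm.xi p) (fun _ _ => OneForm.xi_neg p) hU h)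
          (U.smul_mem _ (hU' _ _ h))
      · rw [OneForm.op, OneForm.opK_xi]; exact U.smul_mem _ (hU _ _ h)
      · rw [OneForm.op, OneForm.opKinv_xi]; exact U.smul_mem _ (hU _ _ h)
    · replace h : (a, b) ∈ S := h
      rw [← OneForm.eta_natCast, SetLike.mem_coe, Submodule.mem_comap]
      cases g
      · rw [OneForm.op, OneForm.opE_eta, mul_smul]
        exact U.add_mem (U.smul_mem _
          (hS.raise_mem _ (OneForm.eta p) (fun _ _ => OneForm.eta_neg p) hU' h)) (hU _ _ h)
      · rw [OneForm.op, OneForm.opF_eta]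
        exact hS.lower_mem _ (OneForm.eta p) (fun _ _ => OneForm.eta_neg p) hU' h
      · rw [OneForm.op, OneForm.opK_eta]; exact U.smul_mem _ (hU' _ _ h)
      · rw [OneForm.op, OneForm.opKinv_eta]; exact U.smul_mem _ (hU' _ _ h))

theorem Plane.mem_sub {S : Set (ℕ × ℕ)} {hS : IsStable p S} {f : Plane p} :
    f ∈ Plane.sub S hS ↔ f ∈ Submodule.span ℂ (Plane.basis p '' S) := Iff.rfl

theorem OneForm.mem_sub {S : Set (ℕ × ℕ)} {hS : IsStable p S} {f : OneForm p} :
    f ∈ OneForm.sub S hS ↔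
      f ∈ Submodule.span ℂ (OneForm.basis p '' {i | Sum.elim id id i ∈ S}) := Iff.rfl

theorem Plane.sub_le_grade {S : Set (ℕ × ℕ)} {hS : IsStable p S} {i : ℕ}
    (h : ∀ a b, (a, b) ∈ S → a + b = i) : Plane.sub S hS ≤ Plane.grade p i := by
  intro f hf
  refine (Submodule.span_le (p := Plane.gradeSpan p i)).2 ?_ hf
  rintro _ ⟨⟨a, b⟩, hab, rfl⟩
  exact Submodule.subset_span ⟨a, b, h a b hab, (Plane.mon_natCast p a b).symm⟩

theorem OneForm.sub_le_grade {S : Set (ℕ × ℕ)} {hS : IsStable p S} {i : ℕ}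
    (h : ∀ a b, (a, b) ∈ S → a + b = i) : OneForm.sub S hS ≤ OneForm.grade p i := by
  intro f hf
  refine (Submodule.span_le (p := OneForm.gradeSpan p i)).2 ?_ hf
  rintro _ ⟨⟨a, b⟩ | ⟨a, b⟩, hab, rfl⟩
  · exact Submodule.subset_span ⟨a, b, h a b hab, Or.inl (OneForm.xi_natCast p a b).symm⟩
  · exact Submodule.subset_span ⟨a, b, h a b hab, Or.inr (OneForm.eta_natCast p a b).symm⟩

end Monomials

/-! ### The complement of the exact forms -/

section Theta
open Plane OneForm

variable (p : ℕ)

/-- Multiplication by the invariant one-form `xη - 𝔮⁻¹yξ`, as a `ℂ`-linear map. -/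
def thetaLin : Plane p →ₗ[ℂ] OneForm p :=
  Plane.lin fun m n => (q p ^ n * qInt p (m + 1)) • eta p (m + 1) n
    - ((q p)⁻¹ * qInt p (n + 1)) • xi p m (n + 1)

/-- For boundary exponents: an index $-1$ is raised to $0$, where the monomial need not vanish, but
the coefficient is then $[0]$. -/
theorem qInt_smul_eq_zero {V : Type*} [AddCommGroup V] [Module ℂ V] {n : ℤ} {v : V}
    (h : n ≠ 0 → v = 0) (c : ℂ) : (c * qInt p n) • v = 0 := by
  by_cases hn : n = 0
  · rw [hn, qInt_zero, mul_zero, zero_smul]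
  · rw [h hn, smul_zero]

theorem thetaLin_mon (m n : ℤ) : thetaLin p (mon p m n)
    = (q p ^ n * qInt p (m + 1)) • eta p (m + 1) n
      - ((q p)⁻¹ * qInt p (n + 1)) • xi p m (n + 1) := by
  refine Plane.lin_mon _ (fun m n h => ?_) m n
  rw [qInt_smul_eq_zero p (fun _ => eta_neg p (by omega)),
    qInt_smul_eq_zero p (fun _ => xi_neg p (by omega)), sub_zero]

theorem thetaLin_comm [p.AtLeastTwo] (g : Gen) (f : Plane p) :
    thetaLin p (Uq.gen p g • f) = Uq.gen p g • thetaLin p f := by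
  rw [Plane.gen_smul, OneForm.gen_smul]
  suffices h : thetaLin p ∘ₗ Plane.op p g = OneForm.op p g ∘ₗ thetaLin p from
    LinearMap.congr_fun h f
  refine Plane.hom_ext fun m n => ?_
  have h0 := q_ne_zero p
  cases g <;> simp only [LinearMap.comp_apply, Plane.op, OneForm.op, Plane.opE_mon, Plane.opF_mon,
    Plane.opK_mon, Plane.opKinv_mon, map_smul, thetaLin_mon, map_sub, OneForm.opE_xi,
    OneForm.opE_eta, OneForm.opF_xi, OneForm.opF_eta, OneForm.opK_xi, OneForm.opK_eta,
    OneForm.opKinv_xi, OneForm.opKinv_eta, sub_add_cancel, add_sub_cancel_right]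
  · have e := qInt_succ_inv p n
    have e1 : q p ^ (n - 1) = q p ^ n * (q p)⁻¹ := by rw [zpow_sub_one₀ h0]
    rw [e1, e]
    match_scalars
    · ring
    · field_simp; ring
  · have e := qInt_succ p m
    have e1 : q p ^ (n + 1) = q p ^ n * q p := by rw [zpow_add_one₀ h0]
    have e2 : q p ^ (n + 1 - m) = q p ^ n * q p * q p ^ (-m) := by
      rw [sub_eq_add_neg, zpow_add₀ h0, e1]
    rw [e1, e2, e]
    match_scalars
    · field_simp; ring
    · ring
  · rw [show m + 1 - n - 1 = m - n by ring, show m - (n + 1) + 1 = m - n by ring]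
    module
  · rw [show n - (m + 1) + 1 = n - m by ring, show n + 1 - m - 1 = n - m by ring]
    module

/-- Multiplication by the invariant one-form `xη - 𝔮⁻¹yξ`. -/
def theta [p.AtLeastTwo] : Plane p →ₗ[Uq p] OneForm p := linOfGen (thetaLin p) (thetaLin_comm p)

/-- A left inverse of the differential outside the grades divisible by `p`. -/
def primitive : OneForm p →ₗ[ℂ] Plane p :=
  OneForm.lin (fun a b => ((qInt p (a + b + 1))⁻¹ * q p ^ (-a) * qInt p (a + 1)) • mon p (a + 1) b)
    fun a b => ((qInt p (a + b + 1))⁻¹ * q p ^ (-(a + b)) * qInt p (b + 1)) • mon p a (b + 1)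

/-- A left inverse of the map `theta` outside the grades congruent to `-2` modulo `p`. -/
def coprimitive : OneForm p →ₗ[ℂ] Plane p :=
  OneForm.lin (fun a b => (-((qInt p (a + b + 1))⁻¹ * q p ^ (-a))) • mon p a (b - 1))
    fun a b => ((qInt p (a + b + 1))⁻¹ * q p) • mon p (a - 1) b

/-- The projection to the grades congruent to `-1` modulo `p`. -/
def resonant : OneForm p →ₗ[ℂ] OneForm p :=
  OneForm.lin (fun a b => if (p : ℤ) ∣ a + b + 1 then xi p a b else 0)
    fun a b => if (p : ℤ) ∣ a + b + 1 then eta p a b else 0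

theorem primitive_xi (a b : ℤ) : primitive p (xi p a b)
    = ((qInt p (a + b + 1))⁻¹ * q p ^ (-a) * qInt p (a + 1)) • mon p (a + 1) b :=
  OneForm.lin_xi _ _
    (fun _ _ _ => qInt_smul_eq_zero p (fun _ => mon_neg p (by omega)) _) a b

theorem primitive_eta (a b : ℤ) : primitive p (eta p a b)
    = ((qInt p (a + b + 1))⁻¹ * q p ^ (-(a + b)) * qInt p (b + 1)) • mon p a (b + 1) :=
  OneForm.lin_eta _ _
    (fun _ _ _ => qInt_smul_eq_zero p (fun _ => mon_neg p (by omega)) _) a b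

theorem coprimitive_xi (a b : ℤ) : coprimitive p (xi p a b)
    = (-((qInt p (a + b + 1))⁻¹ * q p ^ (-a))) • mon p a (b - 1) :=
  OneForm.lin_xi _ _ (fun _ _ _ => by rw [mon_neg p (by omega), smul_zero]) a b

theorem coprimitive_eta (a b : ℤ) : coprimitive p (eta p a b)
    = ((qInt p (a + b + 1))⁻¹ * q p) • mon p (a - 1) b :=
  OneForm.lin_eta _ _ (fun _ _ _ => by rw [mon_neg p (by omega), smul_zero]) a b

theorem resonant_xi (a b : ℤ) :
    resonant p (xi p a b) = if (p : ℤ) ∣ a + b + 1 then xi p a b else 0 :=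
  OneForm.lin_xi _ _ (fun _ _ h => by rw [xi_neg p h, ite_self]) a b

theorem resonant_eta (a b : ℤ) :
    resonant p (eta p a b) = if (p : ℤ) ∣ a + b + 1 then eta p a b else 0 :=
  OneForm.lin_eta _ _ (fun _ _ h => by rw [eta_neg p h, ite_self]) a b

/-- The two contributions are $\mathfrak q^n[m]$ and $\mathfrak q^{-m}[n]$, which add up to $[m+n]$.
-/
theorem primitive_dLin_mon {m n : ℤ} (h : qInt p (m + n) ≠ 0) :
    primitive p (dLin p (mon p m n)) = mon p m n := by
  have h0 := q_ne_zero p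
  rw [dLin_mon, map_add, map_smul, map_smul, primitive_xi, primitive_eta, sub_add_cancel,
    sub_add_cancel, smul_smul, smul_smul, ← add_smul, show m - 1 + n + 1 = m + n by ring,
    show m + (n - 1) + 1 = m + n by ring]
  have e : q p ^ (m + n - 1) * ((qInt p (m + n))⁻¹ * q p ^ (-(m - 1)) * qInt p m)
      + q p ^ (n - 1) * ((qInt p (m + n))⁻¹ * q p ^ (-(m + (n - 1))) * qInt p n) = 1 := by
    have e1 : q p ^ (m + n - 1) * q p ^ (-(m - 1)) = q p ^ n := by
      rw [← zpow_add₀ h0]; congr 1; ring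
    have e2 : q p ^ (n - 1) * q p ^ (-(m + (n - 1))) = q p ^ (-m) := by
      rw [← zpow_add₀ h0]; congr 1; ring
    rw [← inv_mul_cancel₀ h]
    linear_combination (qInt p (m + n))⁻¹ * qInt p m * e1 + (qInt p (m + n))⁻¹ * qInt p n * e2
      - (qInt p (m + n))⁻¹ * qInt_add p m n
  rw [e, one_smul]

/-- The contributions of $\xi$ and $\eta$ are opposite multiples of the same inverse, so the
identity holds even when that inverse is the default value $0^{-1}=0$. -/
theorem coprimitive_dLin_mon (m n : ℤ) : coprimitive p (dLin p (mon p m n)) = 0 := by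
  have h0 := q_ne_zero p
  rw [dLin_mon, map_add, map_smul, map_smul, coprimitive_xi, coprimitive_eta, smul_smul,
    smul_smul, ← add_smul, show m - 1 + n + 1 = m + n by ring,
    show m + (n - 1) + 1 = m + n by ring]
  have e1 : q p ^ (m + n - 1) * q p ^ (-(m - 1)) = q p ^ n := by
    rw [← zpow_add₀ h0]; congr 1; ring
  have e2 : q p ^ (n - 1) * q p = q p ^ n := by rw [← zpow_add_one₀ h0, sub_add_cancel]
  convert zero_smul ℂ _ using 2
  linear_combination (-(qInt p (m + n))⁻¹) * e1 + (qInt p (m + n))⁻¹ * e2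

theorem primitive_thetaLin_mon (m n : ℤ) : primitive p (thetaLin p (mon p m n)) = 0 := by
  have h0 := q_ne_zero p
  rw [thetaLin_mon, map_sub, map_smul, map_smul, primitive_xi, primitive_eta, smul_smul,
    smul_smul, ← sub_smul, show m + (n + 1) + 1 = m + n + 2 by ring,
    show m + 1 + n + 1 = m + n + 2 by ring]
  have e1 : q p ^ n * q p ^ (-(m + 1 + n)) = q p ^ (-m) * (q p)⁻¹ := by
    rw [← zpow_add₀ h0, ← zpow_sub_one₀ h0]; congr 1; ring
  convert zero_smul ℂ _ using 2
  linear_combination ((qInt p (m + n + 2))⁻¹ * qInt p (m + 1) * qInt p (n + 1)) * e1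

theorem coprimitive_thetaLin_mon {m n : ℤ} (h : qInt p (m + n + 2) ≠ 0) :
    coprimitive p (thetaLin p (mon p m n)) = mon p m n := by
  have h0 := q_ne_zero p
  rw [thetaLin_mon, map_sub, map_smul, map_smul, coprimitive_xi, coprimitive_eta, smul_smul,
    smul_smul, add_sub_cancel_right, add_sub_cancel_right, ← sub_smul,
    show m + (n + 1) + 1 = m + n + 2 by ring, show m + 1 + n + 1 = m + n + 2 by ring]
  have e : q p ^ n * qInt p (m + 1) * ((qInt p (m + n + 2))⁻¹ * q p)
      - (q p)⁻¹ * qInt p (n + 1) * -((qInt p (m + n + 2))⁻¹ * q p ^ (-m)) = 1 := by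
    have e3 := qInt_add p (m + 1) (n + 1)
    have e1 : q p ^ (n + 1) = q p ^ n * q p := zpow_add_one₀ h0 n
    have e2 : q p ^ (-(m + 1)) = q p ^ (-m) * (q p)⁻¹ := by
      rw [← zpow_sub_one₀ h0]; congr 1; ring
    rw [e1, e2, show m + 1 + (n + 1) = m + n + 2 by ring] at e3
    rw [← inv_mul_cancel₀ h]
    linear_combination (-(qInt p (m + n + 2))⁻¹) * e3
  rw [e, one_smul]

/-- With `smul_eta_eq`, this inverts the passage from monomial forms to exact and coexact ones. The
determinant-like factor $[a+b+1]$ vanishes exactly in the resonant grades. -/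
theorem smul_xi_eq (a b : ℤ) : (q p ^ a * qInt p (a + b + 1)) • xi p a b
    = qInt p (a + 1) • dLin p (mon p (a + 1) b) - thetaLin p (mon p a (b - 1)) := by
  have h0 := q_ne_zero p
  rw [dLin_mon, thetaLin_mon, sub_add_cancel, add_sub_cancel_right,
    show a + 1 + b - 1 = a + b by ring, zpow_add₀ h0, show a + b + 1 = a + 1 + b by ring,
    qInt_add p (a + 1) b, neg_add, zpow_add₀ h0 (-a), zpow_neg, zpow_neg, zpow_one]
  have := zpow_ne_zero a h0
  match_scalars
  · field_simp; ring
  · ring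

theorem smul_eta_eq (a b : ℤ) : (q p ^ (a + b) * qInt p (a + b + 1)) • eta p a b
    = qInt p (b + 1) • dLin p (mon p a (b + 1))
      + q p ^ (a + b + 1) • thetaLin p (mon p (a - 1) b) := by
  have h0 := q_ne_zero p
  rw [dLin_mon, thetaLin_mon, sub_add_cancel, add_sub_cancel_right,
    show a + (b + 1) - 1 = a + b by ring, show a + b + 1 = a + (b + 1) by ring,
    qInt_add p a (b + 1), zpow_add₀ h0 a b, zpow_add₀ h0 a (b + 1), zpow_add₀ h0 b 1, zpow_neg,
    zpow_one]
  have := zpow_ne_zero a h0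
  match_scalars
  · field_simp; ring
  · field_simp; ring

end Theta

/-! ### A basis of the one-forms adapted to the decomposition -/

/-- Labels of exact forms `d(x⁽ᵃ⁾y⁽ᵇ⁾)`, of forms `θ(x⁽ᵃ⁾y⁽ᵇ⁾)` and of monomial forms. -/
abbrev Cell : Type := (ℕ × ℕ) ⊕ (ℕ × ℕ) ⊕ ((ℕ × ℕ) ⊕ (ℕ × ℕ))

namespace Cell

/-- One plus the grade of the one-form with a given label. -/
def grade : Cell → ℕ :=
  Sum.elim (fun i => i.1 + i.2) (Sum.elim (fun i => i.1 + i.2 + 2)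
    (Sum.elim (fun i => i.1 + i.2 + 1) fun i => i.1 + i.2 + 1))

/-- The labels of the basis: monomial forms in the grades congruent to `-1` modulo `p`, and exact
and coexact forms in the other ones. -/
def regular (p : ℕ) : Set Cell :=
  {c | match c with
    | Sum.inl _ => ¬ p ∣ c.grade
    | Sum.inr (Sum.inl _) => ¬ p ∣ c.grade
    | Sum.inr (Sum.inr _) => p ∣ c.grade}

variable (p : ℕ) [p.AtLeastTwo]

/-- The one-form with a given label. -/
def form : Cell → OneForm p :=
  Sum.elim (fun i => d p (Plane.basis p i)) (Sum.elim (fun i => theta p (Plane.basis p i))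
    (OneForm.basis p))

theorem form_exact (a b : ℕ) : form p (Sum.inl (a, b)) = dLin p (Plane.mon p a b) := by
  rw [Plane.mon_natCast]; rfl

theorem form_coexact (a b : ℕ) :
    form p (Sum.inr (Sum.inl (a, b))) = thetaLin p (Plane.mon p a b) := by
  rw [Plane.mon_natCast]; rfl

/-- The triple of `primitive`, `coprimitive` and `resonant` sends each regular form to its own basis
vector of a direct sum: exact forms to the first component, coexact ones to the second, resonant
monomials to the third. -/
theorem linearIndependent_form : LinearIndependent ℂ fun c : regular p => form p c := by
  let Φ := (primitive p).prod ((coprimitive p).prod (resonant p))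
  let B := (Plane.basis p).prod ((Plane.basis p).prod (OneForm.basis p))
  refine LinearIndependent.of_comp Φ ?_
  have h : (Φ ∘ fun c : regular p => form p c) = B ∘ Subtype.val := by
    have hdvd : ∀ n : ℕ, (p : ℤ) ∣ n ↔ p ∣ n := fun n => by exact_mod_cast Iff.rfl
    funext ⟨c, hc⟩
    rcases c with ⟨a, b⟩ | ⟨a, b⟩ | ⟨a, b⟩ | ⟨a, b⟩ <;>
      simp only [regular, grade, Set.mem_ofPred_eq, Sum.elim_inl, Sum.elim_inr] at hc <;>
      rw [← hdvd] at hc <;> push_cast at hc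
    · have h1 : qInt p ((a : ℤ) + b) ≠ 0 := fun h => hc ((qInt_eq_zero_iff p _).1 h)
      have e1 := primitive_dLin_mon p h1
      have e2 := coprimitive_dLin_mon p a b
      have e3 : resonant p (dLin p (Plane.mon p a b)) = 0 := by
        rw [dLin_mon, map_add, map_smul, map_smul, resonant_xi, resonant_eta,
          show (a : ℤ) - 1 + b + 1 = a + b by ring, show (a : ℤ) + (b - 1) + 1 = a + b by ring,
          if_neg hc, if_neg hc, smul_zero, smul_zero, add_zero]
      rw [Function.comp_apply, form_exact]
      rw [Plane.mon_natCast] at e1 e2 e3 ⊢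
      simp [Φ, B, e1, e2, e3]
    · have h1 : qInt p ((a : ℤ) + b + 2) ≠ 0 := fun h => hc ((qInt_eq_zero_iff p _).1 h)
      have e1 := primitive_thetaLin_mon p a b
      have e2 := coprimitive_thetaLin_mon p h1
      have e3 : resonant p (thetaLin p (Plane.mon p a b)) = 0 := by
        rw [thetaLin_mon, map_sub, map_smul, map_smul, resonant_xi, resonant_eta,
          show (a : ℤ) + 1 + b + 1 = a + b + 2 by ring,
          show (a : ℤ) + (b + 1) + 1 = a + b + 2 by ring,
          if_neg hc, if_neg hc, smul_zero, smul_zero, sub_zero]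
      rw [Function.comp_apply, form_coexact]
      rw [Plane.mon_natCast] at e1 e2 e3 ⊢
      simp [Φ, B, e1, e2, e3]
    · have h1 : qInt p ((a : ℤ) + b + 1) = 0 := (qInt_eq_zero_iff p _).2 hc
      have e1 := primitive_xi p a b
      have e2 := coprimitive_xi p a b
      have e3 := resonant_xi p a b
      -- On resonance $[a+b+1]^{-1}$ takes the default value $0$, so the two partial inverses kill
      -- the monomial forms.
      rw [h1, inv_zero, zero_mul, zero_mul, zero_smul] at e1
      rw [h1, inv_zero, zero_mul, neg_zero, zero_smul] at e2
      rw [if_pos hc] at e3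
      rw [OneForm.xi_natCast] at e1 e2 e3
      simp [Φ, B, form, e1, e2, e3]
    · have h1 : qInt p ((a : ℤ) + b + 1) = 0 := (qInt_eq_zero_iff p _).2 hc
      have e1 := primitive_eta p a b
      have e2 := coprimitive_eta p a b
      have e3 := resonant_eta p a b
      rw [h1, inv_zero, zero_mul, zero_mul, zero_smul] at e1
      rw [h1, inv_zero, zero_mul, zero_smul] at e2
      rw [if_pos hc] at e3
      rw [OneForm.eta_natCast] at e1 e2 e3
      simp [Φ, B, form, e1, e2, e3]
  rw [h]
  exact B.linearIndependent.comp _ Subtype.val_injective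

theorem disjoint_span_form {S T : Set Cell} (hS : S ⊆ regular p) (hT : T ⊆ regular p)
    (h : Disjoint S T) :
    Disjoint (Submodule.span ℂ (form p '' S)) (Submodule.span ℂ (form p '' T)) := by
  have h1 := (linearIndependent_form p).disjoint_span_image
    (h.preimage (Subtype.val : regular p → Cell))
  have h2 : ∀ U : Set Cell, U ⊆ regular p →
      (fun c : regular p => form p c) '' (Subtype.val ⁻¹' U) = form p '' U := by
    intro U hU
    ext x
    constructor
    · rintro ⟨c, hc, rfl⟩; exact ⟨c, hc, rfl⟩
    · rintro ⟨c, hc, rfl⟩; exact ⟨⟨c, hU hc⟩, hc, rfl⟩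
  rwa [h2 S hS, h2 T hT] at h1

theorem form_mem_gradeSpan (c : Cell) {i : ℕ} (hc : c.grade = i + 1) :
    form p c ∈ OneForm.gradeSpan p i := by
  rcases c with ⟨a, b⟩ | ⟨a, b⟩ | ⟨a, b⟩ | ⟨a, b⟩ <;>
    simp only [grade, Sum.elim_inl, Sum.elim_inr] at hc
  · rw [form_exact, dLin_mon]
    exact Submodule.add_mem _ (Submodule.smul_mem _ _ (OneForm.xi_mem p (by omega)))
      (Submodule.smul_mem _ _ (OneForm.eta_mem p (by omega)))
  · rw [form_coexact, thetaLin_mon]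
    exact Submodule.sub_mem _ (Submodule.smul_mem _ _ (OneForm.eta_mem p (by omega)))
      (Submodule.smul_mem _ _ (OneForm.xi_mem p (by omega)))
  · exact Submodule.subset_span ⟨a, b, by omega, Or.inl (OneForm.xi_natCast p a b).symm⟩
  · exact Submodule.subset_span ⟨a, b, by omega, Or.inr (OneForm.eta_natCast p a b).symm⟩

/-- On resonance the monomial forms are themselves labelled; elsewhere divide `smul_xi_eq` and
`smul_eta_eq` by the nonzero factor $[a+b+1]$. -/
theorem gradeSpan_le_span_form (i : ℕ) : OneForm.gradeSpan p i
    ≤ Submodule.span ℂ (form p '' {c ∈ regular p | c.grade = i + 1}) := by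
  have h0 := q_ne_zero p
  refine Submodule.span_le.2 ?_
  rintro _ ⟨a, b, hab, h⟩
  set U := Submodule.span ℂ (form p '' {c ∈ regular p | c.grade = i + 1})
  by_cases hp : p ∣ i + 1
  · rcases h with rfl | rfl
    · refine Submodule.subset_span ⟨Sum.inr (Sum.inr (Sum.inl (a, b))), ⟨?_, ?_⟩,
        (OneForm.xi_natCast p a b).symm⟩
      · change p ∣ a + b + 1; rwa [hab]
      · change a + b + 1 = i + 1; rw [hab]
    · refine Submodule.subset_span ⟨Sum.inr (Sum.inr (Sum.inr (a, b))), ⟨?_, ?_⟩,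
        (OneForm.eta_natCast p a b).symm⟩
      · change p ∣ a + b + 1; rwa [hab]
      · change a + b + 1 = i + 1; rw [hab]
  · have hq : qInt p ((a : ℤ) + b + 1) ≠ 0 := by
      rw [← hab, ← qInt_natCast_eq_zero_iff] at hp
      exact_mod_cast hp
    have hd : ∀ a' b' : ℕ, a' + b' = i + 1 → dLin p (Plane.mon p a' b') ∈ U := by
      intro a' b' h
      refine Submodule.subset_span ⟨Sum.inl (a', b'), ⟨?_, h⟩, form_exact p a' b'⟩
      change ¬ p ∣ a' + b'; rwa [h]
    have ht : ∀ a' b' : ℤ, a' + b' + 2 = i + 1 → thetaLin p (Plane.mon p a' b') ∈ U := by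
      intro a' b' h
      by_cases h' : 0 ≤ a' ∧ 0 ≤ b'
      · obtain ⟨ha', hb'⟩ := h'
        lift a' to ℕ using ha'
        lift b' to ℕ using hb'
        have h2 : a' + b' + 2 = i + 1 := by omega
        refine Submodule.subset_span ⟨Sum.inr (Sum.inl (a', b')), ⟨?_, h2⟩, form_coexact p a' b'⟩
        change ¬ p ∣ a' + b' + 2; rwa [h2]
      · rw [Plane.mon_neg p h', map_zero]; exact U.zero_mem
    rcases h with rfl | rfl
    · refine (Submodule.smul_mem_iff _ (mul_ne_zero (zpow_ne_zero a h0) hq)).1 ?_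
      rw [smul_xi_eq]
      refine U.sub_mem (U.smul_mem _ ?_) (ht _ _ (by omega))
      exact_mod_cast hd (a + 1) b (by omega)
    · refine (Submodule.smul_mem_iff _ (mul_ne_zero (zpow_ne_zero (a + b) h0) hq)).1 ?_
      rw [smul_eta_eq]
      refine U.add_mem (U.smul_mem _ ?_) (U.smul_mem _ (ht _ _ (by omega)))
      exact_mod_cast hd a (b + 1) (by omega)

theorem restrictScalars_upTo (i : ℕ) : (OneForm.upTo p i).restrictScalars ℂ
    = Submodule.span ℂ (form p '' {c ∈ regular p | c.grade ≤ i + 1}) := by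
  have h : (OneForm.upTo p i).restrictScalars ℂ
      = ⨆ (j : ℕ) (_ : j ≤ i), OneForm.gradeSpan p j := by
    rw [OneForm.upTo, Submodule.restrictScalars_iSup]
    refine iSup_congr fun j => ?_
    rw [Submodule.restrictScalars_iSup]
    rfl
  rw [h]
  refine le_antisymm (iSup₂_le fun j hj => (gradeSpan_le_span_form p j).trans ?_) ?_
  · refine Submodule.span_mono (Set.image_mono ?_)
    rintro c ⟨hc, hg⟩
    exact ⟨hc, by omega⟩
  · refine Submodule.span_le.2 ?_
    rintro _ ⟨c, ⟨hc, hg⟩, rfl⟩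
    obtain ⟨j, hj⟩ : ∃ j, c.grade = j + 1 := by
      refine Nat.exists_eq_succ_of_ne_zero fun h0 => ?_
      rcases c with ⟨a, b⟩ | ⟨a, b⟩ | ⟨a, b⟩ | ⟨a, b⟩
      -- The only label with value $0$ is that of $d(1)=0$, and it is not regular since $p\mid0$.
      · exact hc (h0 ▸ dvd_zero p)
      all_goals simp [grade] at h0
    exact Submodule.mem_iSup_of_mem j (Submodule.mem_iSup_of_mem (by omega)
      (form_mem_gradeSpan p c hj))

/-- A partition of the basis labels gives a decomposition into a direct sum. -/
theorem isDirectSum {ι : Type} (N : ι → Submodule (Uq p) (OneForm p)) (C : ι → Set Cell)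
    (hN : ∀ i, (N i).restrictScalars ℂ = Submodule.span ℂ (form p '' C i))
    (hdisj : Pairwise fun i j => Disjoint (C i) (C j)) {g : ℕ}
    (hC : ⋃ i, C i = {c ∈ regular p | c.grade ≤ g + 1}) : IsDirectSum N (OneForm.upTo p g) := by
  have hreg : ∀ i, C i ⊆ regular p := fun i c hc =>
    (hC ▸ Set.mem_iUnion_of_mem i hc : c ∈ {c ∈ regular p | c.grade ≤ g + 1}).1
  have hsup : ∀ (κ : Type) (f : κ → ι), (⨆ k, N (f k)).restrictScalars ℂ
      = Submodule.span ℂ (form p '' ⋃ k, C (f k)) := by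
    intro κ f
    rw [Submodule.restrictScalars_iSup, Set.image_iUnion, Submodule.span_iUnion]
    exact iSup_congr fun k => hN _
  refine ⟨fun i => ?_, ?_⟩
  · have h1 : ⨆ j, ⨆ (_ : j ≠ i), N j = ⨆ k : {j // j ≠ i}, N k.1 := iSup_subtype'
    rw [h1]
    have h2 := disjoint_span_form p (hreg i)
      (Set.iUnion_subset fun k : {j // j ≠ i} => hreg k.1)
      (Set.disjoint_iUnion_right.2 fun k : {j // j ≠ i} => hdisj k.2.symm)
    rw [← hN, ← hsup] at h2
    rw [Submodule.disjoint_def] at h2 ⊢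
    exact h2
  · have h1 := hsup ι id
    simp only [id] at h1
    rw [hC, ← restrictScalars_upTo] at h1
    exact Submodule.restrictScalars_injective ℂ _ _ h1

end Cell

/-! ### The summands -/

section Basis

variable {p : ℕ} {M : Type*} [AddCommGroup M] [Module ℂ M] [Module (Uq p) M]
  [IsScalarTower ℂ (Uq p) M]

/-- Nonzero multiples of the elements of a part of a basis are a basis of the submodule spanned by
that part. -/
theorem exists_basis_of_span {κ ι : Type*} (B : Module.Basis κ ℂ M) (N : Submodule (Uq p) M)
    {S : Set κ} (hN : ∀ y, y ∈ N ↔ y ∈ Submodule.span ℂ (B '' S)) {φ : ι → κ}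
    (hφ : Function.Injective φ) (hS : Set.range φ = S) (x : ι → N) (c : ι → ℂ)
    (hc : ∀ i, c i ≠ 0) (hx : ∀ i, (x i : M) = c i • B (φ i)) :
    ∃ b : Module.Basis ι ℂ N, ∀ i, b i = x i := by
  have hli : LinearIndependent ℂ x := by
    refine LinearIndependent.of_comp (N.subtype.restrictScalars ℂ) ?_
    have : (N.subtype.restrictScalars ℂ) ∘ x = (fun i => Units.mk0 (c i) (hc i)) • (B ∘ φ) := by
      funext i; exact hx i
    rw [this]
    exact (B.linearIndependent.comp φ hφ).units_smul _
  have hspan : ⊤ ≤ Submodule.span ℂ (Set.range x) := by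
    rintro y -
    have h1 : (y : M) ∈ (Submodule.span ℂ (Set.range x)).map (N.subtype.restrictScalars ℂ) := by
      refine (Submodule.span_le.2 ?_ : _ ≤ _) ((hN y).1 y.2)
      rintro _ ⟨k, hk, rfl⟩
      obtain ⟨i, rfl⟩ := hS.symm ▸ hk
      refine ⟨(c i)⁻¹ • x i, Submodule.smul_mem _ _ (Submodule.subset_span ⟨i, rfl⟩), ?_⟩
      rw [map_smul]
      change (c i)⁻¹ • (x i : M) = _
      rw [hx, inv_smul_smul₀ (hc i)]
    obtain ⟨z, hz, hzy⟩ := h1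
    rwa [← Subtype.ext hzy]
  exact ⟨Module.Basis.mk hli hspan, fun i => by simp⟩

end Basis

/-! ### Irreducible, zigzag and projective modules spanned by monomials -/

section Summands

variable (p : ℕ)

/-- The exponents of the monomials of degree `N`. -/
def diag (N : ℕ) : Set (ℕ × ℕ) := {i | i.1 + i.2 = N}

/-- The exponents `(a, b)` of the monomials of degree `N` with `b` in the `k`th interval of
length `p`. -/
def block (N k : ℕ) : Set (ℕ × ℕ) := {i | i.1 + i.2 = N ∧ i.2 / p = k}

theorem isStable_diag (N : ℕ) : IsStable p (diag N) := by
  constructor <;> intro a b h _ <;> simp only [diag, Set.mem_ofPred_eq] at h ⊢ <;> omega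

/-- When $p\mid N+1$, the two exponents that adjacent monomials can reach sum to $N+1$, so both are
multiples of $p$ or neither is. Hence $E$ and $F$ vanish at the same block boundaries. -/
theorem isStable_block {N : ℕ} (hN : p ∣ N + 1) (k : ℕ) : IsStable p (block p N k) := by
  constructor
  · rintro a b ⟨h1, h2⟩ h3
    simp only at h1 h2
    refine ⟨by simp only; omega, ?_⟩
    rw [Nat.succ_div, if_neg] at h2
    · exact h2
    · intro h4
      refine h3 ((Nat.dvd_add_left h4).1 ?_)
      rwa [show a + 1 + (b + 1) = N + 1 by omega]
  · rintro a b ⟨h1, h2⟩ h3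
    simp only at h1 h2
    refine ⟨by simp only; omega, ?_⟩
    simp only
    rw [Nat.succ_div, if_neg h3]
    exact h2

variable {p} [p.AtLeastTwo]

theorem Plane.F_pow_smul (s : ℕ) (f : Plane p) : Uq.F p ^ s • f = (Plane.opF p ^ s) f := by
  induction s with
  | zero => simp
  | succ s ih =>
    rw [pow_succ', mul_smul, ih, Plane.gen_smul, pow_succ', Module.End.mul_apply]; rfl

theorem OneForm.F_pow_smul (s : ℕ) (f : OneForm p) :
    Uq.F p ^ s • f = (OneForm.opF p ^ s) f := by
  induction s with
  | zero => simp
  | succ s ih =>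
    rw [pow_succ', mul_smul, ih, OneForm.gen_smul, pow_succ', Module.End.mul_apply]; rfl

/-- Fewer than $p$ consecutive integers just after a multiple of $p$ avoid the multiples of $p$. -/
theorem prod_qInt_ne_zero {k : ℤ} (hk : (p : ℤ) ∣ k) {s : ℕ} (hs : s < p) :
    ∏ i ∈ Finset.range s, qInt p (k + 1 + i) ≠ 0 := by
  refine Finset.prod_ne_zero_iff.2 fun i hi => ?_
  rw [Finset.mem_range] at hi
  rw [Ne, qInt_eq_zero_iff, add_assoc, dvd_add_right hk]
  intro h
  have := Int.le_of_dvd (by omega) h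
  omega

/-- A string of monomials closed under the action spans an irreducible module. -/
theorem Plane.isX_sub {S : Set (ℕ × ℕ)} {hS : IsStable p S} {ε : ℤˣ} {m k r : ℕ} (hr : r ≤ p)
    (hrm : r ≤ m + 1) (hr₁ : 1 ≤ r) (hk : p ∣ k) (hE : p ∣ m + 1 ∨ k = 0) (hF : r = p ∨ r = m + 1)
    (hε : q p ^ ((m : ℤ) - k) = ((ε : ℤ) : ℂ) * q p ^ ((r : ℤ) - 1))
    (hmem : ∀ a b, (a, b) ∈ S ↔ a + b = m + k ∧ k ≤ b ∧ b < k + r) :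
    IsX p ε r (Plane.sub S hS) := by
  have hv : Plane.mon p m k ∈ Plane.sub S hS := by
    rw [Plane.mon_natCast]
    exact Submodule.subset_span ⟨_, (hmem m k).2 ⟨rfl, le_rfl, by omega⟩, rfl⟩
  set v : Plane.sub S hS := ⟨_, hv⟩ with hvdef
  have hpow : ∀ s : ℕ, ((Uq.F p ^ s • v : Plane.sub S hS) : Plane p)
      = (∏ i ∈ Finset.range s, qInt p ((k : ℤ) + 1 + i)) • Plane.mon p ((m : ℤ) - s) (k + s) := by
    intro s
    rw [Submodule.coe_smul, Plane.F_pow_smul, hvdef, Plane.opF_pow]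
  obtain ⟨b, hb⟩ := exists_basis_of_span (Plane.basis p) (Plane.sub S hS)
    (fun y => Plane.mem_sub) (φ := fun s : Fin r => (m - (s : ℕ), k + (s : ℕ)))
    (fun s t h => Fin.ext (by simp only [Prod.mk.injEq] at h; omega))
    (by
      ext ⟨a, b⟩
      rw [hmem, Set.mem_range]
      constructor
      · rintro ⟨s, h⟩
        simp only [Prod.mk.injEq] at h
        omega
      · rintro ⟨h1, h2, h3⟩
        refine ⟨⟨b - k, by omega⟩, ?_⟩
        simp only [Prod.mk.injEq]
        omega)
    (fun s => Uq.F p ^ (s : ℕ) • v)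
    (fun s => ∏ i ∈ Finset.range (s : ℕ), qInt p ((k : ℤ) + 1 + i))
    (fun s => prod_qInt_ne_zero (by exact_mod_cast hk) (by omega))
    (fun s => by
      rw [hpow, ← Plane.mon_natCast]
      have : (s : ℕ) ≤ m := by omega
      push_cast [this]
      rfl)
  refine isX_of_primitive (v := v) ?_ ?_ ?_ b hb
  · refine Subtype.ext ?_
    change Uq.K p • Plane.mon p m k = _ • Plane.mon p m k
    rw [Plane.gen_smul, Plane.op, Plane.opK_mon, hε]
  · refine Subtype.ext ?_
    change Uq.E p • Plane.mon p m k = 0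
    rw [Plane.gen_smul, Plane.op, Plane.opE_mon]
    rcases hE with h | rfl
    · rw [(qInt_natCast_eq_zero_iff p m).2 h, zero_smul]
    · rw [Plane.mon_neg p (by simp), smul_zero]
  -- The string ends either because $F^p=0$ or because the exponent of $x$ reaches $-1$.
  · rcases hF with rfl | rfl
    · exact F_pow_smul_of_le le_rfl v
    · refine Subtype.ext ?_
      rw [hpow, Plane.mon_neg p (by push_cast; omega), smul_zero]; rfl

/-- Modulo $2p$ the exponent $m-k$ is $m+k=(n-1)p+r-1$, because $p\mid k$; each $p$ contributes a
sign. -/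
theorem q_zpow_sub_eq {n m k r : ℕ} {ε : ℤˣ} (hε : ε = (-1) ^ (n - 1))
    (hk : p ∣ k) (h : m + k + 1 = (n - 1) * p + r) :
    q p ^ ((m : ℤ) - k) = ((ε : ℤ) : ℂ) * q p ^ ((r : ℤ) - 1) := by
  obtain ⟨i, rfl⟩ := hk
  have e : (m : ℤ) - (p * i : ℕ) = ((n - 1 : ℕ) : ℤ) * p + (2 * p : ℕ) * (-i) + (r - 1) := by
    have : (m : ℤ) + (p * i : ℕ) + 1 = ((n - 1 : ℕ) : ℤ) * p + r := by exact_mod_cast h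
    push_cast at this ⊢
    linarith
  have h0 := q_ne_zero p
  rw [e, zpow_add₀ h0, zpow_add₀ h0, q_zpow_mul_p, zpow_mul, zpow_natCast (q p),
    (q_primitive p).pow_eq_one, one_zpow, mul_one, hε]
  simp

theorem mem_block_iff {N k a b : ℕ} :
    (a, b) ∈ block p N k ↔ a + b = N ∧ k * p ≤ b ∧ b < k * p + p := by
  have hp := two_le p
  change _ ∧ b / p = k ↔ _
  rw [Nat.div_eq_iff (by omega), Nat.add_sub_assoc (by omega)]
  refine and_congr_right fun _ => and_congr_right fun _ => ?_
  omega

/-- The block of a Steinberg degree spans an irreducible module of dimension `p`. -/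
theorem Plane.isX_block {n k N : ℕ} {ε : ℤˣ} (hn : 1 ≤ n) (hε : ε = (-1) ^ (n - 1)) (hk : k < n)
    (hN : N + 1 = n * p) (hS : IsStable p (block p N k)) :
    IsX p ε p (Plane.sub (block p N k) hS) := by
  have hp := two_le p
  have h1 : k * p + p ≤ n * p := by
    rw [← Nat.succ_mul]; exact Nat.mul_le_mul_right p hk
  have h2 : (n - 1) * p + p = n * p := by rw [← Nat.succ_mul]; congr 1; omega
  have hm : p ∣ N - k * p + 1 := by
    rw [show N - k * p + 1 = n * p - k * p by omega]
    exact Nat.dvd_sub (dvd_mul_left _ _) (dvd_mul_left _ _)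
  refine Plane.isX_sub (m := N - k * p) (k := k * p) le_rfl (by omega) (by omega)
    (dvd_mul_left _ _) (Or.inl hm) (Or.inl rfl)
    (q_zpow_sub_eq hε (dvd_mul_left _ _) (by omega)) fun a b => ?_
  rw [mem_block_iff, show N - k * p + k * p = N by omega]

theorem Plane.isX_diag {r : ℕ} (hr₁ : 1 ≤ r) (hr : r ≤ p) (hS : IsStable p (diag (r - 1))) :
    IsX p 1 r (Plane.sub (diag (r - 1)) hS) := by
  refine Plane.isX_sub (m := r - 1) (k := 0) hr (by omega) hr₁ (dvd_zero p) (Or.inr rfl)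
    (Or.inr (by omega)) (q_zpow_sub_eq (n := 1) (by simp) (dvd_zero p) (by omega)) fun a b => ?_
  simp only [diag, Set.mem_ofPred_eq]
  omega

/-- The chain consists of rescaled monomials $x^{(N-ip)}y^{(ip)}$. Both $Ex_{i+1}$ and $F^{p-1}x_i$
are nonzero multiples of the same monomial, so scaling makes them equal. -/
theorem Plane.isW_diag {n r N : ℕ} {ε : ℤˣ} (hn : 1 ≤ n) (hε : ε = (-1) ^ (n - 1)) (hr₁ : 1 ≤ r)
    (hr : r < p) (hN : N + 1 = (n - 1) * p + r) (hS : IsStable p (diag N)) :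
    IsW p ε r n (Plane.sub (diag N) hS) := by
  have hp := two_le p
  -- `D` is the coefficient of $E$ on $x^{(N-(i+1)p)}y^{((i+1)p)}$; `A` is that of $F^{p-1}$ on
  -- $x^{(N-ip)}y^{(ip)}$. Since $N+1\equiv r\not\equiv0$ modulo $p$, `D` never vanishes.
  set D : ℕ → ℂ := fun i => qInt p ((N : ℤ) - ((i + 1) * p : ℕ) + 1) with hDdef
  set A : ℕ → ℂ := fun i => ∏ l ∈ Finset.range (p - 1), qInt p (((i * p : ℕ) : ℤ) + 1 + l) with hAdef
  have hD : ∀ i, D i ≠ 0 := by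
    intro i
    rw [hDdef, Ne, qInt_eq_zero_iff]
    intro h
    have h1 : (p : ℤ) ∣ r := by
      have : (r : ℤ) = (N - ((i + 1) * p : ℕ) + 1) + ((i + 1 : ℕ) * p - (n - 1 : ℕ) * p) := by
        have : (N : ℤ) + 1 = (n - 1 : ℕ) * p + r := by exact_mod_cast hN
        push_cast at this ⊢
        linarith
      rw [this]
      exact dvd_add h (dvd_sub (dvd_mul_left _ _) (dvd_mul_left _ _))
    have := Int.le_of_dvd (by omega) h1
    omega
  have hA : ∀ i, A i ≠ 0 := fun i =>
    prod_qInt_ne_zero (by push_cast; exact dvd_mul_left _ _) (by omega)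
  -- The solution of $c_{i+1}D_i=c_iA_i$ with $c_0=1$.
  set c : ℕ → ℂ := fun i => ∏ j ∈ Finset.range i, A j / D j with hcdef
  have hc : ∀ i, c i ≠ 0 := fun i =>
    Finset.prod_ne_zero_iff.2 fun j _ => div_ne_zero (hA j) (hD j)
  have hcsucc : ∀ i, c (i + 1) * D i = c i * A i := by
    intro i
    rw [hcdef]
    simp only
    rw [Finset.prod_range_succ, mul_assoc, div_mul_cancel₀ _ (hD i)]
  have hmem : ∀ i : ℕ, c i • Plane.mon p ((N : ℤ) - (i * p : ℕ)) (i * p : ℕ)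
      ∈ Plane.sub (diag N) hS := by
    intro i
    refine Plane.mem_sub.2 (Submodule.smul_mem _ _ ?_)
    by_cases h : i * p ≤ N
    · rw [← Nat.cast_sub h, Plane.mon_natCast]
      refine Submodule.subset_span ⟨_, ?_, rfl⟩
      change N - i * p + i * p = N
      omega
    · rw [Plane.mon_neg p (by omega)]; exact Submodule.zero_mem _
  set x : ℕ → Plane.sub (diag N) hS := fun i => ⟨_, hmem i⟩ with hxdef
  have hpow : ∀ i s : ℕ, ((Uq.F p ^ s • x i : Plane.sub (diag N) hS) : Plane p)
      = (c i * ∏ l ∈ Finset.range s, qInt p (((i * p : ℕ) : ℤ) + 1 + l))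
        • Plane.mon p ((N : ℤ) - (i * p : ℕ) - s) ((i * p : ℕ) + s) := by
    intro i s
    rw [Submodule.coe_smul, Plane.F_pow_smul, hxdef, map_smul, Plane.opF_pow, smul_smul]
  have hle : ∀ i : ℕ, i < n → i * p ≤ (n - 1) * p := fun i hi => Nat.mul_le_mul_right p (by omega)
  have hle' : ∀ i : ℕ, i < n - 1 → i * p + p ≤ (n - 1) * p := fun i hi => by
    rw [← Nat.succ_mul]; exact Nat.mul_le_mul_right p hi
  have hcoef : ∀ i s : ℕ, s < p →
      c i * ∏ l ∈ Finset.range s, qInt p (((i * p : ℕ) : ℤ) + 1 + l) ≠ 0 := fun i s hs =>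
    mul_ne_zero (hc i) (prod_qInt_ne_zero (by push_cast; exact dvd_mul_left _ _) hs)
  have hdm : ∀ i s : ℕ, s < p → (i * p + s) / p = i ∧ (i * p + s) % p = s := by
    intro i s hs
    rw [mul_comm, add_comm]
    exact ⟨by rw [Nat.add_mul_div_left _ _ (by omega), Nat.div_eq_of_lt hs, zero_add],
      by rw [Nat.add_mul_mod_self_left, Nat.mod_eq_of_lt hs]⟩
  -- Quotient and remainder of the $y$-exponent by $p$: remainders below $r$ are in a top copy, the
  -- others in a socle copy.
  let ψ : (Fin n × Fin r) ⊕ (Fin (n - 1) × Fin (p - r)) → ℕ × ℕ :=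
    Sum.elim (fun a => ((a.1 : ℕ), (a.2 : ℕ))) fun a => ((a.1 : ℕ), r + (a.2 : ℕ))
  have hψ : ∀ i, (ψ i).2 < p ∧ (ψ i).1 * p + (ψ i).2 ≤ N := by
    rintro (⟨i, s⟩ | ⟨j, s⟩)
    · have := hle i i.2
      simp only [ψ, Sum.elim_inl]; omega
    · have := hle' j j.2
      simp only [ψ, Sum.elim_inr]; omega
  have hψinj : Function.Injective ψ := by
    rintro (⟨i, s⟩ | ⟨j, s⟩) (⟨i', s'⟩ | ⟨j', s'⟩) h <;>
      simp only [ψ, Sum.elim_inl, Sum.elim_inr, Prod.mk.injEq] at h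
    · rw [Fin.ext h.1, Fin.ext h.2]
    · omega
    · omega
    · rw [Fin.ext h.1, Fin.ext (by omega : (s : ℕ) = s')]
  obtain ⟨b, hb⟩ := exists_basis_of_span (Plane.basis p) (Plane.sub (diag N) hS)
    (fun y => Plane.mem_sub)
    (φ := fun i => (N - ((ψ i).1 * p + (ψ i).2), (ψ i).1 * p + (ψ i).2))
    (fun i j h => hψinj (by
      have h1 := hdm (ψ i).1 (ψ i).2 (hψ i).1
      have h2 := hdm (ψ j).1 (ψ j).2 (hψ j).1
      rw [(Prod.mk.inj h).2] at h1
      exact Prod.ext (h1.1.symm.trans h2.1) (h1.2.symm.trans h2.2)))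
    (by
      ext ⟨a, b⟩
      change _ ↔ a + b = N
      rw [Set.mem_range]
      constructor
      · rintro ⟨i, h⟩
        have := (hψ i).2
        simp only [Prod.mk.injEq] at h
        omega
      · intro h
        have h1 := Nat.div_add_mod b p
        have h2 := Nat.mod_lt b (by omega : 0 < p)
        rw [mul_comm] at h1
        by_cases hs : b % p < r
        · have hi : b / p < n := by
            by_contra hi
            have := Nat.mul_le_mul_right p (show n - 1 + 1 ≤ b / p by omega)
            rw [Nat.succ_mul] at this
            omega
          refine ⟨Sum.inl (⟨b / p, hi⟩, ⟨b % p, hs⟩), ?_⟩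
          simp only [ψ, Sum.elim_inl, Prod.mk.injEq]
          omega
        · have hi : b / p < n - 1 := by
            by_contra hi
            have := Nat.mul_le_mul_right p (show n - 1 ≤ b / p by omega)
            omega
          refine ⟨Sum.inr (⟨b / p, hi⟩, ⟨b % p - r, by omega⟩), ?_⟩
          simp only [ψ, Sum.elim_inr, Prod.mk.injEq]
          omega)
    (fun i => Uq.F p ^ (ψ i).2 • x (ψ i).1) _ (fun i => hcoef (ψ i).1 (ψ i).2 (hψ i).1)
    (fun i => by
      rw [hpow, ← Plane.mon_natCast, Nat.cast_sub (hψ i).2, Nat.cast_add, sub_sub])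
  refine isW_of_chain (x := x) hr₁ hr ?_ ?_ ?_ ?_ b (fun i s => hb _) (fun j s => hb _)
  · intro i hi
    refine Subtype.ext ?_
    change Uq.K p • c i • Plane.mon p _ _ = _ • c i • Plane.mon p _ _
    have := hle i hi
    rw [smul_smul_comm', Plane.gen_smul, Plane.op, ← Nat.cast_sub (by omega : i * p ≤ N),
      Plane.opK_mon, q_zpow_sub_eq hε (dvd_mul_left _ _) (r := r) (by omega), smul_comm]
  · refine Subtype.ext ?_
    change Uq.E p • c 0 • Plane.mon p _ _ = 0
    rw [smul_smul_comm', Plane.gen_smul, Plane.op, Plane.opE_mon, Plane.mon_neg p (by simp),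
      smul_zero, smul_zero]
  · intro i hi
    refine Subtype.ext ?_
    rw [hpow]
    change Uq.E p • c (i + 1) • Plane.mon p _ _ = _
    rw [smul_smul_comm', Plane.gen_smul, Plane.op, Plane.opE_mon, smul_smul]
    have e := hcsucc i
    rw [hDdef, hAdef] at e
    simp only at e
    rw [e]
    congr 2
    · push_cast [(by omega : 1 ≤ p)]; ring
    · push_cast [(by omega : 1 ≤ p)]; ring
  · refine Subtype.ext ?_
    rw [hpow, Plane.mon_neg p (by omega), smul_zero]; rfl

/-- The one-forms on a block of a Steinberg degree are a projective cover. -/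
theorem OneForm.isP_block {n k N : ℕ} {ε : ℤˣ} (hn : 1 ≤ n) (hε : ε = (-1) ^ (n - 1)) (hk : k < n)
    (hN : N + 1 = n * p) (hS : IsStable p (block p N k)) :
    IsP p ε (p - 1) (OneForm.sub (block p N k) hS) := by
  have hp := two_le p
  have h1 : k * p + p ≤ n * p := by
    rw [← Nat.succ_mul]; exact Nat.mul_le_mul_right p hk
  have h2 : (n - 1) * p + p = n * p := by rw [← Nat.succ_mul]; congr 1; omega
  have hm : p ∣ N - k * p + 1 := by
    rw [show N - k * p + 1 = n * p - k * p by omega]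
    exact Nat.dvd_sub (dvd_mul_left _ _) (dvd_mul_left _ _)
  obtain ⟨m, hmdef⟩ : ∃ m, m = N - k * p := ⟨_, rfl⟩
  rw [← hmdef] at hm
  have hm0 : qInt p ((m : ℤ) + 1) = 0 := (qInt_natCast_eq_zero_iff p m).2 hm
  set U := OneForm.sub (block p N k) hS with hU
  have hxi : ∀ s < p, OneForm.xi p ((m : ℤ) - s) ((k * p : ℕ) + s) ∈ U := by
    intro s hs
    rw [← Nat.cast_sub (by omega), ← Nat.cast_add, OneForm.xi_natCast]
    refine Submodule.subset_span ⟨_, ?_, rfl⟩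
    exact mem_block_iff.2 ⟨by omega, by omega, by omega⟩
  have heta : ∀ s < p, OneForm.eta p ((m : ℤ) - s) ((k * p : ℕ) + s) ∈ U := by
    intro s hs
    rw [← Nat.cast_sub (by omega), ← Nat.cast_add, OneForm.eta_natCast]
    refine Submodule.subset_span ⟨_, ?_, rfl⟩
    exact mem_block_iff.2 ⟨by omega, by omega, by omega⟩
  -- The leading $\eta$-form. As $p\mid m+1$, its image under $E$ is just the leading $\xi$-form,
  -- which $E$ kills.
  set e : U := ⟨_, heta 0 (by omega)⟩ with he
  have he' : (e : OneForm p) = OneForm.eta p m (k * p : ℕ) := by simp [he]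
  have hEe : ((Uq.E p • e : U) : OneForm p) = OneForm.xi p m (k * p : ℕ) := by
    rw [Submodule.coe_smul, he', OneForm.gen_smul, OneForm.op, OneForm.opE_eta, hm0, mul_zero,
      zero_smul, zero_add]
  have hdom : IsDominant (p := p) ε e := by
    constructor
    · refine Subtype.ext ?_
      rw [Submodule.coe_smul, Submodule.coe_smul_of_tower, he', OneForm.gen_smul, OneForm.op, OneForm.opK_eta]
      congr 1
      have h0 := q_ne_zero p
      rw [show (m : ℤ) - (k * p : ℕ) - 1 = (m - (k * p : ℕ)) + -1 by
        ring, zpow_add₀ h0, q_zpow_sub_eq hε (dvd_mul_left p k) (r := p) (by omega),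
        mul_assoc, ← zpow_add₀ h0]
      congr 2; ring
    · refine Subtype.ext ?_
      rw [Submodule.coe_smul, hEe, OneForm.gen_smul, OneForm.op, OneForm.opE_xi, hm0, mul_zero,
        zero_smul]; rfl
  have hgen : ∀ N : Submodule (Uq p) U, e ∈ N → N = ⊤ := by
    intro N' heN
    have hsmul : ∀ (c : ℂ) (w : U), w ∈ N' → c • w ∈ N' := fun c w hw => by
      rw [← algebraMap_smul (Uq p) c]; exact N'.smul_mem _ hw
    have h3 : ∀ s (hs : s < p), (⟨_, heta s hs⟩ : U) ∈ N' := by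
      intro s hs
      have h4 : (Uq.F p ^ s • e : U)
          = (∏ i ∈ Finset.range s, qInt p (((k * p : ℕ) : ℤ) + 1 + i)) • ⟨_, heta s hs⟩ := by
        refine Subtype.ext ?_
        rw [Submodule.coe_smul, OneForm.F_pow_smul, he, OneForm.opF_pow_eta]
        simp only [Nat.cast_zero, add_zero, sub_zero]
        rfl
      have h5 := prod_qInt_ne_zero (p := p) (k := ((k * p : ℕ) : ℤ))
        (by push_cast; exact dvd_mul_left _ _) hs
      rw [← inv_smul_smul₀ h5 (⟨_, heta s hs⟩ : U), ← h4]
      exact hsmul _ _ (N'.smul_mem _ heN)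
    have h6 : ∀ s (hs : s < p), (⟨_, hxi s hs⟩ : U) ∈ N' := by
      intro s hs
      rcases s with _ | s
      · have : (⟨_, hxi 0 hs⟩ : U) = Uq.E p • e :=
          Subtype.ext (by rw [hEe]; simp)
        rw [this]
        exact N'.smul_mem _ heN
      -- $E$ maps an $\eta$-form to the $\xi$-form with the same exponents plus a multiple of the
      -- preceding $\eta$-form, already known to lie in `N'`.
      · have : (⟨_, hxi (s + 1) hs⟩ : U) = Uq.E p • (⟨_, heta (s + 1) hs⟩ : U)
            + (-((q p)⁻¹ * qInt p ((m : ℤ) - (s + 1 : ℕ) + 1))) • (⟨_, heta s (by omega)⟩ : U) := by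
          refine Subtype.ext ?_
          change _ = Uq.E p • OneForm.eta p _ _ + _ • OneForm.eta p _ _
          rw [OneForm.gen_smul, OneForm.op, OneForm.opE_eta]
          simp only
          rw [show (m : ℤ) - (s + 1 : ℕ) + 1 = m - s by push_cast; ring,
            show ((k * p : ℕ) : ℤ) + (s + 1 : ℕ) - 1 = (k * p : ℕ) + s by push_cast; ring]
          module
        rw [this]
        exact N'.add_mem (N'.smul_mem _ (h3 _ hs)) (hsmul _ _ (h3 _ (by omega)))
    refine eq_top_iff.2 ?_
    rintro ⟨y, hy⟩ -
    have h7 : y ∈ Submodule.span ℂ (OneForm.basis p '' {i | Sum.elim id id i ∈ block p N k}) := hy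
    have h8 : ∃ hy' : y ∈ U, (⟨y, hy'⟩ : U) ∈ N' := by
      clear hy
      induction h7 using Submodule.span_induction with
      | zero => exact ⟨U.zero_mem, N'.zero_mem⟩
      | add x y hx hy ihx ihy =>
        obtain ⟨hx1, hx2⟩ := ihx
        obtain ⟨hy1, hy2⟩ := ihy
        exact ⟨U.add_mem hx1 hy1, N'.add_mem hx2 hy2⟩
      | smul c x hx ih =>
        obtain ⟨hx1, hx2⟩ := ih
        have h9 := hsmul c _ hx2
        exact ⟨(c • (⟨x, hx1⟩ : U)).2, h9⟩
      | mem x hx =>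
        obtain ⟨⟨a, b⟩ | ⟨a, b⟩, hab, rfl⟩ := hx <;>
          obtain ⟨ha, hb, hb'⟩ := mem_block_iff.1 (show (a, b) ∈ block p N k from hab) <;>
          refine ⟨Submodule.subset_span ⟨_, hab, rfl⟩, ?_⟩
        · have := h6 (b - k * p) (by omega)
          simp only [← Nat.cast_sub (show b - k * p ≤ m by omega), ← Nat.cast_add,
            OneForm.xi_natCast, show k * p + (b - k * p) = b by omega,
            show m - (b - k * p) = a by omega] at this
          exact this
        · have := h3 (b - k * p) (by omega)
          simp only [← Nat.cast_sub (show b - k * p ≤ m by omega), ← Nat.cast_add,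
            OneForm.eta_natCast, show k * p + (b - k * p) = b by omega,
            show m - (b - k * p) = a by omega] at this
          exact this
    exact h8.2
  refine hdom.isP hgen ?_
  let ψ : Fin p → ℕ × ℕ := fun s => (m - (s : ℕ), k * p + (s : ℕ))
  have hψ : Function.Injective ψ := fun s t h => Fin.ext (by
    simp only [ψ, Prod.mk.injEq] at h; omega)
  obtain ⟨b, -⟩ := exists_basis_of_span (OneForm.basis p) U (fun y => OneForm.mem_sub)
    (φ := Sum.map ψ ψ) (hψ.sumMap hψ)
    (by
      have h3 : Set.range ψ = block p N k := by
        ext ⟨a, b⟩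
        rw [mem_block_iff, Set.mem_range]
        constructor
        · rintro ⟨s, h⟩
          simp only [ψ, Prod.mk.injEq] at h
          omega
        · rintro ⟨h1, h2, h3⟩
          refine ⟨⟨b - k * p, by omega⟩, ?_⟩
          simp only [ψ, Prod.mk.injEq]
          omega
      ext i
      rcases i with i | i <;>
        simp [← h3])
    (Sum.elim (fun s => ⟨_, hxi s s.2⟩) fun s => ⟨_, heta s s.2⟩) (fun _ => 1)
    (fun _ => one_ne_zero)
    (by
      rintro (s | s)
      · rw [one_smul]
        simp only [Sum.elim_inl, Sum.map_inl, ψ, ← OneForm.xi_natCast]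
        rw [Nat.cast_sub (by omega), Nat.cast_add]
      · rw [one_smul]
        simp only [Sum.elim_inr, Sum.map_inr, ψ, ← OneForm.eta_natCast]
        rw [Nat.cast_sub (by omega), Nat.cast_add])
  rw [Module.finrank_eq_card_basis b]
  simp [two_mul]

end Summands

/-! ### Images of monomial submodules under `d` and `theta` -/

section Images

variable {p : ℕ} [p.AtLeastTwo]

theorem restrictScalars_map_sub (f : Plane p →ₗ[Uq p] OneForm p) {S : Set (ℕ × ℕ)}
    (hS : IsStable p S) : ((Plane.sub S hS).map f).restrictScalars ℂ
      = Submodule.span ℂ ((fun i => f (Plane.basis p i)) '' S) := by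
  have h1 : ((Plane.sub S hS).map f).restrictScalars ℂ
      = (Submodule.span ℂ (Plane.basis p '' S)).map (f.restrictScalars ℂ) := rfl
  rw [h1, Submodule.map_span, Set.image_image]
  rfl

theorem restrictScalars_map_d {S : Set (ℕ × ℕ)} (hS : IsStable p S) :
    ((Plane.sub S hS).map (d p)).restrictScalars ℂ
      = Submodule.span ℂ (Cell.form p '' (Sum.inl '' S)) := by
  rw [restrictScalars_map_sub, Set.image_image]; rfl

theorem restrictScalars_map_theta {S : Set (ℕ × ℕ)} (hS : IsStable p S) :
    ((Plane.sub S hS).map (theta p)).restrictScalars ℂ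
      = Submodule.span ℂ (Cell.form p '' ((Sum.inr ∘ Sum.inl) '' S)) := by
  rw [restrictScalars_map_sub, Set.image_image]; rfl

theorem restrictScalars_sub {S : Set (ℕ × ℕ)} (hS : IsStable p S) :
    (OneForm.sub S hS).restrictScalars ℂ
      = Submodule.span ℂ (Cell.form p '' ((Sum.inr ∘ Sum.inr) '' {i | Sum.elim id id i ∈ S})) := by
  rw [Set.image_image]; rfl

theorem map_d_le_grade {S : Set (ℕ × ℕ)} {hS : IsStable p S} {i : ℕ}
    (h : ∀ a b, (a, b) ∈ S → a + b = i + 1) :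
    (Plane.sub S hS).map (d p) ≤ OneForm.grade p i := by
  intro y hy
  have h1 : y ∈ ((Plane.sub S hS).map (d p)).restrictScalars ℂ := hy
  rw [restrictScalars_map_d] at h1
  refine (Submodule.span_le (p := OneForm.gradeSpan p i)).2 ?_ h1
  rintro _ ⟨_, ⟨⟨a, b⟩, hab, rfl⟩, rfl⟩
  exact Cell.form_mem_gradeSpan p _ (h a b hab)

theorem map_theta_le_grade {S : Set (ℕ × ℕ)} {hS : IsStable p S} {i : ℕ}
    (h : ∀ a b, (a, b) ∈ S → a + b + 1 = i) :
    (Plane.sub S hS).map (theta p) ≤ OneForm.grade p i := by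
  intro y hy
  have h1 : y ∈ ((Plane.sub S hS).map (theta p)).restrictScalars ℂ := hy
  rw [restrictScalars_map_theta] at h1
  refine (Submodule.span_le (p := OneForm.gradeSpan p i)).2 ?_ h1
  rintro _ ⟨_, ⟨⟨a, b⟩, hab, rfl⟩, rfl⟩
  refine Cell.form_mem_gradeSpan p _ ?_
  have := h a b hab
  change a + b + 2 = i + 1
  omega

theorem injOn_of_left_inverse (f : Plane p →ₗ[Uq p] OneForm p) (g : OneForm p →ₗ[ℂ] Plane p)
    {S : Set (ℕ × ℕ)} (hS : IsStable p S)
    (h : ∀ i ∈ S, g (f (Plane.basis p i)) = Plane.basis p i) :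
    Set.InjOn f (Plane.sub S hS) := by
  have h1 : ∀ x ∈ Plane.sub S hS, g (f x) = x := by
    intro x hx
    have h2 : Submodule.span ℂ (Plane.basis p '' S)
        ≤ LinearMap.eqLocus (g ∘ₗ f.restrictScalars ℂ) LinearMap.id := by
      refine Submodule.span_le.2 ?_
      rintro _ ⟨i, hi, rfl⟩
      exact h i hi
    exact h2 (Plane.mem_sub.1 hx)
  intro x hx y hy hxy
  rw [← h1 x hx, ← h1 y hy, hxy]

theorem isExactCopy_map {S : Set (ℕ × ℕ)} (hS : IsStable p S) {N : ℕ} (hN : ¬ p ∣ N)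
    (h : ∀ i ∈ S, i.1 + i.2 = N) :
    IsExactCopy (Plane.sub S hS) ((Plane.sub S hS).map (d p)) := by
  refine ⟨injOn_of_left_inverse (d p) (primitive p) hS ?_, rfl⟩
  rintro ⟨a, b⟩ hab
  have h1 : qInt p ((a : ℤ) + b) ≠ 0 := by
    rw [Ne, qInt_eq_zero_iff, show (a : ℤ) + b = (N : ℤ) by exact_mod_cast h _ hab]
    exact_mod_cast hN
  rw [← Plane.mon_natCast]
  exact primitive_dLin_mon p h1

/-- The map `theta` is an isomorphism onto its image in the nonresonant grades. -/
theorem exists_equiv_map_theta {S : Set (ℕ × ℕ)} (hS : IsStable p S) {N : ℕ} (hN : ¬ p ∣ N + 2)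
    (h : ∀ i ∈ S, i.1 + i.2 = N) :
    Nonempty (Plane.sub S hS ≃ₗ[Uq p] (Plane.sub S hS).map (theta p)) := by
  have hinj : Set.InjOn (theta p) (Plane.sub S hS) := by
    refine injOn_of_left_inverse (theta p) (coprimitive p) hS ?_
    rintro ⟨a, b⟩ hab
    have h1 : qInt p ((a : ℤ) + b + 2) ≠ 0 := by
      rw [Ne, qInt_eq_zero_iff, show (a : ℤ) + b + 2 = (N + 2 : ℕ) by
        have := h _ hab
        simp only at this
        omega]
      exact_mod_cast hN
    rw [← Plane.mon_natCast]
    exact coprimitive_thetaLin_mon p h1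
  refine ⟨LinearEquiv.ofBijective ((theta p).submoduleMap (Plane.sub S hS))
    ⟨fun x y hxy => Subtype.ext (hinj x.2 y.2 (congrArg Subtype.val hxy)),
      (theta p).submoduleMap_surjective _⟩⟩

end Images

/-! ### The decompositions -/

section Decomposition

theorem pred_mul_add {n : ℕ} (hn : 1 ≤ n) (p : ℕ) : (n - 1) * p + p = n * p := by
  rw [← Nat.succ_mul]; congr 1; omega

theorem exists_mem_block (p : ℕ) {N m a b : ℕ} (hab : a + b = N) (hb : b < m * p) :
    ∃ j : Fin m, (a, b) ∈ block p N j :=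
  ⟨⟨b / p, Nat.div_lt_of_lt_mul (by rwa [mul_comm])⟩, hab, rfl⟩

variable (p : ℕ) [p.AtLeastTwo]

theorem not_dvd_of_between {p Q m : ℕ} (hQ : p ∣ Q) (h₁ : Q < m) (h₂ : m < Q + p) : ¬ p ∣ m := by
  intro h
  have h3 := Nat.le_of_dvd (by omega) (Nat.dvd_sub h hQ)
  omega

theorem eq_of_dvd_of_between {p Q m : ℕ} (hQ : p ∣ Q) (h₁ : Q < m) (h₂ : m ≤ Q + p) (h : p ∣ m) :
    m = Q + p := by
  by_contra h3
  exact not_dvd_of_between hQ h₁ (by omega) h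

theorem isStable_block_low : IsStable p (block p (p - 1) 0) :=
  isStable_block p (by have := two_le p; rw [Nat.sub_add_cancel (by omega)]) 0

/-- The summands in the lowest range of grades. -/
def lowSummand : LowSummand p → Submodule (Uq p) (OneForm p)
  | .dX r _ _ => (Plane.sub (diag (r - 1)) (isStable_diag p _)).map (d p)
  | .X r _ _ => (Plane.sub (diag (r - 1)) (isStable_diag p _)).map (theta p)
  | .P => OneForm.sub (block p (p - 1) 0) (isStable_block_low p)

/-- The labels of the basis elements that span the summands in the lowest range of grades. -/
def lowCells : LowSummand p → Set Cell
  | .dX r _ _ => Sum.inl '' diag (r - 1)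
  | .X r _ _ => (Sum.inr ∘ Sum.inl) '' diag (r - 1)
  | .P => (Sum.inr ∘ Sum.inr) '' {i | Sum.elim id id i ∈ block p (p - 1) 0}

theorem isDirectSum_lowSummand : IsDirectSum (lowSummand p) (OneForm.upTo p (p - 1)) := by
  have hp := two_le p
  refine Cell.isDirectSum p _ (lowCells p) ?_ ?_ ?_
  · rintro (⟨r, h₁, h₂⟩ | ⟨r, h₁, h₂⟩ | _)
    · exact restrictScalars_map_d _
    · exact restrictScalars_map_theta _
    · exact restrictScalars_sub (isStable_block_low p)
  · intro i j hij
    rw [Set.disjoint_left]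
    intro c hc hc'
    apply hij
    rcases c with ⟨a, b⟩ | ⟨a, b⟩ | ⟨a, b⟩ | ⟨a, b⟩ <;>
    rcases i with ⟨r, h₁, h₂⟩ | ⟨r, h₁, h₂⟩ | _ <;>
    rcases j with ⟨r', h₁', h₂'⟩ | ⟨r', h₁', h₂'⟩ | _ <;>
    simp [lowCells, diag] at hc hc' ⊢ <;> omega
  · ext c
    rw [Set.mem_iUnion]
    constructor
    · rintro ⟨⟨r, h₁, h₂⟩ | ⟨r, h₁, h₂⟩ | _, hc⟩
      · obtain ⟨⟨a, b⟩, hab, rfl⟩ := hc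
        replace hab : a + b = r - 1 := hab
        refine ⟨not_dvd_of_between (p := p) (m := a + b) (dvd_zero p) (by omega) (by omega), ?_⟩
        change a + b ≤ _
        omega
      · obtain ⟨⟨a, b⟩, hab, rfl⟩ := hc
        replace hab : a + b = r - 1 := hab
        refine ⟨not_dvd_of_between (p := p) (m := a + b + 2) (dvd_zero p) (by omega) (by omega), ?_⟩
        change a + b + 2 ≤ _
        omega
      · obtain ⟨⟨a, b⟩ | ⟨a, b⟩, ⟨hab, -⟩, rfl⟩ := hc <;> replace hab : a + b = p - 1 := hab
        all_goals
          have h3 : a + b + 1 = p := by omega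
          refine ⟨show p ∣ a + b + 1 by rw [h3], ?_⟩
          change a + b + 1 ≤ _
          omega
    · rintro ⟨hreg, hg⟩
      have hpos : ∀ m, ¬ p ∣ m → m ≠ 0 ∧ m ≠ p := fun m h =>
        ⟨by rintro rfl; exact h (dvd_zero p), by rintro rfl; exact h dvd_rfl⟩
      rcases c with ⟨a, b⟩ | ⟨a, b⟩ | ⟨a, b⟩ | ⟨a, b⟩
      · have h := hpos (a + b) hreg
        replace hg : a + b ≤ p - 1 + 1 := hg
        exact ⟨.dX (a + b + 1) (by omega) (by omega), ⟨_, rfl, rfl⟩⟩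
      · have h := hpos (a + b + 2) hreg
        replace hg : a + b + 2 ≤ p - 1 + 1 := hg
        exact ⟨.X (a + b + 1) (by omega) (by omega), ⟨_, rfl, rfl⟩⟩
      · replace hg : a + b + 1 ≤ p - 1 + 1 := hg
        have h := eq_of_dvd_of_between (dvd_zero p) (by omega : 0 < a + b + 1) (by omega) hreg
        exact ⟨.P, ⟨Sum.inl (a, b), mem_block_iff.2 ⟨by omega, by omega, by omega⟩, rfl⟩⟩
      · replace hg : a + b + 1 ≤ p - 1 + 1 := hg
        have h := eq_of_dvd_of_between (dvd_zero p) (by omega : 0 < a + b + 1) (by omega) hreg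
        exact ⟨.P, ⟨Sum.inr (a, b), mem_block_iff.2 ⟨by omega, by omega, by omega⟩, rfl⟩⟩

variable (n : ℕ)

theorem isStable_block_top (hn : 2 ≤ n) (j : ℕ) : IsStable p (block p (n * p - 1) j) :=
  isStable_block p (by
    have := two_le p
    have := pred_mul_add (by omega : 1 ≤ n) p
    rw [Nat.sub_add_cancel (by omega)]; exact dvd_mul_left p n) j

theorem isStable_block_bottom (hn : 2 ≤ n) (j : ℕ) : IsStable p (block p ((n - 1) * p - 1) j) :=
  isStable_block p (by
    have := two_le p
    have : 1 * p ≤ (n - 1) * p := Nat.mul_le_mul_right p (by omega)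
    rw [Nat.sub_add_cancel (by omega)]; exact dvd_mul_left p _) j

/-- The summands in the `n`th range of grades. -/
def summand (hn : 2 ≤ n) : Summand p n → Submodule (Uq p) (OneForm p)
  | .lower => OneForm.upTo p ((n - 1) * p - 1)
  | .dW r _ _ => (Plane.sub (diag ((n - 1) * p + r - 1)) (isStable_diag p _)).map (d p)
  | .dX j => (Plane.sub (block p (n * p - 1) j) (isStable_block_top p n hn j)).map (d p)
  | .X j => (Plane.sub (block p ((n - 1) * p - 1) j) (isStable_block_bottom p n hn j)).map (theta p)
  | .W r _ _ => (Plane.sub (diag ((n - 1) * p + r - 1)) (isStable_diag p _)).map (theta p)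
  | .P j => OneForm.sub (block p (n * p - 1) j) (isStable_block_top p n hn j)

/-- The labels of the basis elements that span the summands in the `n`th range of grades. -/
def cells : Summand p n → Set Cell
  | .lower => {c ∈ Cell.regular p | c.grade ≤ (n - 1) * p - 1 + 1}
  | .dW r _ _ => Sum.inl '' diag ((n - 1) * p + r - 1)
  | .dX j => Sum.inl '' block p (n * p - 1) j
  | .X j => (Sum.inr ∘ Sum.inl) '' block p ((n - 1) * p - 1) j
  | .W r _ _ => (Sum.inr ∘ Sum.inl) '' diag ((n - 1) * p + r - 1)
  | .P j => (Sum.inr ∘ Sum.inr) '' {i | Sum.elim id id i ∈ block p (n * p - 1) j}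

theorem pairwise_disjoint_cells (hn : 2 ≤ n) :
    Pairwise fun i j => Disjoint (cells p n i) (cells p n j) := by
  have hp := two_le p
  have hQ := pred_mul_add (by omega : 1 ≤ n) p
  have hQ1 : 1 * p ≤ (n - 1) * p := Nat.mul_le_mul_right p (by omega)
  intro i j hij
  rw [Set.disjoint_left]
  intro c hc hc'
  apply hij
  -- Treating $(n-1)p$ and $np$ as atoms makes every case linear.
  generalize hQdef : (n - 1) * p = Q at *
  generalize hTdef : n * p = T at *
  rcases c with ⟨a, b⟩ | ⟨a, b⟩ | ⟨a, b⟩ | ⟨a, b⟩ <;>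
  rcases i with _ | ⟨r, h₁, h₂⟩ | i | i | ⟨r, h₁, h₂⟩ | i <;>
  rcases j with _ | ⟨r', h₁', h₂'⟩ | j | j | ⟨r', h₁', h₂'⟩ | j <;>
  simp [cells, diag, block, Cell.regular, Cell.grade, hQdef, hTdef] at hc hc' ⊢ <;> omega

/-- The range of grades is $(n-1)p,\dots,np-1$. Exact forms come from the degrees strictly between
$(n-1)p$ and $np$, coexact ones from degrees $(n-1)p-1$ to $np-3$. The extreme degrees $np-1$ for
$d$ and $(n-1)p-1$ for `theta` split into $n$ and $n-1$ blocks $X_p$; the others give one zigzag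
each. -/
theorem isDirectSum_summand (hn : 2 ≤ n) :
    IsDirectSum (summand p n hn) (OneForm.upTo p (n * p - 1)) := by
  have hp := two_le p
  have hQ := pred_mul_add (by omega : 1 ≤ n) p
  have hQ1 : 1 * p ≤ (n - 1) * p := Nat.mul_le_mul_right p (by omega)
  have hQd : p ∣ (n - 1) * p := dvd_mul_left _ _
  have hTd : p ∣ n * p := dvd_mul_left _ _
  refine Cell.isDirectSum p _ (cells p n) ?_ (pairwise_disjoint_cells p n hn) ?_
  · rintro (_ | ⟨r, h₁, h₂⟩ | j | j | ⟨r, h₁, h₂⟩ | j)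
    · exact Cell.restrictScalars_upTo p _
    · exact restrictScalars_map_d _
    · exact restrictScalars_map_d _
    · exact restrictScalars_map_theta _
    · exact restrictScalars_map_theta _
    · exact restrictScalars_sub (isStable_block_top p n hn j)
  · ext c
    rw [Set.mem_iUnion]
    constructor
    · rintro ⟨_ | ⟨r, h₁, h₂⟩ | j | j | ⟨r, h₁, h₂⟩ | j, hc⟩
      · exact ⟨hc.1, hc.2.trans (by omega)⟩
      · obtain ⟨⟨a, b⟩, hab, rfl⟩ := hc
        replace hab : a + b = (n - 1) * p + r - 1 := hab
        refine ⟨not_dvd_of_between (p := p) (m := a + b) hQd (by omega) (by omega), ?_⟩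
        change a + b ≤ _
        omega
      · obtain ⟨⟨a, b⟩, ⟨hab, -⟩, rfl⟩ := hc
        replace hab : a + b = n * p - 1 := hab
        refine ⟨not_dvd_of_between (p := p) (m := a + b) hQd (by omega) (by omega), ?_⟩
        change a + b ≤ _
        omega
      · obtain ⟨⟨a, b⟩, ⟨hab, -⟩, rfl⟩ := hc
        replace hab : a + b = (n - 1) * p - 1 := hab
        refine ⟨not_dvd_of_between (p := p) (m := a + b + 2) hQd (by omega) (by omega), ?_⟩
        change a + b + 2 ≤ _
        omega
      · obtain ⟨⟨a, b⟩, hab, rfl⟩ := hc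
        replace hab : a + b = (n - 1) * p + r - 1 := hab
        refine ⟨not_dvd_of_between (p := p) (m := a + b + 2) hQd (by omega) (by omega), ?_⟩
        change a + b + 2 ≤ _
        omega
      · obtain ⟨⟨a, b⟩ | ⟨a, b⟩, ⟨hab, -⟩, rfl⟩ := hc <;> replace hab : a + b = n * p - 1 := hab
        all_goals
          have h3 : a + b + 1 = n * p := by omega
          refine ⟨show p ∣ a + b + 1 by rw [h3]; exact hTd, ?_⟩
          change a + b + 1 ≤ _
          omega
    · rintro ⟨hreg, hg⟩
      by_cases hlow : c.grade ≤ (n - 1) * p - 1 + 1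
      · exact ⟨.lower, hreg, hlow⟩
      have hne : ∀ m, ¬ p ∣ m → m ≠ n * p := by
        rintro m h rfl; exact h hTd
      rcases c with ⟨a, b⟩ | ⟨a, b⟩ | ⟨a, b⟩ | ⟨a, b⟩
      · have h := hne (a + b) hreg
        replace hg : a + b ≤ n * p - 1 + 1 := hg
        replace hlow : ¬ a + b ≤ (n - 1) * p - 1 + 1 := hlow
        by_cases htop : a + b = n * p - 1
        · obtain ⟨j, hj⟩ := exists_mem_block p (m := n) htop (by omega)
          exact ⟨.dX j, ⟨_, hj, rfl⟩⟩
        · refine ⟨.dW (a + b - (n - 1) * p + 1) (by omega) (by omega), ⟨_, ?_, rfl⟩⟩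
          change a + b = _
          omega
      · have h := hne (a + b + 2) hreg
        replace hg : a + b + 2 ≤ n * p - 1 + 1 := hg
        replace hlow : ¬ a + b + 2 ≤ (n - 1) * p - 1 + 1 := hlow
        by_cases hbot : a + b = (n - 1) * p - 1
        · obtain ⟨j, hj⟩ := exists_mem_block p (m := n - 1) hbot (by omega)
          exact ⟨.X j, ⟨_, hj, rfl⟩⟩
        · refine ⟨.W (a + b - (n - 1) * p + 1) (by omega) (by omega), ⟨_, ?_, rfl⟩⟩
          change a + b = _
          omega
      · replace hg : a + b + 1 ≤ n * p - 1 + 1 := hg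
        replace hlow : ¬ a + b + 1 ≤ (n - 1) * p - 1 + 1 := hlow
        have h := eq_of_dvd_of_between hQd (by omega : _ < a + b + 1) (by omega) hreg
        obtain ⟨j, hj⟩ := exists_mem_block p (N := n * p - 1) (m := n) (a := a) (b := b)
          (by omega) (by omega)
        exact ⟨.P j, ⟨Sum.inl (a, b), hj, rfl⟩⟩
      · replace hg : a + b + 1 ≤ n * p - 1 + 1 := hg
        replace hlow : ¬ a + b + 1 ≤ (n - 1) * p - 1 + 1 := hlow
        have h := eq_of_dvd_of_between hQd (by omega : _ < a + b + 1) (by omega) hreg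
        obtain ⟨j, hj⟩ := exists_mem_block p (N := n * p - 1) (m := n) (a := a) (b := b)
          (by omega) (by omega)
        exact ⟨.P j, ⟨Sum.inr (a, b), hj, rfl⟩⟩

end Decomposition

end QPlane

end

/-! ### Identification of each summand and its grade -/

theorem lemma2 (p : ℕ) [p.AtLeastTwo] :
    (∃ N : QPlane.LowSummand p → Submodule (QPlane.Uq p) (QPlane.OneForm p),
      QPlane.IsDirectSum N (QPlane.OneForm.upTo p (p - 1)) ∧
      (∀ r h₁ h₂, N (.dX r h₁ h₂) ≤ QPlane.OneForm.grade p (r - 2) ∧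
        ∃ S ≤ QPlane.Plane.grade p (r - 1), QPlane.IsX p 1 r S ∧
          QPlane.IsExactCopy S (N (.dX r h₁ h₂))) ∧
      (∀ r h₁ h₂, N (.X r h₁ h₂) ≤ QPlane.OneForm.grade p r ∧
        QPlane.IsX p 1 r (N (.X r h₁ h₂))) ∧
      (N .P ≤ QPlane.OneForm.grade p (p - 1) ∧ QPlane.IsP p 1 (p - 1) (N .P))) ∧
    ∀ n : ℕ, 2 ≤ n → ∀ ε : ℤˣ, ε = (-1) ^ (n - 1) →
      ∃ N : QPlane.Summand p n → Submodule (QPlane.Uq p) (QPlane.OneForm p),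
        QPlane.IsDirectSum N (QPlane.OneForm.upTo p (n * p - 1)) ∧
        N .lower = QPlane.OneForm.upTo p ((n - 1) * p - 1) ∧
        (∀ r h₁ h₂, N (.dW r h₁ h₂) ≤ QPlane.OneForm.grade p ((n - 1) * p + r - 2) ∧
          ∃ S ≤ QPlane.Plane.grade p ((n - 1) * p + r - 1),
            QPlane.IsW p ε r n S ∧ QPlane.IsExactCopy S (N (.dW r h₁ h₂))) ∧
        (∀ j, N (.dX j) ≤ QPlane.OneForm.grade p (n * p - 2) ∧
          ∃ S ≤ QPlane.Plane.grade p (n * p - 1), QPlane.IsX p ε p S ∧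
            QPlane.IsExactCopy S (N (.dX j))) ∧
        (∀ j, N (.X j) ≤ QPlane.OneForm.grade p ((n - 1) * p) ∧
          QPlane.IsX p (-ε) p (N (.X j))) ∧
        (∀ r h₁ h₂, N (.W r h₁ h₂) ≤ QPlane.OneForm.grade p ((n - 1) * p + r) ∧
          QPlane.IsW p ε r n (N (.W r h₁ h₂))) ∧
        (∀ j, N (.P j) ≤ QPlane.OneForm.grade p (n * p - 1) ∧
          QPlane.IsP p ε (p - 1) (N (.P j))) := by
  have hp := QPlane.two_le p
  refine ⟨⟨QPlane.lowSummand p, QPlane.isDirectSum_lowSummand p, fun r h₁ h₂ => ⟨?_, ?_⟩,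
    fun r h₁ h₂ => ⟨?_, ?_⟩, ?_, ?_⟩, fun n hn ε hε => ⟨QPlane.summand p n hn,
    QPlane.isDirectSum_summand p n hn, rfl, fun r h₁ h₂ => ⟨?_, ?_⟩, fun j => ⟨?_, ?_⟩,
    fun j => ⟨?_, ?_⟩, fun r h₁ h₂ => ⟨?_, ?_⟩, fun j => ⟨?_, ?_⟩⟩⟩
  · refine QPlane.map_d_le_grade fun a b h => ?_
    replace h : a + b = r - 1 := h
    omega
  · exact ⟨_, QPlane.Plane.sub_le_grade fun a b h => h,
      QPlane.Plane.isX_diag (by omega) h₂ (QPlane.isStable_diag p _),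
      QPlane.isExactCopy_map _
        (QPlane.not_dvd_of_between (dvd_zero p) (by omega) (by omega)) fun i h => h⟩
  · refine QPlane.map_theta_le_grade fun a b h => ?_
    replace h : a + b = r - 1 := h
    omega
  · obtain ⟨f⟩ := QPlane.exists_equiv_map_theta (QPlane.isStable_diag p (r - 1))
      (QPlane.not_dvd_of_between (dvd_zero p) (by omega) (by omega)) fun i h => h
    exact (QPlane.Plane.isX_diag h₁ (by omega) _).of_equiv f
  · exact QPlane.OneForm.sub_le_grade (hS := QPlane.isStable_block_low p) fun a b h => h.1
  · exact QPlane.OneForm.isP_block (n := 1) le_rfl (by simp) one_pos (by omega)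
      (QPlane.isStable_block_low p)
  all_goals
    have hQ := QPlane.pred_mul_add (by omega : 1 ≤ n) p
    have hQ1 : 1 * p ≤ (n - 1) * p := Nat.mul_le_mul_right p (by omega)
    have hQd : p ∣ (n - 1) * p := dvd_mul_left _ _
  · refine QPlane.map_d_le_grade fun a b h => ?_
    replace h : a + b = (n - 1) * p + r - 1 := h
    omega
  · exact ⟨_, QPlane.Plane.sub_le_grade fun a b h => h,
      QPlane.Plane.isW_diag (by omega) hε (by omega) (by omega) (by omega)
        (QPlane.isStable_diag p _),
      QPlane.isExactCopy_map _
        (QPlane.not_dvd_of_between hQd (by omega) (by omega)) fun i h => h⟩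
  · refine QPlane.map_d_le_grade fun a b h => ?_
    have h' : a + b = n * p - 1 := h.1
    omega
  · exact ⟨_, QPlane.Plane.sub_le_grade fun a b h => h.1,
      QPlane.Plane.isX_block (by omega) hε j.2 (by omega) (QPlane.isStable_block_top p n hn j),
      QPlane.isExactCopy_map _
        (QPlane.not_dvd_of_between hQd (by omega) (by omega)) fun i h => h.1⟩
  · refine QPlane.map_theta_le_grade fun a b h => ?_
    have h' : a + b = (n - 1) * p - 1 := h.1
    omega
  · obtain ⟨f⟩ := QPlane.exists_equiv_map_theta (QPlane.isStable_block_bottom p n hn j)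
      (QPlane.not_dvd_of_between hQd (by omega) (by omega)) fun i h => h.1
    refine (QPlane.Plane.isX_block (n := n - 1) (by omega) ?_ j.2 (by omega) _).of_equiv f
    -- The source degree $(n-1)p-1$ belongs to the previous range, so the sign is
    -- $(-1)^{n-2}=-\varepsilon$.
    rw [hε, ← mul_neg_one, ← pow_succ, show n - 1 + 1 = n - 1 - 1 + 2 by omega, pow_add]
    simp
  · refine QPlane.map_theta_le_grade fun a b h => ?_
    replace h : a + b = (n - 1) * p + r - 1 := h
    omega
  · obtain ⟨f⟩ := QPlane.exists_equiv_map_theta (QPlane.isStable_diag p ((n - 1) * p + r - 1))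
      (QPlane.not_dvd_of_between hQd (by omega) (by omega)) fun i h => h
    exact (QPlane.Plane.isW_diag (by omega) hε h₁ (by omega) (by omega) _).of_equiv f
  · exact QPlane.OneForm.sub_le_grade (hS := QPlane.isStable_block_top p n hn j) fun a b h => h.1
  · exact QPlane.OneForm.isP_block (by omega) hε j.2 (by omega)
      (QPlane.isStable_block_top p n hn j)
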